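/- **Conventions.** Let $\mathsf D$ be an exact category (in the sense of Quillen), with its class of short exact sequences $X\hookrightarrow Y\twoheadrightarrow Z$ (conflations), and let $\mathsf C\subset\mathsf D$ be a full additive subcategory, closed under isomorphisms and under extensions, with the induced exact structure. Fix an infinite cardinal $\kappa$. * $\mathrm{Lex}(\mathsf D)$ is the abelian category of presheaves of abelian groups on $\mathsf D$ that send every conflation $X\hookrightarrow Y\twoheadrightarrow Z$ to an exact sequence $0\to F(Z)\to F(Y)\to F(X)$; $\mathsf D$ is embedded in it by the Yoneda functor. $\mathsf{Ind}(\mathsf D,\mathsf C)\subset\mathrm{Lex}(\mathsf D)$ is the full subcategory of objects isomorphic to $\varinjlim_{i\in I}X_i$, where $I$ is a non-empty directed poset with $|I|\le\kappa$ and $X\colon I\to\mathsf D$ is a functor such that for all $i<j$ the map $X_i\to X_j$ is an admissible monomorphism with cokernel $X_j/X_i\in\mathsf C$. Its conflations are the sequences that are short exact in $\mathrm{Lex}(\mathsf D)$. Put $\mathsf{Ind}(\mathsf D)=\mathsf{Ind}(\mathsf D,\mathsf D)$, $\mathsf{Pro}(\mathsf D)=\mathsf{Ind}(\mathsf D^{\mathrm{op}})^{\mathrm{op}}$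 and $\mathsf{Tate}^{el}(\mathsf D,\mathsf C)=\mathsf{Ind}(\mathsf{Pro}(\mathsf D),\mathsf C)$, where $\mathsf C$ is viewed in $\mathsf{Pro}(\mathsf D)$ through $\mathsf C\subset\mathsf D\subset\mathsf{Pro}(\mathsf D)$. * A fully faithful exact inclusion $\mathsf A\hookrightarrow\mathsf U$ of exact categories is *left $s$-filtering* if (i) every morphism $X\to Y$ in $\mathsf U$ with $X\in\mathsf A$ factors through an admissible monomorphism $X'\hookrightarrow Y$ with $X'\in\mathsf A$, and (ii) for every admissible epimorphism $G\twoheadrightarrow Z$ in $\mathsf U$ with $Z\in\mathsf A$ and kernel $F$ there are a conflation $X\hookrightarrow Y\twoheadrightarrow Z$ in $\mathsf A$ and a morphism from it to $F\hookrightarrow G\twoheadrightarrow Z$ that is the identity on $Z$. * For such an inclusion, $\mathsf U/\mathsf A$ is the localization of $\mathsf U$ at the finite compositions of admissible monomorphisms with cokernel in $\mathsf A$ and admissible epimorphisms with kernel in $\mathsf A$ (where $\mathsf A$ is identified with its essential image); its conflations are the sequences isomorphic to images of conflations of $\mathsf U$. * The natural functors $\mathsf{Ind}(\mathsf C)\to\mathsf{Ind}(\mathsf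 D,\mathsf C)$ and $\mathsf{Ind}(\mathsf D,\mathsf C)\to\mathsf{Tate}^{el}(\mathsf D,\mathsf C)$ are the functors, unique up to isomorphism, that extend $\mathsf C\subset\mathsf D$, respectively $\mathsf D\subset\mathsf{Pro}(\mathsf D)$, and preserve the colimits of the diagrams above (that is, $\varinjlim X_i\mapsto\varinjlim X_i$). **Proposition.** The categories $\mathsf{Ind}(\mathsf D,\mathsf C)$, $\mathsf{Pro}(\mathsf D)$ and $\mathsf{Tate}^{el}(\mathsf D,\mathsf C)$ are exact, and the inclusions $\mathsf D\hookrightarrow\mathsf{Ind}(\mathsf D,\mathsf C)$ and $\mathsf{Pro}(\mathsf D)\hookrightarrow\mathsf{Tate}^{el}(\mathsf D,\mathsf C)$ are left $s$-filtering. The quotients $\mathsf{Ind}(\mathsf C)/\mathsf C$, $\mathsf{Ind}(\mathsf D,\mathsf C)/\mathsf D$ and $\mathsf{Tate}^{el}(\mathsf D,\mathsf C)/\mathsf{Pro}(\mathsf D)$ are exact categories. The natural functors $\mathsf{Ind}(\mathsf C)\to\mathsf{Ind}(\mathsf D,\mathsf C)$ and $\mathsf{Ind}(\mathsf D,\mathsf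 C)\to\mathsf{Tate}^{el}(\mathsf D,\mathsf C)$ exist, are exact, and induce exact equivalences (equivalences that preserve and reflect conflations) $$\mathsf{Ind}(\mathsf C)/\mathsf C\;\xrightarrow{\ \simeq\ }\;\mathsf{Ind}(\mathsf D,\mathsf C)/\mathsf D\;\xrightarrow{\ \simeq\ }\;\mathsf{Tate}^{el}(\mathsf D,\mathsf C)/\mathsf{Pro}(\mathsf D).$$ -/

import Mathlib

open CategoryTheory CategoryTheory.Limits Opposite

universe w v u v₁ u₁ v₂ u₂

noncomputable section

namespace RelTate

/-! ### Exact categories -/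

/-- A family of composable pairs `X ⟶ Y ⟶ Z` of a category. -/
abbrev PairClass (D : Type u) [Category.{v} D] :=
  ∀ ⦃X Y Z : D⦄, (X ⟶ Y) → (Y ⟶ Z) → Prop

/-- `f` is a kernel of `g` and `g` is a cokernel of `f`. In an abelian category this says that
`0 ⟶ X ⟶ Y ⟶ Z ⟶ 0` is a short exact sequence. -/
def IsKernelCokernelPair {D : Type u} [Category.{v} D] [Preadditive D] {X Y Z : D}
    (f : X ⟶ Y) (g : Y ⟶ Z) : Prop :=
  ∃ h : f ≫ g = 0, Nonempty (IsLimit (KernelFork.ofι f h)) ∧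
    Nonempty (IsColimit (CokernelCofork.ofπ g h))

/-- A class of kernel-cokernel pairs, called conflations (or short exact sequences). -/
structure ConflationClass (D : Type u) [Category.{v} D] [Preadditive D] where
  /-- `Conf f g`: the pair `f`, `g` is a conflation. -/
  Conf : PairClass D
  isKernelCokernelPair : ∀ ⦃X Y Z : D⦄ (f : X ⟶ Y) (g : Y ⟶ Z), Conf f g →
    IsKernelCokernelPair f g

namespace ConflationClass

variable {D : Type u} [Category.{v} D] [Preadditive D] (E : ConflationClass D)

/-- Admissible monomorphisms. -/
def Inflation {X Y : D} (f : X ⟶ Y) : Prop := ∃ (Z : D) (g : Y ⟶ Z), E.Conf f g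

/-- Admissible epimorphisms. -/
def Deflation {Y Z : D} (g : Y ⟶ Z) : Prop := ∃ (X : D) (f : X ⟶ Y), E.Conf f g

/-- `(D, E)` is an exact category in the sense of Quillen. -/
structure IsExact : Prop where
  hasZeroObject : HasZeroObject D
  hasBinaryBiproducts : HasBinaryBiproducts D
  conf_of_iso : ∀ {X Y Z X' Y' Z' : D} {f : X ⟶ Y} {g : Y ⟶ Z} {f' : X' ⟶ Y'} {g' : Y' ⟶ Z'}
    (a : X ≅ X') (b : Y ≅ Y') (c : Z ≅ Z'),
    f ≫ b.hom = a.hom ≫ f' → g ≫ c.hom = b.hom ≫ g' → E.Conf f g → E.Conf f' g'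
  inflation_id : ∀ X : D, E.Inflation (𝟙 X)
  deflation_id : ∀ X : D, E.Deflation (𝟙 X)
  inflation_comp : ∀ {X Y Z : D} (f : X ⟶ Y) (g : Y ⟶ Z),
    E.Inflation f → E.Inflation g → E.Inflation (f ≫ g)
  deflation_comp : ∀ {X Y Z : D} (f : X ⟶ Y) (g : Y ⟶ Z),
    E.Deflation f → E.Deflation g → E.Deflation (f ≫ g)
  exists_pushout : ∀ {X Y X' : D} (i : X ⟶ Y) (f : X ⟶ X'), E.Inflation i →
    ∃ (Y' : D) (f' : Y ⟶ Y') (i' : X' ⟶ Y'), IsPushout i f f' i' ∧ E.Inflation i'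
  exists_pullback : ∀ {Y Z Z' : D} (p : Y ⟶ Z) (f : Z' ⟶ Z), E.Deflation p →
    ∃ (Y' : D) (f' : Y' ⟶ Y) (p' : Y' ⟶ Z'), IsPullback f' p' p f ∧ E.Deflation p'

/-- The objects satisfying `P` form a (strictly full, additive) subcategory of `D` which is
closed under extensions. -/
structure IsExtensionClosed (P : ObjectProperty D) : Prop where
  of_iso : ∀ {X Y : D}, (X ≅ Y) → P X → P Y
  zero : ∀ {X : D}, IsZero X → P X
  extension : ∀ {X Y Z : D} (f : X ⟶ Y) (g : Y ⟶ Z), E.Conf f g → P X → P Z → P Y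

end ConflationClass

theorem IsKernelCokernelPair.of_fullSubcategory {D : Type u} [Category.{v} D] [Preadditive D]
    {P : ObjectProperty D} {X Y Z : P.FullSubcategory} (f : X ⟶ Y) (g : Y ⟶ Z)
    (h : IsKernelCokernelPair f.hom g.hom) : IsKernelCokernelPair f g := by
  obtain ⟨w, ⟨hk⟩, ⟨hc⟩⟩ := h
  have w' : f ≫ g = 0 := P.hom_ext w
  refine ⟨w', ⟨KernelFork.IsLimit.ofι f w' (fun k hk' => ObjectProperty.homMk
    (KernelFork.IsLimit.lift' hk k.hom (congrArg InducedCategory.Hom.hom hk')).1) ?_ ?_⟩,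
    ⟨CokernelCofork.IsColimit.ofπ g w' (fun k hk' => ObjectProperty.homMk
    (CokernelCofork.IsColimit.desc' hc k.hom (congrArg InducedCategory.Hom.hom hk')).1) ?_ ?_⟩⟩
  · intro _ k hk'
    exact P.hom_ext
      (KernelFork.IsLimit.lift' hk k.hom (congrArg InducedCategory.Hom.hom hk')).2
  · intro _ k hk' m hm
    refine P.hom_ext (Fork.IsLimit.hom_ext hk ?_)
    exact (congrArg InducedCategory.Hom.hom hm).trans
      (KernelFork.IsLimit.lift' hk k.hom (congrArg InducedCategory.Hom.hom hk')).2.symm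
  · intro _ k hk'
    exact P.hom_ext
      (CokernelCofork.IsColimit.desc' hc k.hom (congrArg InducedCategory.Hom.hom hk')).2
  · intro _ k hk' m hm
    refine P.hom_ext (Cofork.IsColimit.hom_ext hc ?_)
    exact (congrArg InducedCategory.Hom.hom hm).trans
      (CokernelCofork.IsColimit.desc' hc k.hom (congrArg InducedCategory.Hom.hom hk')).2.symm

theorem IsKernelCokernelPair.op {D : Type u} [Category.{v} D] [Preadditive D] {X Y Z : D}
    {f : X ⟶ Y} {g : Y ⟶ Z} (h : IsKernelCokernelPair f g) :
    IsKernelCokernelPair g.op f.op := by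
  obtain ⟨w, ⟨hk⟩, ⟨hc⟩⟩ := h
  exact ⟨congrArg Quiver.Hom.op w, ⟨CokernelCofork.IsColimit.ofπOp g w hc⟩,
    ⟨KernelFork.IsLimit.ofιOp f w hk⟩⟩

namespace ConflationClass

variable {D : Type u} [Category.{v} D] [Preadditive D] (E : ConflationClass D)

/-- The opposite exact structure. -/
def op : ConflationClass Dᵒᵖ where
  Conf _ _ _ f g := E.Conf g.unop f.unop
  isKernelCokernelPair _ _ _ _ _ h := (E.isKernelCokernelPair _ _ h).op

/-- The exact structure induced on a full subcategory: its conflations are the conflations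
of `D` all of whose terms lie in the subcategory. -/
def restrict (P : ObjectProperty D) : ConflationClass P.FullSubcategory where
  Conf _ _ _ f g := E.Conf f.hom g.hom
  isKernelCokernelPair _ _ _ f g h :=
    IsKernelCokernelPair.of_fullSubcategory f g (E.isKernelCokernelPair _ _ h)

end ConflationClass

/-! ### Exact functors and left s-filtering inclusions -/

/-- The functor `F` is exact, i.e. it maps conflations to conflations. -/
def IsExactFunctor {A : Type u₁} [Category.{v₁} A] [Preadditive A] (EA : ConflationClass A)
    {B : Type u₂} [Category.{v₂} B] [Preadditive B] (EB : ConflationClass B) (F : A ⥤ B) : Prop :=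
  ∀ ⦃X Y Z : A⦄ (f : X ⟶ Y) (g : Y ⟶ Z), EA.Conf f g → EB.Conf (F.map f) (F.map g)

/-- `ι : A ⥤ U` is a fully faithful exact inclusion of exact categories
which is left filtering and left special. -/
structure IsLeftSFiltering {A : Type u₁} [Category.{v₁} A] [Preadditive A]
    (EA : ConflationClass A) {U : Type u₂} [Category.{v₂} U] [Preadditive U]
    (EU : ConflationClass U) (ι : A ⥤ U) : Prop where
  isExact_source : EA.IsExact
  isExact_target : EU.IsExact
  full : ι.Full
  faithful : ι.Faithful
  exact : IsExactFunctor EA EU ι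
  left_filtering : ∀ (X : A) (Y : U) (f : ι.obj X ⟶ Y),
    ∃ (X' : A) (a : X ⟶ X') (i : ι.obj X' ⟶ Y), EU.Inflation i ∧ ι.map a ≫ i = f
  left_special : ∀ (G : U) (Z : A) (p : G ⟶ ι.obj Z), EU.Deflation p →
    ∃ (F : U) (k : F ⟶ G) (X Y : A) (i : X ⟶ Y) (q : Y ⟶ Z) (a : ι.obj X ⟶ F) (b : ι.obj Y ⟶ G),
      EU.Conf k p ∧ EA.Conf i q ∧ ι.map i ≫ b = a ≫ k ∧ b ≫ p = ι.map q

/-! ### Left exact presheaves -/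

section Lex

variable {D : Type u} [Category.{v} D] [Preadditive D] (E : ConflationClass D)

/-- A presheaf of abelian groups is left exact if for every conflation `X ⟶ Y ⟶ Z` the sequence
`0 ⟶ F(Z) ⟶ F(Y) ⟶ F(X)` is exact. -/
def isLeftExact : ObjectProperty (Dᵒᵖ ⥤ AddCommGrpCat.{max u v w}) := fun F =>
  ∀ ⦃X Y Z : D⦄ (f : X ⟶ Y) (g : Y ⟶ Z), E.Conf f g →
    Function.Injective (F.map g.op).hom ∧ Function.Exact (F.map g.op).hom (F.map f.op).hom

/-- The category `Lex(D)` of left exact presheaves on `D`. -/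
abbrev LexCat := (isLeftExact.{w} E).FullSubcategory

/-- The Yoneda embedding into presheaves of abelian groups (in a larger universe). -/
def presheafYoneda : D ⥤ Dᵒᵖ ⥤ AddCommGrpCat.{max u v w} :=
  preadditiveYoneda ⋙ (Functor.whiskeringRight Dᵒᵖ AddCommGrpCat.{v}
    AddCommGrpCat.{max u v w}).obj AddCommGrpCat.uliftFunctor.{max u w, v}

theorem isLeftExact_presheafYoneda (A : D) :
    isLeftExact.{w} E ((presheafYoneda.{w}).obj A) := by
  intro X Y Z f g h
  obtain ⟨hw, -, ⟨hc⟩⟩ := E.isKernelCokernelPair f g h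
  refine ⟨?_, ?_⟩
  · rintro ⟨a⟩ ⟨b⟩ hab
    have hab' : g ≫ a = g ≫ b := congrArg ULift.down hab
    exact congrArg ULift.up (Cofork.IsColimit.hom_ext hc hab')
  · rintro ⟨b⟩
    constructor
    · intro hb
      have hb' : f ≫ b = 0 := congrArg ULift.down hb
      obtain ⟨l, hl⟩ := CokernelCofork.IsColimit.desc' hc b hb'
      exact ⟨⟨l⟩, congrArg ULift.up hl⟩
    · rintro ⟨⟨a⟩, ha⟩
      have ha' : g ≫ a = b := congrArg ULift.down ha
      have hb : f ≫ (show Y ⟶ A from b) = 0 :=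
        (congrArg (f ≫ ·) ha'.symm).trans
          ((Category.assoc f g (show Z ⟶ A from a)).symm.trans
            ((congrArg (· ≫ (show Z ⟶ A from a)) hw).trans zero_comp))
      exact congrArg ULift.up hb

/-- The Yoneda embedding `D ⥤ Lex(D)`. -/
def lexYoneda : D ⥤ LexCat.{w} E :=
  (isLeftExact.{w} E).lift presheafYoneda.{w} (isLeftExact_presheafYoneda E)

end Lex

/-! ### (Relative) admissible Ind objects -/

section Ind

variable {D : Type u} [Category.{v} D] [Preadditive D] (E : ConflationClass D)
  (P : ObjectProperty D) (κ : Cardinal.{w})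

/-- A diagram `X` indexed by a poset is a relative admissible Ind diagram (with respect to the
subcategory of objects satisfying `P`) if for all `i < j` the map `X i ⟶ X j` is an admissible
monomorphism whose cokernel `X j / X i` satisfies `P`. (For `i = j` the map is an identity.)
For `P = ⊤` this is the notion of an admissible Ind diagram. -/
def IsRelIndDiagram {I : Type w} [PartialOrder I] (X : I ⥤ D) : Prop :=
  ∀ ⦃i j : I⦄ (h : i < j), ∃ (Z : D) (g : X.obj j ⟶ Z), E.Conf (X.map (homOfLE h.le)) g ∧ P Z

/-- The left exact presheaves which are colimits in `Lex(D)` of a relative admissible Ind diagram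
indexed by a filtered poset of cardinality at most `κ`. -/
def isRelInd : ObjectProperty (LexCat.{w} E) := fun F =>
  ∃ (I : Type w) (_ : PartialOrder I) (_ : IsDirectedOrder I) (_ : Nonempty I) (X : I ⥤ D),
    Cardinal.mk I ≤ κ ∧ IsRelIndDiagram E P X ∧
      ∃ (c : Cocone (X ⋙ lexYoneda.{w} E)), Nonempty (IsColimit c) ∧ Nonempty (c.pt ≅ F)

/-- The category `Ind(D, C)` of relative admissible Ind objects, where `C` is the full
subcategory of `D` given by `P`. For `P = ⊤` this is the category `Ind(D)` of admissible
Ind objects. -/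
abbrev RelInd := (isRelInd E P κ).FullSubcategory

/-- The conflations of `Ind(D, C)`: the sequences which are short exact in `Lex(D)`. -/
def relIndClass : ConflationClass (RelInd E P κ) where
  Conf _ _ _ f g := IsKernelCokernelPair f.hom g.hom
  isKernelCokernelPair _ _ _ f g h := IsKernelCokernelPair.of_fullSubcategory f g h

variable {κ} in
theorem isRelInd_lexYoneda (hκ : Cardinal.aleph0 ≤ κ) (A : D) :
    isRelInd E P κ ((lexYoneda.{w} E).obj A) := by
  refine ⟨PUnit, inferInstance, inferInstance, inferInstance, (Functor.const _).obj A, ?_, ?_,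
    _, ⟨colimitOfDiagramTerminal (isTerminalTop : IsTerminal (⊤ : PUnit.{w + 1})) _⟩,
    ⟨Iso.refl _⟩⟩
  · rw [Cardinal.mk_punit]
    exact Cardinal.one_le_aleph0.trans hκ
  · intro i j h
    exact absurd h (by simp)

variable {κ} in
/-- The inclusion `D ⥤ Ind(D, C)`. -/
def toRelInd (hκ : Cardinal.aleph0 ≤ κ) : D ⥤ RelInd E P κ :=
  (isRelInd E P κ).lift (lexYoneda.{w} E) (isRelInd_lexYoneda E P hκ)

end Ind

/-- `J : Ind(A, P) ⥤ Ind(B, P')` is the canonical functor induced by `φ : A ⥤ B`, sending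
`colim X i` to `colim φ (X i)`: it extends `φ` and it preserves the colimits of relative
admissible Ind diagrams. These properties determine `J` up to isomorphism. -/
structure IsIndExtension {A : Type u₁} [Category.{v₁} A] [Preadditive A] (EA : ConflationClass A)
    (P : ObjectProperty A) {B : Type u₂} [Category.{v₂} B] [Preadditive B]
    (EB : ConflationClass B) (P' : ObjectProperty B) {κ : Cardinal.{w}}
    (hκ : Cardinal.aleph0 ≤ κ) (φ : A ⥤ B) (J : RelInd EA P κ ⥤ RelInd EB P' κ) : Prop where
  extends_functor : Nonempty (toRelInd EA P hκ ⋙ J ≅ φ ⋙ toRelInd EB P' hκ)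
  preserves : ∀ (I : Type w) [PartialOrder I] [IsDirectedOrder I] [Nonempty I] (X : I ⥤ A),
    Cardinal.mk I ≤ κ → IsRelIndDiagram EA P X → PreservesColimit (X ⋙ toRelInd EA P hκ) J

/-! ### Admissible Pro objects and relative elementary Tate objects -/

section Tate

variable {D : Type u} [Category.{v} D] [Preadditive D] (E : ConflationClass D)
  (P : ObjectProperty D) (κ : Cardinal.{w})

/-- The category `Pro(D) = Ind(Dᵒᵖ)ᵒᵖ` of admissible Pro objects. -/
abbrev ProCat := (RelInd E.op ⊤ κ)ᵒᵖ

/-- The conflations of `Pro(D)`. -/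
def proClass : ConflationClass (ProCat E κ) := (relIndClass E.op ⊤ κ).op

variable {κ} in
/-- The inclusion `D ⥤ Pro(D)`. -/
def toPro (hκ : Cardinal.aleph0 ≤ κ) : D ⥤ ProCat E κ :=
  (toRelInd E.op ⊤ hκ).rightOp

variable {κ} in
/-- The category `Tate^el(D, C) = Ind(Pro(D), C)` of relative elementary Tate objects;
here `C` is viewed as a subcategory of `Pro(D)` through `D ⥤ Pro(D)`. -/
abbrev ElTate (hκ : Cardinal.aleph0 ≤ κ) :=
  RelInd (proClass E κ) (P.map (toPro E hκ)) κ

variable {κ} in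
/-- The conflations of `Tate^el(D, C)`. -/
def elTateClass (hκ : Cardinal.aleph0 ≤ κ) : ConflationClass (ElTate E P hκ) :=
  relIndClass (proClass E κ) (P.map (toPro E hκ)) κ

variable {κ} in
/-- The inclusion `Pro(D) ⥤ Tate^el(D, C)`. -/
def proToElTate (hκ : Cardinal.aleph0 ≤ κ) : ProCat E κ ⥤ ElTate E P hκ :=
  toRelInd (proClass E κ) (P.map (toPro E hκ)) hκ

end Tate

/-! ### Quotients of exact categories -/

section Quotient

variable {U : Type u₁} [Category.{v₁} U] [Preadditive U] (EU : ConflationClass U)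
  (A : ObjectProperty U)

/-- Weak isomorphisms: finite compositions of admissible monomorphisms with cokernel in `A` and
of admissible epimorphisms with kernel in `A`. -/
def weakIso : MorphismProperty U :=
  MorphismProperty.multiplicativeClosure fun X Y f =>
    (∃ (Z : U) (g : Y ⟶ Z), EU.Conf f g ∧ A Z) ∨ (∃ (K : U) (k : K ⟶ X), EU.Conf k f ∧ A K)

/-- The quotient category `U / A`: the localization of `U` at the weak isomorphisms. -/
abbrev Quot := (weakIso EU A).Localization

/-- The localization functor `U ⥤ U / A`. -/
abbrev toQuot : U ⥤ Quot EU A := (weakIso EU A).Q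

/-- The conflations of `U / A`: the sequences isomorphic to the image of a conflation of `U`. -/
def quotConf : PairClass (Quot EU A) := fun X Y Z f g =>
  ∃ (X' Y' Z' : U) (f' : X' ⟶ Y') (g' : Y' ⟶ Z') (a : (toQuot EU A).obj X' ≅ X)
    (b : (toQuot EU A).obj Y' ≅ Y) (c : (toQuot EU A).obj Z' ≅ Z), EU.Conf f' g' ∧
      (toQuot EU A).map f' ≫ b.hom = a.hom ≫ f ∧ (toQuot EU A).map g' ≫ c.hom = b.hom ≫ g

/-- `U / A`, with its class of conflations, is an exact category
(and the localization functor is additive). -/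
def QuotIsExact : Prop :=
  ∃ (_ : Preadditive (Quot EU A)) (E : ConflationClass (Quot EU A)),
    (toQuot EU A).Additive ∧ E.Conf = quotConf EU A ∧ E.IsExact

/-- The functor `J : U ⥤ V` induces an exact equivalence `U / A ⥤ V / B`, that is, an
equivalence which preserves and reflects conflations. -/
def InducesExactEquivalence {V : Type u₂} [Category.{v₂} V] [Preadditive V]
    (EV : ConflationClass V) (B : ObjectProperty V) (J : U ⥤ V) : Prop :=
  ∃ F : Quot EU A ⥤ Quot EV B, Nonempty (toQuot EU A ⋙ F ≅ J ⋙ toQuot EV B) ∧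
    F.IsEquivalence ∧ ∀ ⦃X Y Z : Quot EU A⦄ (f : X ⟶ Y) (g : Y ⟶ Z),
      quotConf EU A f g ↔ quotConf EV B (F.map f) (F.map g)

end Quotient

end RelTate

end

noncomputable section

namespace RelTate

/-! ### Kernel-cokernel pairs -/

namespace IsKernelCokernelPair

variable {D : Type u} [Category.{v} D] [Preadditive D] {X Y Z : D} {f : X ⟶ Y} {g : Y ⟶ Z}

theorem w (h : IsKernelCokernelPair f g) : f ≫ g = 0 := h.1

theorem mono (h : IsKernelCokernelPair f g) : Mono f := by
  obtain ⟨w, ⟨hk⟩, -⟩ := h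
  exact ⟨fun a b hab => Fork.IsLimit.hom_ext hk hab⟩

theorem epi (h : IsKernelCokernelPair f g) : Epi g := by
  obtain ⟨w, -, ⟨hc⟩⟩ := h
  exact ⟨fun a b hab => Cofork.IsColimit.hom_ext hc hab⟩

theorem exists_lift (h : IsKernelCokernelPair f g) {T : D} (k : T ⟶ Y) (hk : k ≫ g = 0) :
    ∃ l : T ⟶ X, l ≫ f = k := by
  obtain ⟨w, ⟨hl⟩, -⟩ := h
  exact ⟨_, (KernelFork.IsLimit.lift' hl k hk).2⟩

theorem exists_desc (h : IsKernelCokernelPair f g) {T : D} (k : Y ⟶ T) (hk : f ≫ k = 0) :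
    ∃ l : Z ⟶ T, g ≫ l = k := by
  obtain ⟨w, -, ⟨hl⟩⟩ := h
  exact ⟨_, (CokernelCofork.IsColimit.desc' hl k hk).2⟩

theorem of_exists (w : f ≫ g = 0) (hf : Mono f) (hg : Epi g)
    (lift : ∀ ⦃T : D⦄ (k : T ⟶ Y), k ≫ g = 0 → ∃ l : T ⟶ X, l ≫ f = k)
    (desc : ∀ ⦃T : D⦄ (k : Y ⟶ T), f ≫ k = 0 → ∃ l : Z ⟶ T, g ≫ l = k) :
    IsKernelCokernelPair f g :=
  ⟨w, ⟨KernelFork.IsLimit.ofι f w (fun k hk => (lift k hk).choose)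
      (fun k hk => (lift k hk).choose_spec)
      (fun k hk m hm => by rw [← cancel_mono f, hm, (lift k hk).choose_spec])⟩,
    ⟨CokernelCofork.IsColimit.ofπ g w (fun k hk => (desc k hk).choose)
      (fun k hk => (desc k hk).choose_spec)
      (fun k hk m hm => by rw [← cancel_epi g, hm, (desc k hk).choose_spec])⟩⟩

theorem of_iso {X' Y' Z' : D} {f' : X' ⟶ Y'} {g' : Y' ⟶ Z'}
    (a : X ≅ X') (b : Y ≅ Y') (c : Z ≅ Z') (hf : f ≫ b.hom = a.hom ≫ f')
    (hg : g ≫ c.hom = b.hom ≫ g') (h : IsKernelCokernelPair f g) :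
    IsKernelCokernelPair f' g' := by
  have := h.mono
  have := h.epi
  have hf' : f' = a.inv ≫ f ≫ b.hom := by rw [hf, Iso.inv_hom_id_assoc]
  have hg' : g' = b.inv ≫ g ≫ c.hom := by rw [hg, Iso.inv_hom_id_assoc]
  refine of_exists ?_ ?_ ?_ ?_ ?_
  · rw [hf', hg']
    simp [reassoc_of% h.w]
  · rw [hf']; infer_instance
  · rw [hg']; infer_instance
  · intro T k hk
    obtain ⟨l, hl⟩ := h.exists_lift (k ≫ b.inv) (by
      rw [← cancel_mono c.hom]; simpa [hg'] using hk)
    exact ⟨l ≫ a.hom, by rw [hf']; simp [reassoc_of% hl]⟩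
  · intro T k hk
    obtain ⟨l, hl⟩ := h.exists_desc (b.hom ≫ k) (by
      rw [← cancel_epi a.inv]; simpa [hf'] using hk)
    exact ⟨c.inv ≫ l, by rw [hg']; simp [hl]⟩

/-- Two cokernels of the same morphism are isomorphic. -/
theorem exists_iso {Z' : D} {g' : Y ⟶ Z'} (h : IsKernelCokernelPair f g) (w : f ≫ g' = 0)
    (hg' : Epi g') (desc : ∀ ⦃T : D⦄ (k : Y ⟶ T), f ≫ k = 0 → ∃ l : Z' ⟶ T, g' ≫ l = k) :
    ∃ e : Z ≅ Z', g ≫ e.hom = g' := by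
  have := h.epi
  obtain ⟨a, ha⟩ := h.exists_desc g' w
  obtain ⟨b, hb⟩ := desc g h.w
  exact ⟨⟨a, b, by rw [← cancel_epi g, reassoc_of% ha, hb, Category.comp_id],
    by rw [← cancel_epi g', reassoc_of% hb, ha, Category.comp_id]⟩, ha⟩

/-- Two kernels of the same morphism are isomorphic. -/
theorem exists_iso' {X' : D} {f' : X' ⟶ Y} (h : IsKernelCokernelPair f g) (w : f' ≫ g = 0)
    (hf' : Mono f') (lift : ∀ ⦃T : D⦄ (k : T ⟶ Y), k ≫ g = 0 → ∃ l : T ⟶ X', l ≫ f' = k) :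
    ∃ e : X' ≅ X, e.hom ≫ f = f' := by
  have := h.mono
  obtain ⟨a, ha⟩ := h.exists_lift f' w
  obtain ⟨b, hb⟩ := lift f h.w
  exact ⟨⟨a, b, by rw [← cancel_mono f', Category.assoc, hb, ha, Category.id_comp],
    by rw [← cancel_mono f, Category.assoc, ha, hb, Category.id_comp]⟩, ha⟩

end IsKernelCokernelPair

/-! ### Exact categories -/

namespace ConflationClass

variable {D : Type u} [Category.{v} D] [Preadditive D] {E : ConflationClass D}

theorem Conf.pair {X Y Z : D} {f : X ⟶ Y} {g : Y ⟶ Z} (h : E.Conf f g) :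
    IsKernelCokernelPair f g := E.isKernelCokernelPair f g h

theorem IsExact.op (hE : E.IsExact) : E.op.IsExact where
  hasZeroObject := by
    have := hE.hasZeroObject
    infer_instance
  hasBinaryBiproducts := by
    have := hE.hasBinaryBiproducts
    infer_instance
  conf_of_iso {_ _ _ _ _ _ f g f' g'} a b c h₁ h₂ h := by
    refine hE.conf_of_iso c.unop.symm b.unop.symm a.unop.symm ?_ ?_ h
    · have : b.inv ≫ g = g' ≫ c.inv := by
        rw [Iso.inv_comp_eq, ← Category.assoc, ← h₂, Category.assoc, Iso.hom_inv_id,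
          Category.comp_id]
      exact congrArg Quiver.Hom.unop this
    · have : a.inv ≫ f = f' ≫ b.inv := by
        rw [Iso.inv_comp_eq, ← Category.assoc, ← h₁, Category.assoc, Iso.hom_inv_id,
          Category.comp_id]
      exact congrArg Quiver.Hom.unop this
  inflation_id X := by
    obtain ⟨K, k, h⟩ := hE.deflation_id X.unop
    exact ⟨_, k.op, h⟩
  deflation_id X := by
    obtain ⟨K, k, h⟩ := hE.inflation_id X.unop
    exact ⟨_, k.op, h⟩
  inflation_comp := by
    rintro X Y Z f g ⟨A, a, ha⟩ ⟨B, b, hb⟩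
    obtain ⟨K, k, h⟩ := hE.deflation_comp g.unop f.unop ⟨_, _, hb⟩ ⟨_, _, ha⟩
    exact ⟨_, k.op, h⟩
  deflation_comp := by
    rintro X Y Z f g ⟨A, a, ha⟩ ⟨B, b, hb⟩
    obtain ⟨K, k, h⟩ := hE.inflation_comp g.unop f.unop ⟨_, _, hb⟩ ⟨_, _, ha⟩
    exact ⟨_, k.op, h⟩
  exists_pushout := by
    rintro X Y X' i f ⟨Z, p, hp⟩
    obtain ⟨W, a, b, h, ⟨K, k, hk⟩⟩ := hE.exists_pullback i.unop f.unop ⟨_, _, hp⟩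
    exact ⟨_, a.op, b.op, h.op.flip, ⟨_, k.op, hk⟩⟩
  exists_pullback := by
    rintro X Y X' i f ⟨Z, p, hp⟩
    obtain ⟨W, a, b, h, ⟨K, k, hk⟩⟩ := hE.exists_pushout i.unop f.unop ⟨_, _, hp⟩
    exact ⟨_, a.op, b.op, h.op.flip, ⟨_, k.op, hk⟩⟩

theorem op_op_conf {X Y Z : D} {f : X ⟶ Y} {g : Y ⟶ Z} :
    E.op.Conf g.op f.op ↔ E.Conf f g := Iff.rfl

namespace IsExact

variable (hE : E.IsExact)
include hE

theorem conf_iso_left {X X' Y Z : D} {f : X ⟶ Y} {g : Y ⟶ Z} (h : E.Conf f g) (e : X' ≅ X) :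
    E.Conf (e.hom ≫ f) g :=
  hE.conf_of_iso e.symm (Iso.refl _) (Iso.refl _) (by simp) (by simp) h

theorem conf_iso_right {X Y Z Z' : D} {f : X ⟶ Y} {g : Y ⟶ Z} (h : E.Conf f g) (e : Z ≅ Z') :
    E.Conf f (g ≫ e.hom) :=
  hE.conf_of_iso (Iso.refl _) (Iso.refl _) e (by simp) (by simp) h

theorem conf_iso_mid {X Y Y' Z : D} {f : X ⟶ Y} {g : Y ⟶ Z} (h : E.Conf f g) (e : Y ≅ Y') :
    E.Conf (f ≫ e.hom) (e.inv ≫ g) :=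
  hE.conf_of_iso (Iso.refl _) e (Iso.refl _) (by simp) (by simp) h

/-- A cokernel of an inflation forms a conflation with it. -/
theorem conf_of_inflation {X Y Z : D} {f : X ⟶ Y} {g : Y ⟶ Z} (hf : E.Inflation f)
    (w : f ≫ g = 0) (hg : Epi g)
    (desc : ∀ ⦃T : D⦄ (k : Y ⟶ T), f ≫ k = 0 → ∃ l : Z ⟶ T, g ≫ l = k) : E.Conf f g := by
  obtain ⟨Z', g', h⟩ := hf
  obtain ⟨e, he⟩ := h.pair.exists_iso w hg desc
  rw [← he]
  exact hE.conf_iso_right h e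

theorem conf_of_deflation {X Y Z : D} {f : X ⟶ Y} {g : Y ⟶ Z} (hg : E.Deflation g)
    (w : f ≫ g = 0) (hf : Mono f)
    (lift : ∀ ⦃T : D⦄ (k : T ⟶ Y), k ≫ g = 0 → ∃ l : T ⟶ X, l ≫ f = k) : E.Conf f g := by
  obtain ⟨X', f', h⟩ := hg
  obtain ⟨e, he⟩ := h.pair.exists_iso' w hf lift
  rw [← he]
  exact hE.conf_iso_left h e

theorem conf_id_zero (X : D) {O : D} (hO : IsZero O) : E.Conf (𝟙 X) (0 : X ⟶ O) :=
  hE.conf_of_inflation (hE.inflation_id X) (by simp) ⟨fun _ _ _ => hO.eq_of_src _ _⟩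
    (fun T k hk => ⟨0, by simpa using hk.symm⟩)

theorem conf_zero_id (X : D) {O : D} (hO : IsZero O) : E.Conf (0 : O ⟶ X) (𝟙 X) :=
  hE.conf_of_deflation (hE.deflation_id X) (by simp) ⟨fun _ _ _ => hO.eq_of_tgt _ _⟩
    (fun T k hk => ⟨0, by simpa using hk.symm⟩)

theorem conf_iso_zero {X Y : D} (f : X ⟶ Y) [IsIso f] {O : D} (hO : IsZero O) :
    E.Conf f (0 : Y ⟶ O) :=
  hE.conf_of_iso (Iso.refl X) (asIso f) (Iso.refl O) (by simp) (by simp) (hE.conf_id_zero X hO)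

omit hE in
theorem isIso_of_conf_zero {X Y Z : D} {f : X ⟶ Y} {g : Y ⟶ Z} (h : E.Conf f g)
    (hZ : IsZero Z) : IsIso f := by
  have := h.pair.mono
  obtain ⟨l, hl⟩ := h.pair.exists_lift (𝟙 Y) (hZ.eq_of_tgt _ _)
  exact ⟨l, by rw [← cancel_mono f, Category.assoc, hl]; simp, hl⟩

/-- Pushouts of conflations. -/
theorem exists_pushout_conf {X Y Z X' : D} {i : X ⟶ Y} {p : Y ⟶ Z} (h : E.Conf i p)
    (f : X ⟶ X') : ∃ (Y' : D) (f' : Y ⟶ Y') (i' : X' ⟶ Y') (p' : Y' ⟶ Z),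
      IsPushout i f f' i' ∧ E.Conf i' p' ∧ f' ≫ p' = p := by
  obtain ⟨Y', f', i', hp, hi'⟩ := hE.exists_pushout i f ⟨Z, p, h⟩
  have hw : i ≫ p = f ≫ (0 : X' ⟶ Z) := by rw [h.pair.w, comp_zero]
  have := h.pair.epi
  refine ⟨Y', f', i', hp.desc p 0 hw, hp, ?_, by simp⟩
  refine hE.conf_of_inflation hi' (by simp) ?_ ?_
  · refine ⟨fun a b hab => ?_⟩
    have := congrArg (f' ≫ ·) hab
    simpa [cancel_epi] using this
  · intro T k hk
    obtain ⟨l, hl⟩ := h.pair.exists_desc (f' ≫ k) (by rw [hp.w_assoc, hk, comp_zero])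
    exact ⟨l, hp.hom_ext (by simp [hl]) (by simp [hk])⟩

/-- Pullbacks of conflations. -/
theorem exists_pullback_conf {X Y Z Z' : D} {i : X ⟶ Y} {p : Y ⟶ Z} (h : E.Conf i p)
    (f : Z' ⟶ Z) : ∃ (Y' : D) (f' : Y' ⟶ Y) (p' : Y' ⟶ Z') (i' : X ⟶ Y'),
      IsPullback f' p' p f ∧ E.Conf i' p' ∧ i' ≫ f' = i := by
  obtain ⟨Y', f', p', i', hp, h', e⟩ := hE.op.exists_pushout_conf (op_op_conf.2 h) f.op
  exact ⟨Y'.unop, f'.unop, p'.unop, i'.unop, hp.unop.flip, h', congrArg Quiver.Hom.unop e⟩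

/-- The short five lemma, for identities. -/
theorem isIso_of_conf {X Y Y' Z : D} {i : X ⟶ Y} {p : Y ⟶ Z} {i' : X ⟶ Y'} {p' : Y' ⟶ Z}
    (h : E.Conf i p) (h' : E.Conf i' p') (b : Y ⟶ Y') (hi : i ≫ b = i') (hp : b ≫ p' = p) :
    IsIso b := by
  have := h.pair.mono
  have := h'.pair.mono
  have hb : Mono b := by
    refine Preadditive.mono_of_cancel_zero _ (fun k hk => ?_)
    obtain ⟨l, rfl⟩ := h.pair.exists_lift k (by rw [← hp, reassoc_of% hk, zero_comp])
    rw [Category.assoc, hi] at hk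
    rw [(cancel_mono i').1 (hk.trans zero_comp.symm), zero_comp]
  -- Over the pullback `Q` of `p` and `p'`, the discrepancy `q₁ - q₂ ≫ b` is killed by `p'` and so
  -- comes from `X`. Correcting `q₂` by it gives a lift of `q₁` through `b`, which descends along
  -- the deflation `q₁` to an inverse of `b`.
  obtain ⟨Q, q₂, q₁, k, hQ, hk, hkq⟩ := hE.exists_pullback_conf h p'
  obtain ⟨e, he⟩ := h'.pair.exists_lift (q₁ - q₂ ≫ b) (by simp [hp, hQ.w])
  have := hk.pair.epi
  have hr : (q₂ + e ≫ i) ≫ b = q₁ := by simp [hi, he]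
  have hkr : k ≫ (q₂ + e ≫ i) = 0 := by
    rw [← cancel_mono b, Category.assoc, hr, hk.pair.w, zero_comp]
  obtain ⟨s, hs⟩ := hk.pair.exists_desc _ hkr
  have hsb : s ≫ b = 𝟙 _ := by rw [← cancel_epi q₁, reassoc_of% hs, hr, Category.comp_id]
  exact ⟨s, by rw [← cancel_mono b, Category.assoc, hsb]; simp, hsb⟩

/-- The composition of two inflations, with the induced conflation of the cokernels. -/
theorem conf_comp {X Y Z A B : D} {f : X ⟶ Y} {p : Y ⟶ A} {g : Y ⟶ Z} {q : Z ⟶ B}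
    (hf : E.Conf f p) (hg : E.Conf g q) :
    ∃ (Q : D) (r : Z ⟶ Q) (a : A ⟶ Q) (b : Q ⟶ B),
      E.Conf (f ≫ g) r ∧ E.Conf a b ∧ p ≫ a = g ≫ r ∧ r ≫ b = q := by
  obtain ⟨Q, r, a, b, hp, hab, hb⟩ := hE.exists_pushout_conf hg p
  have := hf.pair.epi
  refine ⟨Q, r, a, b, ?_, hab, hp.w.symm, hb⟩
  refine hE.conf_of_inflation (hE.inflation_comp f g ⟨_, _, hf⟩ ⟨_, _, hg⟩) ?_ ?_ ?_
  · rw [Category.assoc, hp.w, reassoc_of% hf.pair.w, zero_comp]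
  · refine ⟨fun s t hst => hp.hom_ext hst ?_⟩
    rw [← cancel_epi p, ← Category.assoc, ← hp.w, ← Category.assoc, ← hp.w]
    simp [hst]
  · intro T k hk
    obtain ⟨l, hl⟩ := hf.pair.exists_desc (g ≫ k) (by simpa using hk)
    exact ⟨hp.desc k l hl.symm, by simp⟩

/-- The composition of two deflations, with the induced conflation of the kernels. -/
theorem conf_comp' {X Y Z K M : D} {p : X ⟶ Y} {k : K ⟶ X} {q : Y ⟶ Z} {m : M ⟶ Y}
    (hp : E.Conf k p) (hq : E.Conf m q) :
    ∃ (N : D) (n : N ⟶ X) (a : K ⟶ N) (b : N ⟶ M),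
      E.Conf n (p ≫ q) ∧ E.Conf a b ∧ a ≫ n = k ∧ b ≫ m = n ≫ p := by
  obtain ⟨Q, r, a, b, h₁, h₂, h₃, h₄⟩ := hE.op.conf_comp (op_op_conf.2 hq) (op_op_conf.2 hp)
  exact ⟨Q.unop, r.unop, b.unop, a.unop, h₁, h₂, congrArg Quiver.Hom.unop h₄,
    congrArg Quiver.Hom.unop h₃⟩

/-- A morphism of conflations which is the identity on the kernels and an inflation on the
cokernels. -/
theorem conf_of_left_id {X V W Z Z' C : D} {i : X ⟶ V} {p : V ⟶ Z} {i' : X ⟶ W} {p' : W ⟶ Z'}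
    (h : E.Conf i p) (h' : E.Conf i' p') {b : V ⟶ W} {c : Z ⟶ Z'} {d : Z' ⟶ C} (hc : E.Conf c d)
    (hi : i ≫ b = i') (hp : p ≫ c = b ≫ p') : E.Conf b (p' ≫ d) := by
  -- The kernel `N` of `p' ≫ d` is an extension of `Z` by `X`, and so is `V`; the five lemma
  -- identifies the two.
  obtain ⟨N, n, j, q, hn, hjq, hj, hq⟩ := hE.conf_comp' h' hc
  have := hn.pair.mono
  have := hc.pair.mono
  obtain ⟨l, hl⟩ := hn.pair.exists_lift b (by
    rw [← Category.assoc, ← hp, Category.assoc, hc.pair.w, comp_zero])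
  have : IsIso l := hE.isIso_of_conf h hjq l (by rw [← cancel_mono n, Category.assoc, hl, hi, hj])
    (by rw [← cancel_mono c, Category.assoc, hq, hp, reassoc_of% hl])
  rw [← hl]
  exact hE.conf_iso_left hn (asIso l)

/-- A morphism of conflations whose outer components are inflations. -/
theorem conf_mid {X Y Z X' Y' Z' A C : D} {i : X ⟶ Y} {p : Y ⟶ Z} {i' : X' ⟶ Y'} {p' : Y' ⟶ Z'}
    (h : E.Conf i p) (h' : E.Conf i' p') {a : X ⟶ X'} {b : Y ⟶ Y'} {c : Z ⟶ Z'}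
    {a' : X' ⟶ A} {c' : Z' ⟶ C} (ha : E.Conf a a') (hc : E.Conf c c')
    (hi : i ≫ b = a ≫ i') (hp : p ≫ c = b ≫ p') :
    ∃ (B : D) (b' : Y' ⟶ B) (j : A ⟶ B) (q : B ⟶ C), E.Conf b b' ∧ E.Conf j q ∧
      a' ≫ j = i' ≫ b' ∧ b' ≫ q = p' ≫ c' := by
  -- `b` factors through the pushout `V` of `i` along `a`. The first half `Y ⟶ V` has cokernel `A`,
  -- as is seen by forming the same pushout from the conflation of `a` (as `V'`); the second half
  -- has cokernel `C` by `conf_of_left_id`.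
  obtain ⟨V, r, i'', p'', hV, hp'', hr⟩ := hE.exists_pushout_conf h a
  obtain ⟨V', r', s', t', hV', hst, ht'⟩ := hE.exists_pushout_conf ha i
  let e : V ≅ V' := hV.flip.isoIsPushout _ _ hV'
  have he1 : i'' ≫ e.hom = r' := hV.flip.inl_isoIsPushout_hom _ _ hV'
  have he2 : r ≫ e.hom = s' := hV.flip.inr_isoIsPushout_hom _ _ hV'
  have hrt : E.Conf r (e.hom ≫ t') := by
    have := hE.conf_iso_mid hst e.symm
    rw [← he2] at this
    simpa using this
  let m : V ⟶ Y' := hV.desc b i' hi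
  have hm1 : r ≫ m = b := by simp [m]
  have hm2 : i'' ≫ m = i' := by simp [m]
  have hm : E.Conf m (p' ≫ c') := hE.conf_of_left_id hp'' h' hc hm2
    (hV.hom_ext (by rw [reassoc_of% hr, reassoc_of% hm1, hp])
      (by rw [reassoc_of% hp''.pair.w, zero_comp, reassoc_of% hm2, h'.pair.w]))
  obtain ⟨B, b', j, q, h1, h2, h3, h4⟩ := hE.conf_comp hrt hm
  refine ⟨B, b', j, q, by rwa [hm1] at h1, h2, ?_, h4⟩
  rw [← ht', ← he1, Category.assoc, Category.assoc, ← hm2, Category.assoc, ← h3, Category.assoc]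

/-- Split conflations. -/
theorem conf_inl (X Z : D) [HasBinaryBiproducts D] :
    E.Conf (biprod.inl : X ⟶ X ⊞ Z) (biprod.snd : X ⊞ Z ⟶ Z) := by
  obtain ⟨O, hO⟩ := hE.hasZeroObject
  -- The split sequence is the pushout of `0 ⟶ Z ⟶ Z` along `0 ⟶ X`.
  obtain ⟨Y', f', i', p', h, hc, hp⟩ := hE.exists_pushout_conf (hE.conf_zero_id Z hO) (0 : O ⟶ X)
  let e : Y' ≅ X ⊞ Z := ⟨h.desc biprod.inr biprod.inl (by simp), biprod.desc i' f',
    h.hom_ext (by simp) (by simp), by ext <;> simp⟩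
  have h1 : i' ≫ e.hom = biprod.inl := by simp [e]
  have h2 := hE.conf_iso_mid hc e
  rw [h1] at h2
  refine hE.conf_of_inflation ⟨_, _, h2⟩ (by simp) inferInstance (fun T k hk => ?_)
  exact ⟨biprod.inr ≫ k, by ext <;> simp [hk]⟩

/-- The conflation `X ⟶ Y ⊞ X' ⟶ Y'` of a pushout square, with an arbitrary model for the
biproduct. -/
theorem conf_of_isPushout {X Y Z X' Y' Q : D} {i : X ⟶ Y} {p : Y ⟶ Z} (h : E.Conf i p)
    {f : X ⟶ X'} {f' : Y ⟶ Y'} {i' : X' ⟶ Y'} (hp : IsPushout i f f' i')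
    (inl : Y ⟶ Q) (inr : X' ⟶ Q) (fst : Q ⟶ Y) (snd : Q ⟶ X') (h₁ : inl ≫ fst = 𝟙 Y)
    (h₂ : inl ≫ snd = 0) (h₃ : inr ≫ fst = 0) (h₄ : inr ≫ snd = 𝟙 X')
    (h₅ : fst ≫ inl + snd ≫ inr = 𝟙 Q) :
    E.Conf (i ≫ inl - f ≫ inr) (fst ≫ f' + snd ≫ i') := by
  have := hE.hasBinaryBiproducts
  obtain ⟨O, hO⟩ := hE.hasZeroObject
  obtain ⟨e, he⟩ : ∃ e : Y ⊞ X' ≅ Q, e.hom = biprod.desc inl inr :=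
    ⟨⟨biprod.desc inl inr, biprod.lift fst snd, by ext <;> simp [h₁, h₂, h₃, h₄], by simp [h₅]⟩,
      rfl⟩
  -- The shear `σ` turns `inl` into the graph `(1, -f)`, so `(i, -f)` is a graph inclusion followed
  -- by `i ⊞ 1`, a composition of inflations.
  let σ : X ⊞ X' ≅ X ⊞ X' := ⟨biprod.lift biprod.fst (biprod.snd - biprod.fst ≫ f),
    biprod.lift biprod.fst (biprod.snd + biprod.fst ≫ f), by ext <;> simp, by ext <;> simp⟩
  have hσ := hE.conf_iso_mid (hE.conf_inl X X') σ
  obtain ⟨B, b', j, q, h6, -⟩ := hE.conf_mid (hE.conf_inl X X') (hE.conf_inl Y X') h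
    (hE.conf_id_zero X' hO) (b := biprod.map i (𝟙 X')) (by simp) (by simp)
  have h7 := hE.inflation_comp _ _ (hE.inflation_comp _ _ ⟨_, _, hσ⟩ ⟨_, _, h6⟩)
    ⟨_, _, hE.conf_iso_zero e.hom hO⟩
  have h8 : ((biprod.inl ≫ σ.hom) ≫ biprod.map i (𝟙 X')) ≫ e.hom = i ≫ inl - f ≫ inr := by
    have : (biprod.inl ≫ σ.hom) ≫ biprod.map i (𝟙 X') = i ≫ biprod.inl - f ≫ biprod.inr := by
      ext <;> simp [σ]
    rw [this]
    simp [he]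
  rw [h8] at h7
  refine hE.conf_of_inflation h7 ?_ ?_ ?_
  · simp [Preadditive.sub_comp, reassoc_of% h₁, reassoc_of% h₂, reassoc_of% h₃, reassoc_of% h₄,
      hp.w]
  · refine ⟨fun s t hst => hp.hom_ext ?_ ?_⟩
    · simpa [reassoc_of% h₁, reassoc_of% h₂] using congrArg (inl ≫ ·) hst
    · simpa [reassoc_of% h₃, reassoc_of% h₄] using congrArg (inr ≫ ·) hst
  · intro T k hk
    refine ⟨hp.desc (inl ≫ k) (inr ≫ k) (by simpa [sub_eq_zero] using hk), ?_⟩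
    simp only [Preadditive.add_comp, Category.assoc, IsPushout.inl_desc, IsPushout.inr_desc]
    rw [← Category.assoc, ← Category.assoc, ← Preadditive.add_comp, h₅, Category.id_comp]

theorem conf_of_isPullback {X Y Z Z' Y' Q : D} {i : X ⟶ Y} {p : Y ⟶ Z} (h : E.Conf i p)
    {f : Z' ⟶ Z} {f' : Y' ⟶ Y} {p' : Y' ⟶ Z'} (hp : IsPullback f' p' p f)
    (inl : Y ⟶ Q) (inr : Z' ⟶ Q) (fst : Q ⟶ Y) (snd : Q ⟶ Z') (h₁ : inl ≫ fst = 𝟙 Y)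
    (h₂ : inl ≫ snd = 0) (h₃ : inr ≫ fst = 0) (h₄ : inr ≫ snd = 𝟙 Z')
    (h₅ : fst ≫ inl + snd ≫ inr = 𝟙 Q) :
    E.Conf (f' ≫ inl + p' ≫ inr) (fst ≫ p - snd ≫ f) :=
  hE.op.conf_of_isPushout (op_op_conf.2 h) hp.op.flip fst.op snd.op inl.op inr.op
    (congrArg Quiver.Hom.op h₁) (congrArg Quiver.Hom.op h₃) (congrArg Quiver.Hom.op h₂)
    (congrArg Quiver.Hom.op h₄) (congrArg Quiver.Hom.op h₅)

end IsExact

end ConflationClass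

end RelTate

end

noncomputable section

namespace RelTate

/-! ### Sections of left exact presheaves -/

section Sections

variable {D : Type u} [Category.{v} D] [Preadditive D] {E : ConflationClass D}

/-- The element of `F(A)` corresponding to a morphism from a representable presheaf. -/
def valOf {F : LexCat.{w} E} {A : D} (s : (lexYoneda.{w} E).obj A ⟶ F) : F.obj.obj (op A) :=
  (s.hom.app (op A)).hom ⟨𝟙 A⟩

theorem valOf_comp {F G : LexCat.{w} E} {A : D} (s : (lexYoneda.{w} E).obj A ⟶ F) (α : F ⟶ G) :
    valOf (s ≫ α) = (α.hom.app (op A)).hom (valOf s) := rfl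

theorem app_eq_valOf {F : LexCat.{w} E} {A B : D} (s : (lexYoneda.{w} E).obj A ⟶ F) (m : B ⟶ A) :
    (s.hom.app (op B)).hom ⟨m⟩ = (F.obj.map m.op).hom (valOf s) := by
  have h := congrArg (fun k => k.hom (⟨𝟙 A⟩ : ULift (A ⟶ A))) (s.hom.naturality m.op)
  have h' : (((lexYoneda.{w} E).obj A).obj.map m.op).hom (⟨𝟙 A⟩ : ULift (A ⟶ A)) =
    (⟨m ≫ 𝟙 A⟩ : ULift (B ⟶ A)) := rfl
  rw [Category.comp_id] at h'
  exact (congrArg (s.hom.app (op B)).hom h'.symm).trans h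

theorem valOf_map_comp {F : LexCat.{w} E} {A B : D} (s : (lexYoneda.{w} E).obj A ⟶ F)
    (m : B ⟶ A) : valOf ((lexYoneda.{w} E).map m ≫ s) = (F.obj.map m.op).hom (valOf s) := by
  rw [← app_eq_valOf, valOf_comp]
  have h' : valOf ((lexYoneda.{w} E).map m) = (⟨𝟙 B ≫ m⟩ : ULift (B ⟶ A)) := rfl
  rw [h', Category.id_comp]
  rfl

theorem valOf_map {A B : D} (m : B ⟶ A) :
    valOf ((lexYoneda.{w} E).map m) = (⟨m⟩ : ULift (B ⟶ A)) := by
  have h' : valOf ((lexYoneda.{w} E).map m) = (⟨𝟙 B ≫ m⟩ : ULift (B ⟶ A)) := rfl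
  rw [h', Category.id_comp]

theorem valOf_injective {F : LexCat.{w} E} {A : D} {s t : (lexYoneda.{w} E).obj A ⟶ F}
    (h : valOf s = valOf t) : s = t := by
  apply ObjectProperty.hom_ext
  ext B ⟨m⟩
  exact (app_eq_valOf s m).trans ((congrArg _ h).trans (app_eq_valOf t m).symm)

theorem valOf_add {F : LexCat.{w} E} {A : D} (s t : (lexYoneda.{w} E).obj A ⟶ F) :
    valOf (s + t) = valOf s + valOf t := rfl

theorem valOf_zero {F : LexCat.{w} E} {A : D} :
    valOf (0 : (lexYoneda.{w} E).obj A ⟶ F) = 0 := rfl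

instance : (lexYoneda.{w} E).Faithful where
  map_injective {A B m n} h := by
    have := congrArg valOf h
    rw [valOf_map, valOf_map] at this
    exact congrArg ULift.down this

instance : (lexYoneda.{w} E).Full where
  map_surjective {A B} s := by
    refine ⟨ULift.down (valOf s : ULift (A ⟶ B)), valOf_injective ?_⟩
    rw [valOf_map]
    rfl

instance : (lexYoneda.{w} E).Additive where
  map_add {A B m n} := valOf_injective (by
    rw [valOf_add, valOf_map, valOf_map, valOf_map]; rfl)

end Sections

/-! ### Additivity of left exact presheaves; products, subobjects and filtered colimits. -/

section Lex

variable {D : Type u} [Category.{v} D] [Preadditive D] {E : ConflationClass D}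

/-- Objects of Lex(D) are not assumed additive; additivity comes from left exactness. A zero
morphism factors through a zero object `O`, and exactness at the conflation `X ⟶ X ⟶ O` makes
restriction from `O` to `X` vanish. -/
theorem isLeftExact.map_zero (hE : E.IsExact) {F : Dᵒᵖ ⥤ AddCommGrpCat.{max u v w}}
    (hF : isLeftExact.{w} E F) {X Y : D} (x : F.obj (op Y)) :
    (F.map (0 : X ⟶ Y).op).hom x = 0 := by
  obtain ⟨O, hO⟩ := hE.hasZeroObject
  have h1 := (hF _ _ (hE.conf_id_zero X hO)).2
  have h2 := (h1 _).2 ⟨(F.map (0 : O ⟶ Y).op).hom x, rfl⟩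
  have h3 : (0 : X ⟶ Y).op = (0 : O ⟶ Y).op ≫ (0 : X ⟶ O).op := by
    rw [← op_comp, zero_comp]
  rw [h3, F.map_comp]
  simpa using h2

/-- By the split conflation, an element over `Y ⊞ Y` that vanishes along `inl` comes from the second
factor, and is then determined by its restriction along `inr`. Hence the codiagonal acts as the sum
of the two projections, and `m + n` is `(m, n)` followed by the codiagonal. -/
theorem isLeftExact.map_add (hE : E.IsExact) {F : Dᵒᵖ ⥤ AddCommGrpCat.{max u v w}}
    (hF : isLeftExact.{w} E F) {X Y : D} (m n : X ⟶ Y) (x : F.obj (op Y)) :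
    (F.map (m + n).op).hom x = (F.map m.op).hom x + (F.map n.op).hom x := by
  have := hE.hasBinaryBiproducts
  have comp : ∀ {A B C : D} (a : A ⟶ B) (b : B ⟶ C) (x : F.obj (op C)),
      (F.map (a ≫ b).op).hom x = (F.map a.op).hom ((F.map b.op).hom x) := by
    intro A B C a b x
    rw [op_comp, F.map_comp]; rfl
  obtain ⟨h1, h2⟩ := hF _ _ (hE.conf_inl Y Y)
  have hz : ∀ {X Y : D} (x : F.obj (op Y)), (F.map (0 : op Y ⟶ op X)).hom x = 0 :=
    hF.map_zero hE
  have key : (F.map (biprod.desc (𝟙 Y) (𝟙 Y)).op).hom x =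
      (F.map (biprod.fst : Y ⊞ Y ⟶ Y).op).hom x + (F.map (biprod.snd : Y ⊞ Y ⟶ Y).op).hom x := by
    rw [← sub_eq_zero]
    set d := (F.map (biprod.desc (𝟙 Y) (𝟙 Y)).op).hom x -
      ((F.map (biprod.fst : Y ⊞ Y ⟶ Y).op).hom x + (F.map (biprod.snd : Y ⊞ Y ⟶ Y).op).hom x)
      with hd
    have hl : (F.map (biprod.inl : Y ⟶ Y ⊞ Y).op).hom d = 0 := by
      rw [hd, _root_.map_sub, _root_.map_add, ← comp, ← comp, ← comp]
      simp [hz]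
    have hr : (F.map (biprod.inr : Y ⟶ Y ⊞ Y).op).hom d = 0 := by
      rw [hd, _root_.map_sub, _root_.map_add, ← comp, ← comp, ← comp]
      simp [hz]
    obtain ⟨e, he⟩ := (h2 d).1 hl
    rw [← he, ← comp] at hr
    simp only [biprod.inr_snd, op_id, CategoryTheory.Functor.map_id, AddCommGrpCat.hom_id,
      AddMonoidHom.id_apply] at hr
    rw [← he, hr, _root_.map_zero]
  have h3 : m + n = biprod.lift m n ≫ biprod.desc (𝟙 Y) (𝟙 Y) := by simp
  rw [h3, comp, key, _root_.map_add, ← comp, ← comp, biprod.lift_fst, biprod.lift_snd]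

/-- The morphism from a representable presheaf corresponding to an element. -/
def secOf (hE : E.IsExact) (F : LexCat.{w} E) {A : D} (x : F.obj.obj (op A)) :
    (lexYoneda.{w} E).obj A ⟶ F :=
  ObjectProperty.homMk
    { app := fun B => AddCommGrpCat.ofHom
        { toFun := fun m : ULift (B.unop ⟶ A) => (F.obj.map m.down.op).hom x
          map_zero' := F.property.map_zero hE x
          map_add' := fun m n => F.property.map_add hE m.down n.down x }
      naturality := fun B C m => by
        ext ⟨n⟩
        exact congrArg (fun k => k.hom x) (F.obj.map_comp n.op m) }

@[simp]
theorem valOf_secOf (hE : E.IsExact) (F : LexCat.{w} E) {A : D} (x : F.obj.obj (op A)) :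
    valOf (secOf hE F x) = x :=
  congrArg (fun k => k.hom x) (F.obj.map_id (op A))

theorem secOf_valOf (hE : E.IsExact) {F : LexCat.{w} E} {A : D}
    (s : (lexYoneda.{w} E).obj A ⟶ F) : secOf hE F (valOf s) = s :=
  valOf_injective (valOf_secOf _ _ _)

namespace LexCat

theorem hom_ext (hE : E.IsExact) {F G : LexCat.{w} E} {α β : F ⟶ G}
    (h : ∀ (A : D) (s : (lexYoneda.{w} E).obj A ⟶ F), s ≫ α = s ≫ β) : α = β := by
  apply ObjectProperty.hom_ext
  ext A x
  have := congrArg valOf (h A.unop (secOf hE F x))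
  rw [valOf_comp, valOf_comp, valOf_secOf] at this
  exact this

/-- A natural additive family of maps on sections comes from a morphism. -/
theorem exists_hom (hE : E.IsExact) {F G : LexCat.{w} E}
    (φ : ∀ ⦃A : D⦄, ((lexYoneda.{w} E).obj A ⟶ F) → ((lexYoneda.{w} E).obj A ⟶ G))
    (hφ : ∀ ⦃A : D⦄ (s t : (lexYoneda.{w} E).obj A ⟶ F), φ (s + t) = φ s + φ t)
    (hφ' : ∀ ⦃A B : D⦄ (m : B ⟶ A) (s : (lexYoneda.{w} E).obj A ⟶ F),
      φ ((lexYoneda.{w} E).map m ≫ s) = (lexYoneda.{w} E).map m ≫ φ s) :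
    ∃ α : F ⟶ G, ∀ (A : D) (s : (lexYoneda.{w} E).obj A ⟶ F), s ≫ α = φ s := by
  refine ⟨ObjectProperty.homMk
    { app := fun A => AddCommGrpCat.ofHom (AddMonoidHom.mk'
        (fun x : F.obj.obj (op A.unop) => valOf (φ (secOf hE F x))) (fun x y => ?_))
      naturality := fun A B m => ?_ }, fun A s => ?_⟩
  · rw [← valOf_add, ← hφ]
    exact congrArg (fun s => valOf (φ s)) (valOf_injective (by simp [valOf_add]))
  · ext x
    have : secOf hE F ((F.obj.map m).hom x) =
        (lexYoneda.{w} E).map m.unop ≫ secOf hE F (A := A.unop) x :=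
      valOf_injective (by rw [valOf_map_comp]; simp)
    change valOf (φ (secOf hE F ((F.obj.map m).hom x))) = _
    rw [this, hφ', valOf_map_comp]
    rfl
  · refine valOf_injective ?_
    rw [valOf_comp]
    change valOf (φ (secOf hE F (valOf s))) = _
    rw [secOf_valOf]

theorem cancel_epi (F : LexCat.{w} E) {X Y Z : D} {f : X ⟶ Y} {g : Y ⟶ Z}
    (h : E.Conf f g) {s t : (lexYoneda.{w} E).obj Z ⟶ F}
    (hst : (lexYoneda.{w} E).map g ≫ s = (lexYoneda.{w} E).map g ≫ t) : s = t := by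
  refine valOf_injective ((F.property f g h).1 ?_)
  rw [← valOf_map_comp, hst, valOf_map_comp]

theorem exists_desc (hE : E.IsExact) (F : LexCat.{w} E) {X Y Z : D} {f : X ⟶ Y} {g : Y ⟶ Z}
    (h : E.Conf f g) (t : (lexYoneda.{w} E).obj Y ⟶ F)
    (ht : (lexYoneda.{w} E).map f ≫ t = 0) :
    ∃ s : (lexYoneda.{w} E).obj Z ⟶ F, (lexYoneda.{w} E).map g ≫ s = t := by
  have h1 := congrArg valOf ht
  rw [valOf_map_comp] at h1
  obtain ⟨x, hx⟩ := ((F.property f g h).2 (valOf t)).1 h1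
  exact ⟨secOf hE F x, valOf_injective (by rw [valOf_map_comp]; simpa using hx)⟩

/-- Subobjects given by conditions on sections. -/
theorem exists_sub (hE : E.IsExact) (F : LexCat.{w} E)
    (S : ∀ ⦃A : D⦄, ((lexYoneda.{w} E).obj A ⟶ F) → Prop)
    (h0 : ∀ A : D, S (0 : (lexYoneda.{w} E).obj A ⟶ F))
    (hadd : ∀ ⦃A : D⦄ (s t : (lexYoneda.{w} E).obj A ⟶ F), S s → S t → S (s + t))
    (hneg : ∀ ⦃A : D⦄ (s : (lexYoneda.{w} E).obj A ⟶ F), S s → S (-s))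
    (hres : ∀ ⦃A B : D⦄ (m : B ⟶ A) (s : (lexYoneda.{w} E).obj A ⟶ F), S s →
      S ((lexYoneda.{w} E).map m ≫ s))
    (hloc : ∀ ⦃Y Z : D⦄ (g : Y ⟶ Z) (s : (lexYoneda.{w} E).obj Z ⟶ F), E.Deflation g →
      S ((lexYoneda.{w} E).map g ≫ s) → S s) :
    ∃ (G : LexCat.{w} E) (ι : G ⟶ F),
      (∀ (A : D) (s : (lexYoneda.{w} E).obj A ⟶ G), s ≫ ι = 0 → s = 0) ∧
      (∀ (A : D) (s : (lexYoneda.{w} E).obj A ⟶ F), S s ↔ ∃ t, t ≫ ι = s) := by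
  let T (A : D) : AddSubgroup (F.obj.obj (op A)) :=
    { carrier := { x | S (secOf hE F x) }
      zero_mem' := by
        have : secOf hE F (0 : F.obj.obj (op A)) = 0 := valOf_injective (by simp [valOf_zero])
        simpa [this] using h0 A
      add_mem' := fun {a b} ha hb => by
        have : secOf hE F (a + b) = secOf hE F a + secOf hE F b :=
          valOf_injective (by simp [valOf_add])
        simpa [this] using hadd _ _ ha hb
      neg_mem' := fun {a} ha => by
        have : secOf hE F (-a) = - secOf hE F a := valOf_injective (by
          rw [valOf_secOf]
          exact (congrArg Neg.neg (valOf_secOf hE F a)).symm)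
        simpa [this] using hneg _ ha }
  have hT : ∀ {A B : D} (m : B ⟶ A) (x : F.obj.obj (op A)), x ∈ T A →
      (F.obj.map m.op).hom x ∈ T B := by
    intro A B m x hx
    have : secOf hE F ((F.obj.map m.op).hom x) = (lexYoneda.{w} E).map m ≫ secOf hE F x :=
      valOf_injective (by rw [valOf_map_comp]; simp)
    change S _
    rw [this]
    exact hres m _ hx
  let G : Dᵒᵖ ⥤ AddCommGrpCat.{max u v w} :=
    { obj := fun A => AddCommGrpCat.of (T A.unop)
      map := fun {A B} m => AddCommGrpCat.ofHom (((F.obj.map m).hom.comp (T A.unop).subtype).codRestrict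
        (T B.unop) (fun x => hT m.unop x.1 x.2))
      map_id := fun A => by
        ext x
        exact congrArg (fun k => k.hom x.1) (F.obj.map_id A)
      map_comp := fun {A B C} m n => by
        ext x
        exact congrArg (fun k => k.hom x.1) (F.obj.map_comp m n) }
  have hG : isLeftExact.{w} E G := by
    intro X Y Z f g h
    refine ⟨fun a b hab => ?_, fun b => ⟨fun hb => ?_, ?_⟩⟩
    · exact Subtype.ext ((F.property f g h).1 (congrArg Subtype.val hab))
    · obtain ⟨x, hx⟩ := ((F.property f g h).2 b.1).1 (congrArg Subtype.val hb)
      -- Locality along deflations is what makes the subpresheaf left exact: the element of `F`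
      -- provided by exactness lies in the subpresheaf again.
      refine ⟨⟨x, hloc g _ ⟨_, _, h⟩ ?_⟩, Subtype.ext hx⟩
      have : (lexYoneda.{w} E).map g ≫ secOf hE F x = secOf hE F b.1 :=
        valOf_injective (by rw [valOf_map_comp]; simpa using hx)
      rw [this]
      exact b.2
    · rintro ⟨a, rfl⟩
      exact Subtype.ext (((F.property f g h).2 _).2 ⟨a.1, rfl⟩)
  refine ⟨⟨G, hG⟩, ObjectProperty.homMk
    { app := fun A => AddCommGrpCat.ofHom (T A.unop).subtype
      naturality := fun A B m => rfl }, fun A s hs => ?_, fun A s => ⟨fun hs => ?_, ?_⟩⟩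
  · exact valOf_injective (Subtype.ext (congrArg valOf hs))
  · refine ⟨secOf hE (⟨G, hG⟩ : LexCat.{w} E)
      ⟨valOf s, by change S _; rwa [secOf_valOf]⟩, valOf_injective ?_⟩
    rw [valOf_comp, valOf_secOf]
    rfl
  · rintro ⟨t, rfl⟩
    have : S (secOf hE F _) := (valOf t : T A).2
    rw [← secOf_valOf hE (t ≫ _)]
    exact this

theorem exists_prod (F G : LexCat.{w} E) :
    ∃ (P : LexCat.{w} E) (fst : P ⟶ F) (snd : P ⟶ G) (inl : F ⟶ P) (inr : G ⟶ P),
      inl ≫ fst = 𝟙 F ∧ inl ≫ snd = 0 ∧ inr ≫ fst = 0 ∧ inr ≫ snd = 𝟙 G ∧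
        fst ≫ inl + snd ≫ inr = 𝟙 P := by
  let P : Dᵒᵖ ⥤ AddCommGrpCat.{max u v w} :=
    { obj := fun A => AddCommGrpCat.of (F.obj.obj A × G.obj.obj A)
      map := fun m => AddCommGrpCat.ofHom (AddMonoidHom.prodMap (F.obj.map m).hom (G.obj.map m).hom)
      map_id := fun A => by ext x <;> simp
      map_comp := fun m n => by ext x <;> simp }
  have hP : isLeftExact.{w} E P := by
    intro X Y Z f g h
    obtain ⟨h1, h2⟩ := F.property f g h
    obtain ⟨h3, h4⟩ := G.property f g h
    refine ⟨fun a b hab => Prod.ext (h1 (congrArg Prod.fst hab)) (h3 (congrArg Prod.snd hab)),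
      fun b => ⟨fun hb => ?_, ?_⟩⟩
    · obtain ⟨x, hx⟩ := (h2 _).1 (congrArg Prod.fst hb)
      obtain ⟨y, hy⟩ := (h4 _).1 (congrArg Prod.snd hb)
      exact ⟨(x, y), Prod.ext hx hy⟩
    · rintro ⟨a, rfl⟩
      exact Prod.ext ((h2 _).2 ⟨a.1, rfl⟩) ((h4 _).2 ⟨a.2, rfl⟩)
  refine ⟨⟨P, hP⟩,
    ObjectProperty.homMk { app := fun A => AddCommGrpCat.ofHom (AddMonoidHom.fst _ _)
                           naturality := fun _ _ _ => rfl },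
    ObjectProperty.homMk { app := fun A => AddCommGrpCat.ofHom (AddMonoidHom.snd _ _)
                           naturality := fun _ _ _ => rfl },
    ObjectProperty.homMk { app := fun A => AddCommGrpCat.ofHom (AddMonoidHom.inl _ _)
                           naturality := fun _ _ m => ?_ },
    ObjectProperty.homMk { app := fun A => AddCommGrpCat.ofHom (AddMonoidHom.inr _ _)
                           naturality := fun _ _ m => ?_ }, ?_, ?_, ?_, ?_, ?_⟩
  · ext x
    · rfl
    · exact (_root_.map_zero (G.obj.map m).hom).symm
  · ext x
    · exact (_root_.map_zero (F.obj.map m).hom).symm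
    · rfl
  · rfl
  · rfl
  · rfl
  · rfl
  · apply ObjectProperty.hom_ext
    ext A x
    · exact add_zero _
    · exact zero_add _

/-- Filtered colimits of representable presheaves. -/
theorem exists_colimit {I : Type w} [PartialOrder I] [IsDirectedOrder I] [Nonempty I]
    (hE : E.IsExact) (X : I ⥤ D) :
    ∃ (F : LexCat.{w} E) (s : ∀ i, (lexYoneda.{w} E).obj (X.obj i) ⟶ F),
      (∀ i j (h : i ≤ j), (lexYoneda.{w} E).map (X.map (homOfLE h)) ≫ s j = s i) ∧
      (∀ (i : I) (B : D) (m : B ⟶ X.obj i), (lexYoneda.{w} E).map m ≫ s i = 0 →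
        ∃ (j : I) (h : i ≤ j), m ≫ X.map (homOfLE h) = 0) ∧
      (∀ (B : D) (t : (lexYoneda.{w} E).obj B ⟶ F), ∃ (i : I) (m : B ⟶ X.obj i),
        (lexYoneda.{w} E).map m ≫ s i = t) := by
  -- The colimit is taken in presheaves; the index poset is directed, so it is already left exact
  -- and no sheafification is needed.
  let c := colimit.cocone (X ⋙ presheafYoneda.{w})
  have hc (B : D) : IsColimit (((evaluation Dᵒᵖ AddCommGrpCat.{max u v w}).obj (op B)).mapCocone c) :=
    isColimitOfPreserves _ (colimit.isColimit _)
  let ι (i : I) {B : D} (m : B ⟶ X.obj i) : c.pt.obj (op B) :=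
    ((c.ι.app i).app (op B)).hom (⟨m⟩ : ULift (B ⟶ X.obj i))
  have : PreservesFilteredColimitsOfSize.{w, w} (forget AddCommGrpCat.{max u v w}) :=
    preservesFilteredColimitsOfSize_shrink.{w, max u v w, w, max u v w} _
  have ι_rep : ∀ {B : D} (x : c.pt.obj (op B)), ∃ i m, ι i (B := B) m = x := by
    intro B x
    obtain ⟨i, ⟨m⟩, h⟩ := Concrete.isColimit_exists_rep _ (hc B) x
    exact ⟨i, m, h⟩
  have ι_nat : ∀ {A B : D} (i : I) (m : B ⟶ X.obj i) (n : A ⟶ B),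
      (c.pt.map n.op).hom (ι i m) = ι i (n ≫ m) := by
    intro A B i m n
    exact (congrArg (fun k => k.hom (⟨m⟩ : ULift (B ⟶ X.obj i)))
      ((c.ι.app i).naturality n.op)).symm
  have ι_w : ∀ {B : D} {i j : I} (h : i ≤ j) (m : B ⟶ X.obj i),
      ι j (m ≫ X.map (homOfLE h)) = ι i m := by
    intro B i j h m
    exact congrArg (fun k => (k.app (op B)).hom (⟨m⟩ : ULift (B ⟶ X.obj i))) (c.w (homOfLE h))
  have ι_zero : ∀ (i : I) (B : D), ι i (0 : B ⟶ X.obj i) = 0 := fun i B =>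
    _root_.map_zero ((c.ι.app i).app (op B)).hom
  have ι_eq : ∀ {B : D} {i : I} (m : B ⟶ X.obj i), ι i m = 0 →
      ∃ (j : I) (h : i ≤ j), m ≫ X.map (homOfLE h) = 0 := by
    intro B i m hm
    obtain ⟨k, f, g, hk⟩ := (Concrete.isColimit_rep_eq_iff_exists _ (hc B)
      (⟨m⟩ : ULift (B ⟶ X.obj i)) (⟨0⟩ : ULift (B ⟶ X.obj i))).1 (hm.trans (ι_zero i B).symm)
    refine ⟨k, leOfHom f, ?_⟩
    have : m ≫ X.map f = 0 ≫ X.map g := congrArg ULift.down hk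
    rw [zero_comp] at this
    exact this
  have hF : isLeftExact.{w} E c.pt := by
    intro A B C f g h
    have := h.pair.epi
    refine ⟨(injective_iff_map_eq_zero _).2 fun x hx => ?_, fun x => ⟨fun hx => ?_, ?_⟩⟩
    · obtain ⟨i, m, rfl⟩ := ι_rep x
      rw [ι_nat] at hx
      obtain ⟨j, hij, hj⟩ := ι_eq _ hx
      rw [← ι_w hij, (Preadditive.epi_iff_cancel_zero g).1 inferInstance _ (m ≫ _) (by simpa using hj), ι_zero]
    · obtain ⟨i, m, rfl⟩ := ι_rep x
      rw [ι_nat] at hx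
      obtain ⟨j, hij, hj⟩ := ι_eq _ hx
      obtain ⟨l, hl⟩ := h.pair.exists_desc (m ≫ X.map (homOfLE hij)) (by simpa using hj)
      exact ⟨ι j l, by rw [ι_nat, hl, ι_w]⟩
    · rintro ⟨y, rfl⟩
      obtain ⟨i, m, rfl⟩ := ι_rep y
      rw [ι_nat, ι_nat, reassoc_of% h.pair.w, zero_comp, ι_zero]
  let F : LexCat.{w} E := ⟨c.pt, hF⟩
  refine ⟨F, fun i => secOf hE F (ι i (𝟙 _)), fun i j h => valOf_injective ?_,
    fun i B m hm => ι_eq m ?_, fun B t => ?_⟩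
  · rw [valOf_map_comp, valOf_secOf, valOf_secOf, ι_nat, Category.comp_id]
    have := ι_w h (𝟙 _)
    rwa [Category.id_comp] at this
  · have := congrArg valOf hm
    rwa [valOf_map_comp, valOf_secOf, ι_nat, Category.comp_id] at this
  · obtain ⟨i, m, h⟩ := ι_rep (valOf t)
    refine ⟨i, m, valOf_injective ?_⟩
    rw [valOf_map_comp, valOf_secOf, ι_nat, Category.comp_id, h]

end LexCat

end Lex

end RelTate

end

noncomputable section

namespace RelTate

/-! ### Exact sequences of left exact presheaves -/

namespace ConflationClass.IsExact

variable {D : Type u} [Category.{v} D] [Preadditive D] {E : ConflationClass D}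

/-- Deflations behave as coverings: they can be pulled back, and by `exists_common_cover` two
coverings of an object have a common refinement. The local arguments below rest on this. -/
theorem exists_cover (hE : E.IsExact) {A A' B : D} {p : B ⟶ A} (hp : E.Deflation p) (m : A' ⟶ A) :
    ∃ (C : D) (q : C ⟶ A') (a : C ⟶ B), E.Deflation q ∧ a ≫ p = q ≫ m := by
  obtain ⟨C, a, q, h, hq⟩ := hE.exists_pullback p m hp
  exact ⟨C, q, a, hq, h.w⟩

theorem exists_common_cover (hE : E.IsExact) {A B B' : D} {p : B ⟶ A} (hp : E.Deflation p)
    {p' : B' ⟶ A} (hp' : E.Deflation p') :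
    ∃ (C : D) (a : C ⟶ B) (a' : C ⟶ B'), E.Deflation (a ≫ p) ∧ a ≫ p = a' ≫ p' := by
  obtain ⟨C, q, a, hq, h⟩ := hE.exists_cover hp p'
  exact ⟨C, a, q, h ▸ hE.deflation_comp _ _ hq hp', h⟩

end ConflationClass.IsExact

section

variable {D : Type u} [Category.{v} D] [Preadditive D] {E : ConflationClass D}

/-- Local epimorphisms of left exact presheaves. -/
def LocEpi {F G : LexCat.{w} E} (g : F ⟶ G) : Prop :=
  ∀ ⦃A : D⦄ (s : (lexYoneda.{w} E).obj A ⟶ G), ∃ (B : D) (p : B ⟶ A) (t : (lexYoneda.{w} E).obj B ⟶ F),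
    E.Deflation p ∧ t ≫ g = (lexYoneda.{w} E).map p ≫ s

/-- Short exact sequences of left exact presheaves, in terms of sections. -/
structure LexExact {F G H : LexCat.{w} E} (f : F ⟶ G) (g : G ⟶ H) : Prop where
  w : f ≫ g = 0
  eq_zero : ∀ ⦃A : D⦄ (s : (lexYoneda.{w} E).obj A ⟶ F), s ≫ f = 0 → s = 0
  exists_lift : ∀ ⦃A : D⦄ (s : (lexYoneda.{w} E).obj A ⟶ G), s ≫ g = 0 → ∃ t : (lexYoneda.{w} E).obj A ⟶ F, t ≫ f = s
  locEpi : LocEpi g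

namespace LexCat

variable (hE : E.IsExact)
include hE

theorem mono_of_sections {F G : LexCat.{w} E} {f : F ⟶ G}
    (h : ∀ ⦃A : D⦄ (s : (lexYoneda.{w} E).obj A ⟶ F), s ≫ f = 0 → s = 0) : Mono f :=
  Preadditive.mono_of_cancel_zero _ fun k hk => hom_ext hE fun A s => by
    rw [h (s ≫ k) (by rw [Category.assoc, hk, comp_zero]), comp_zero]

omit hE in
theorem deflation_cancel {A B : D} {p : B ⟶ A} (hp : E.Deflation p) {F : LexCat.{w} E}
    {s t : (lexYoneda.{w} E).obj A ⟶ F} (h : (lexYoneda.{w} E).map p ≫ s = (lexYoneda.{w} E).map p ≫ t) : s = t := by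
  obtain ⟨K, k, hk⟩ := hp
  exact cancel_epi F hk h

omit hE in
theorem deflation_cancel_zero {A B : D} {p : B ⟶ A} (hp : E.Deflation p) {F : LexCat.{w} E}
    {s : (lexYoneda.{w} E).obj A ⟶ F} (h : (lexYoneda.{w} E).map p ≫ s = 0) : s = 0 :=
  deflation_cancel hp (h.trans comp_zero.symm)

theorem epi_of_locEpi {F G : LexCat.{w} E} {g : F ⟶ G} (h : LocEpi g) : Epi g :=
  Preadditive.epi_of_cancel_zero _ fun k hk => hom_ext hE fun A s => by
    obtain ⟨B, p, t, hp, ht⟩ := h s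
    rw [comp_zero]
    refine deflation_cancel_zero hp ?_
    rw [← Category.assoc, ← ht, Category.assoc, hk, comp_zero]

/-- Construction of morphisms from additive relations on sections. -/
theorem exists_hom_of_rel {F G : LexCat.{w} E}
    (R : ∀ ⦃A : D⦄, ((lexYoneda.{w} E).obj A ⟶ F) → ((lexYoneda.{w} E).obj A ⟶ G) → Prop)
    (htot : ∀ ⦃A : D⦄ (s : (lexYoneda.{w} E).obj A ⟶ F), ∃ t, R s t)
    (hsub : ∀ ⦃A : D⦄ (s s' : (lexYoneda.{w} E).obj A ⟶ F) (t t' : (lexYoneda.{w} E).obj A ⟶ G), R s t → R s' t' →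
      R (s - s') (t - t'))
    (hres : ∀ ⦃A B : D⦄ (m : B ⟶ A) (s : (lexYoneda.{w} E).obj A ⟶ F) (t : (lexYoneda.{w} E).obj A ⟶ G), R s t →
      R ((lexYoneda.{w} E).map m ≫ s) ((lexYoneda.{w} E).map m ≫ t))
    (h0 : ∀ ⦃A : D⦄ (t : (lexYoneda.{w} E).obj A ⟶ G), R 0 t → t = 0) :
    ∃ α : F ⟶ G, ∀ ⦃A : D⦄ (s : (lexYoneda.{w} E).obj A ⟶ F) (t : (lexYoneda.{w} E).obj A ⟶ G), R s t → s ≫ α = t := by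
  choose φ hφ using htot
  have uniq : ∀ {A : D} {s : (lexYoneda.{w} E).obj A ⟶ F} {t t' : (lexYoneda.{w} E).obj A ⟶ G}, R s t → R s t' → t = t' := by
    intro A s t t' h h'
    have := hsub _ _ _ _ h h'
    rw [sub_self] at this
    exact sub_eq_zero.1 (h0 _ this)
  obtain ⟨α, hα⟩ := exists_hom hE φ
    (fun A s t => by
      have := hsub _ _ _ _ (hsub _ _ _ _ (hφ (s + t)) (hφ s)) (hφ t)
      rw [add_sub_cancel_left, sub_self] at this
      have := h0 _ this
      rw [sub_sub, sub_eq_zero] at this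
      exact this)
    (fun A B m s => uniq (hφ _) (hres m _ _ (hφ s)))
  exact ⟨α, fun A s t h => by rw [hα]; exact uniq (hφ s) h⟩

theorem exists_factor {F G T : LexCat.{w} E} (f : F ⟶ G) [Mono f] (k : T ⟶ G)
    (h : ∀ ⦃A : D⦄ (s : (lexYoneda.{w} E).obj A ⟶ T), ∃ t, t ≫ f = s ≫ k) : ∃ l : T ⟶ F, l ≫ f = k := by
  obtain ⟨l, hl⟩ := exists_hom_of_rel hE (fun A (s : (lexYoneda.{w} E).obj A ⟶ T) t => t ≫ f = s ≫ k) h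
    (fun A s s' t t' h h' => by rw [Preadditive.sub_comp, h, h', Preadditive.sub_comp])
    (fun A B m s t h => by rw [Category.assoc, h, Category.assoc])
    (fun A t h => by rw [← cancel_mono f, h, zero_comp, zero_comp])
  refine ⟨l, hom_ext hE fun A s => ?_⟩
  obtain ⟨t, ht⟩ := h s
  rw [← Category.assoc, hl s t ht, ht]

/-- A section of `G` lifts to `F` over a deflation; `k` of the lift is a section of `T` that
descends along the deflation, since `k` kills the ambiguity. Common refinements make the result
additive and independent of choices. -/
theorem exists_desc_of_locEpi {F G T : LexCat.{w} E} {g : F ⟶ G} (hg : LocEpi g) (k : F ⟶ T)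
    (h : ∀ ⦃A : D⦄ (s : (lexYoneda.{w} E).obj A ⟶ F), s ≫ g = 0 → s ≫ k = 0) : ∃ l : G ⟶ T, g ≫ l = k := by
  refine Exists.elim (exists_hom_of_rel hE
    (fun A (s : (lexYoneda.{w} E).obj A ⟶ G) r => ∃ (B : D) (p : B ⟶ A) (t : (lexYoneda.{w} E).obj B ⟶ F),
      E.Deflation p ∧ t ≫ g = (lexYoneda.{w} E).map p ≫ s ∧ t ≫ k = (lexYoneda.{w} E).map p ≫ r) ?_ ?_ ?_ ?_)
    (fun l hl => ?_)
  · intro A s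
    obtain ⟨B, p, t, ⟨K, n, hp⟩, ht⟩ := hg s
    obtain ⟨r, hr⟩ := exists_desc hE T hp (t ≫ k) (by
      rw [← Category.assoc]
      refine h _ ?_
      rw [Category.assoc, ht, ← Functor.map_comp_assoc, hp.pair.w, Functor.map_zero, zero_comp])
    exact ⟨r, B, p, t, ⟨K, n, hp⟩, ht, hr.symm⟩
  · rintro A s s' r r' ⟨B, p, t, hp, ht, hr⟩ ⟨B', p', t', hp', ht', hr'⟩
    obtain ⟨C, a, a', hC, haa⟩ := hE.exists_common_cover hp hp'
    refine ⟨C, a ≫ p, (lexYoneda.{w} E).map a ≫ t - (lexYoneda.{w} E).map a' ≫ t', hC, ?_, ?_⟩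
    · rw [Preadditive.sub_comp, Preadditive.comp_sub]
      nth_rw 2 [haa]
      simp only [Category.assoc, ht, ht', Functor.map_comp]
    · rw [Preadditive.sub_comp, Preadditive.comp_sub]
      nth_rw 2 [haa]
      simp only [Category.assoc, hr, hr', Functor.map_comp]
  · rintro A A' m s r ⟨B, p, t, hp, ht, hr⟩
    obtain ⟨C, q, a, hq, ha⟩ := hE.exists_cover hp m
    refine ⟨C, q, (lexYoneda.{w} E).map a ≫ t, hq, ?_, ?_⟩
    · rw [Category.assoc, ht, ← Functor.map_comp_assoc, ha, Functor.map_comp_assoc]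
    · rw [Category.assoc, hr, ← Functor.map_comp_assoc, ha, Functor.map_comp_assoc]
  · rintro A r ⟨B, p, t, hp, ht, hr⟩
    refine deflation_cancel_zero hp ?_
    rw [← hr, h t (by rw [ht, comp_zero])]
  · refine ⟨l, hom_ext hE fun A s => ?_⟩
    rw [← Category.assoc]
    exact hl _ _ ⟨A, 𝟙 A, s, hE.deflation_id A, by simp, by simp⟩

theorem isIso_of_mono_locEpi {F G : LexCat.{w} E} (g : F ⟶ G) [Mono g] (hg : LocEpi g) :
    IsIso g := by
  obtain ⟨l, hl⟩ := exists_desc_of_locEpi hE hg (𝟙 F) (fun A s hs => by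
    rw [← cancel_mono g, Category.comp_id, hs, zero_comp])
  have := epi_of_locEpi hE hg
  exact ⟨l, hl, by rw [← CategoryTheory.cancel_epi g, reassoc_of% hl, Category.comp_id]⟩

theorem exists_kernel {F G : LexCat.{w} E} (g : F ⟶ G) :
    ∃ (K : LexCat.{w} E) (k : K ⟶ F), Mono k ∧ k ≫ g = 0 ∧
      ∀ ⦃A : D⦄ (s : (lexYoneda.{w} E).obj A ⟶ F), s ≫ g = 0 → ∃ t : (lexYoneda.{w} E).obj A ⟶ K, t ≫ k = s := by
  obtain ⟨K, k, h1, h2⟩ := exists_sub hE F (fun A s => s ≫ g = 0) (fun A => zero_comp)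
    (fun A s t hs ht => by rw [Preadditive.add_comp, hs, ht, add_zero])
    (fun A s hs => by rw [Preadditive.neg_comp, hs, neg_zero])
    (fun A B m s hs => by rw [Category.assoc, hs, comp_zero])
    (fun A B m s hm hs => by
      refine deflation_cancel_zero hm ?_
      rwa [← Category.assoc])
  refine ⟨K, k, mono_of_sections hE h1, hom_ext hE fun A s => ?_, fun A s => (h2 A s).1⟩
  rw [← Category.assoc, (h2 A (s ≫ k)).2 ⟨s, rfl⟩, comp_zero]

/-- The image consists of the sections that lift after a deflation. Deflations compose, so this
condition is local and defines a left exact presheaf. -/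
theorem exists_image {F G : LexCat.{w} E} (g : F ⟶ G) :
    ∃ (H : LexCat.{w} E) (e : F ⟶ H) (m : H ⟶ G), Mono m ∧ LocEpi e ∧ e ≫ m = g := by
  refine Exists.elim (exists_sub hE G (fun A s => ∃ (B : D) (p : B ⟶ A) (t : (lexYoneda.{w} E).obj B ⟶ F),
      E.Deflation p ∧ t ≫ g = (lexYoneda.{w} E).map p ≫ s) ?_ ?_ ?_ ?_ ?_)
    (fun H ⟨m, h1, h2⟩ => ?_)
  · exact fun A => ⟨A, 𝟙 A, 0, hE.deflation_id A, by simp⟩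
  · rintro A s s' ⟨B, p, t, hp, ht⟩ ⟨B', p', t', hp', ht'⟩
    obtain ⟨C, a, a', hC, haa⟩ := hE.exists_common_cover hp hp'
    refine ⟨C, a ≫ p, (lexYoneda.{w} E).map a ≫ t + (lexYoneda.{w} E).map a' ≫ t', hC, ?_⟩
    rw [Preadditive.add_comp, Preadditive.comp_add]
    nth_rw 2 [haa]
    simp only [Category.assoc, ht, ht', Functor.map_comp]
  · rintro A s ⟨B, p, t, hp, ht⟩
    exact ⟨B, p, -t, hp, by rw [Preadditive.neg_comp, ht, Preadditive.comp_neg]⟩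
  · rintro A A' m s ⟨B, p, t, hp, ht⟩
    obtain ⟨C, q, a, hq, ha⟩ := hE.exists_cover hp m
    refine ⟨C, q, (lexYoneda.{w} E).map a ≫ t, hq, ?_⟩
    rw [Category.assoc, ht, ← Functor.map_comp_assoc, ha, Functor.map_comp_assoc]
  · rintro A' A m s hm ⟨B, p, t, hp, ht⟩
    exact ⟨B, p ≫ m, t, hE.deflation_comp _ _ hp hm, by rw [ht, Functor.map_comp_assoc]⟩
  · have := mono_of_sections hE h1
    obtain ⟨e, he⟩ := exists_factor hE m g (fun A s => (h2 A _).1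
      ⟨A, 𝟙 A, s, hE.deflation_id A, by simp⟩)
    refine ⟨H, e, m, this, fun A s => ?_, he⟩
    obtain ⟨B, p, t, hp, ht⟩ := (h2 A (s ≫ m)).2 ⟨s, rfl⟩
    exact ⟨B, p, t, hp, by rw [← cancel_mono m, Category.assoc, he, ht, Category.assoc]⟩

theorem exists_isPullback {F G H : LexCat.{w} E} (p : F ⟶ G) (f : H ⟶ G) :
    ∃ (P : LexCat.{w} E) (f' : P ⟶ F) (p' : P ⟶ H), IsPullback f' p' p f := by
  obtain ⟨Q, fst, snd, inl, inr, h1, h2, h3, h4, h5⟩ := exists_prod F H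
  obtain ⟨P, k, hk, hk', hl⟩ := exists_kernel hE (fst ≫ p - snd ≫ f)
  have w : (k ≫ fst) ≫ p = (k ≫ snd) ≫ f := by
    rw [← sub_eq_zero]
    simpa using hk'
  have key (c : PullbackCone p f) : ∃ l : c.pt ⟶ P, l ≫ k = c.fst ≫ inl + c.snd ≫ inr :=
    exists_factor hE k _ (fun A s => hl _ (by
      simp [reassoc_of% h1, reassoc_of% h2, reassoc_of% h3, reassoc_of% h4, c.condition]))
  refine ⟨P, k ≫ fst, k ≫ snd, ⟨w⟩, ⟨PullbackCone.IsLimit.mk w (fun c => (key c).choose)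
    (fun c => ?_) (fun c => ?_) (fun c m h h' => ?_)⟩⟩
  · rw [← Category.assoc, (key c).choose_spec]
    simp [h1, h3]
  · rw [← Category.assoc, (key c).choose_spec]
    simp [h2, h4]
  · rw [← cancel_mono k, (key c).choose_spec, ← h, ← h']
    simp only [Category.assoc, ← Preadditive.comp_add, h5, Category.comp_id]

end LexCat

namespace LexExact

variable {F G H : LexCat.{w} E} {f : F ⟶ G} {g : G ⟶ H}

theorem pair (hE : E.IsExact) (h : LexExact f g) : IsKernelCokernelPair f g := by
  have := LexCat.mono_of_sections hE h.eq_zero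
  refine .of_exists h.w this (LexCat.epi_of_locEpi hE h.locEpi) (fun T k hk => ?_)
    (fun T k hk => ?_)
  · exact LexCat.exists_factor hE f k (fun A s => h.exists_lift _ (by simp [hk]))
  · refine LexCat.exists_desc_of_locEpi hE h.locEpi k (fun A s hs => ?_)
    obtain ⟨t, rfl⟩ := h.exists_lift s hs
    rw [Category.assoc, hk, comp_zero]

theorem mono (hE : E.IsExact) (h : LexExact f g) : Mono f := (h.pair hE).mono

/-- The point is that a cokernel in Lex(D) is locally surjective. The map `e` onto the local image
of `g` vanishes on `f`, so it factors through `g`; this provides a section of the inclusion of the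
image in `H`, and every section of `H` lifts locally. -/
theorem of_pair (hE : E.IsExact) (h : IsKernelCokernelPair f g) : LexExact f g := by
  have := h.mono
  have := h.epi
  obtain ⟨I, e, m, hm, he, hem⟩ := LexCat.exists_image hE g
  have h1 : LexExact f e :=
    ⟨by rw [← cancel_mono m, Category.assoc, hem, h.w, zero_comp],
      fun A s hs => by rw [← cancel_mono f, hs, zero_comp],
      fun A s hs => h.exists_lift s (by rw [← hem, reassoc_of% hs, zero_comp]), he⟩
  obtain ⟨a, ha⟩ := h.exists_desc e h1.w
  refine ⟨h.w, fun A s hs => by rw [← cancel_mono f, hs, zero_comp],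
    fun A s hs => h.exists_lift s hs, fun A s => ?_⟩
  have hma : a ≫ m = 𝟙 _ := by rw [← cancel_epi g, reassoc_of% ha, hem, Category.comp_id]
  obtain ⟨B, p, t, hp, ht⟩ := he (s ≫ a)
  exact ⟨B, p, t, hp, by rw [← hem, reassoc_of% ht, hma, Category.comp_id]⟩

theorem iff_pair (hE : E.IsExact) : LexExact f g ↔ IsKernelCokernelPair f g :=
  ⟨pair hE, of_pair hE⟩

end LexExact

theorem lexExact_map (hE : E.IsExact) {X Y Z : D} {f : X ⟶ Y} {g : Y ⟶ Z} (h : E.Conf f g) :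
    LexExact ((lexYoneda.{w} E).map f) ((lexYoneda.{w} E).map g) := by
  have := h.pair.mono
  refine ⟨by rw [← Functor.map_comp, h.pair.w, Functor.map_zero], fun A s hs => ?_,
    fun A s hs => ?_, fun A s => ?_⟩ <;> obtain ⟨m, rfl⟩ := (lexYoneda.{w} E).map_surjective s
  · rw [← Functor.map_comp, Functor.map_eq_zero_iff] at hs
    rw [(cancel_mono f).1 (hs.trans zero_comp.symm), Functor.map_zero]
  · rw [← Functor.map_comp, Functor.map_eq_zero_iff] at hs
    obtain ⟨l, rfl⟩ := h.pair.exists_lift m hs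
    exact ⟨(lexYoneda.{w} E).map l, (Functor.map_comp _ _ _).symm⟩
  · obtain ⟨C, q, a, hq, ha⟩ := hE.exists_cover ⟨_, _, h⟩ m
    exact ⟨C, q, (lexYoneda.{w} E).map a, hq, by rw [← Functor.map_comp, ha, Functor.map_comp]⟩

/-! ### Presentations -/

/-- The sections `s i` exhibit `F` as the directed union of the objects `X i`. -/
structure IsPres {I : Type w} [PartialOrder I] (X : I ⥤ D) (F : LexCat.{w} E)
    (s : ∀ i, (lexYoneda.{w} E).obj (X.obj i) ⟶ F) : Prop where
  nat : ∀ ⦃i j⦄ (h : i ≤ j), (lexYoneda.{w} E).map (X.map (homOfLE h)) ≫ s j = s i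
  eq_zero : ∀ (i : I) ⦃B : D⦄ (m : B ⟶ X.obj i), (lexYoneda.{w} E).map m ≫ s i = 0 → m = 0
  cover : ∀ ⦃B : D⦄ (t : (lexYoneda.{w} E).obj B ⟶ F), ∃ (i : I) (m : B ⟶ X.obj i), (lexYoneda.{w} E).map m ≫ s i = t

namespace IsPres

variable {I : Type w} [PartialOrder I] {X : I ⥤ D} {F : LexCat.{w} E}
  {s : ∀ i, (lexYoneda.{w} E).obj (X.obj i) ⟶ F}

theorem eq (h : IsPres X F s) {i : I} {B : D} {m n : B ⟶ X.obj i}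
    (hmn : (lexYoneda.{w} E).map m ≫ s i = (lexYoneda.{w} E).map n ≫ s i) : m = n := by
  rw [← sub_eq_zero]
  refine h.eq_zero i _ ?_
  rw [Functor.map_sub, Preadditive.sub_comp, hmn, sub_self]

theorem cover_ge [IsDirectedOrder I] (h : IsPres X F s) (i₀ : I) {B : D} (t : (lexYoneda.{w} E).obj B ⟶ F) :
    ∃ (i : I) (m : B ⟶ X.obj i), i₀ ≤ i ∧ (lexYoneda.{w} E).map m ≫ s i = t := by
  obtain ⟨i, m, rfl⟩ := h.cover t
  obtain ⟨j, h1, h2⟩ := exists_ge_ge i₀ i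
  exact ⟨j, m ≫ X.map (homOfLE h2), h1, by rw [Functor.map_comp_assoc, h.nat]⟩

theorem factor_of_le (h : IsPres X F s) {i j : I} (hij : i ≤ j) {B : D} {t : (lexYoneda.{w} E).obj B ⟶ F}
    (m : B ⟶ X.obj i) (hm : (lexYoneda.{w} E).map m ≫ s i = t) :
    (lexYoneda.{w} E).map (m ≫ X.map (homOfLE hij)) ≫ s j = t := by
  rw [Functor.map_comp_assoc, h.nat, hm]

theorem hom_ext (hE : E.IsExact) (h : IsPres X F s) {G : LexCat.{w} E} {α β : F ⟶ G}
    (hαβ : ∀ i, s i ≫ α = s i ≫ β) : α = β :=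
  LexCat.hom_ext hE fun A t => by
    obtain ⟨i, m, rfl⟩ := h.cover t
    rw [Category.assoc, Category.assoc, hαβ]

theorem exists_desc [IsDirectedOrder I] (hE : E.IsExact) (h : IsPres X F s) {G : LexCat.{w} E}
    (t : ∀ i, (lexYoneda.{w} E).obj (X.obj i) ⟶ G)
    (ht : ∀ ⦃i j⦄ (h : i ≤ j), (lexYoneda.{w} E).map (X.map (homOfLE h)) ≫ t j = t i) :
    ∃ α : F ⟶ G, ∀ i, s i ≫ α = t i := by
  refine Exists.elim (LexCat.exists_hom_of_rel hE
    (fun A (r : (lexYoneda.{w} E).obj A ⟶ F) (r' : (lexYoneda.{w} E).obj A ⟶ G) =>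
      ∃ (i : I) (m : A ⟶ X.obj i), (lexYoneda.{w} E).map m ≫ s i = r ∧ (lexYoneda.{w} E).map m ≫ t i = r') ?_ ?_ ?_ ?_)
    (fun α hα => ?_)
  · intro A r
    obtain ⟨i, m, hm⟩ := h.cover r
    exact ⟨_, i, m, hm, rfl⟩
  · rintro A _ _ _ _ ⟨i, m, rfl, rfl⟩ ⟨j, n, rfl, rfl⟩
    obtain ⟨k, hi, hj⟩ := exists_ge_ge i j
    refine ⟨k, m ≫ X.map (homOfLE hi) - n ≫ X.map (homOfLE hj), ?_, ?_⟩
    · rw [Functor.map_sub, Preadditive.sub_comp, Functor.map_comp_assoc, Functor.map_comp_assoc,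
        h.nat, h.nat]
    · rw [Functor.map_sub, Preadditive.sub_comp, Functor.map_comp_assoc, Functor.map_comp_assoc,
        ht, ht]
  · rintro A B m _ _ ⟨i, n, rfl, rfl⟩
    exact ⟨i, m ≫ n, by rw [Functor.map_comp_assoc], by rw [Functor.map_comp_assoc]⟩
  · rintro A _ ⟨i, m, h1, rfl⟩
    rw [h.eq_zero i m h1, Functor.map_zero, zero_comp]
  · exact ⟨α, fun i => hα _ _ ⟨i, 𝟙 _, by simp, by simp⟩⟩

/-- The cocone of a presentation. -/
def cocone (h : IsPres X F s) : Cocone (X ⋙ (lexYoneda.{w} E)) where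
  pt := F
  ι :=
    { app := s
      naturality := fun i j m => by
        rw [show m = homOfLE (leOfHom m) from rfl]
        simpa using h.nat (leOfHom m) }

theorem nonempty_isColimit [IsDirectedOrder I] (hE : E.IsExact) (h : IsPres X F s) :
    Nonempty (IsColimit h.cocone) := by
  have key (c : Cocone (X ⋙ (lexYoneda.{w} E))) : ∃ α : F ⟶ c.pt, ∀ i, s i ≫ α = c.ι.app i :=
    h.exists_desc hE c.ι.app (fun i j hij => c.w (homOfLE hij))
  exact ⟨⟨fun c => (key c).choose, fun c => (key c).choose_spec, fun c m hm =>
    h.hom_ext hE fun i => (hm i).trans ((key c).choose_spec i).symm⟩⟩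

theorem of_iso {F' : LexCat.{w} E} (h : IsPres X F s) (e : F ≅ F') :
    IsPres X F' (fun i => s i ≫ e.hom) where
  nat i j hij := by rw [← Category.assoc, h.nat]
  eq_zero i B m hm := h.eq_zero i m (by
    rw [← cancel_mono e.hom, Category.assoc, hm, zero_comp])
  cover B t := by
    obtain ⟨i, m, hm⟩ := h.cover (t ≫ e.inv)
    exact ⟨i, m, by rw [← Category.assoc, hm]; simp⟩

/-- An isomorphism onto the union that factors through stage `i` factors through every later stage
`j`; since maps into a stage are determined by their composite to the union, stage `j` is
everything. -/
theorem isIso_of_section [IsDirectedOrder I] (h : IsPres X F s) {A : D}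
    (e : (lexYoneda.{w} E).obj A ⟶ F) [IsIso e] {i : I} {m : A ⟶ X.obj i} (hm : (lexYoneda.{w} E).map m ≫ s i = e) {j : I}
    (hij : i ≤ j) : IsIso (s j) := by
  refine ⟨inv e ≫ (lexYoneda.{w} E).map (m ≫ X.map (homOfLE hij)), ?_, ?_⟩
  · obtain ⟨n, hn⟩ := (lexYoneda.{w} E).map_surjective (s j ≫ inv e ≫ (lexYoneda.{w} E).map (m ≫ X.map (homOfLE hij)))
    rw [← hn, ← CategoryTheory.Functor.map_id]
    congr 1
    refine h.eq ?_
    rw [hn, Category.assoc, Category.assoc, h.factor_of_le hij m hm]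
    simp
  · rw [Category.assoc, h.factor_of_le hij m hm]
    simp

/-- A representable object is eventually equal to the terms of its presentations. -/
theorem exists_isIso [IsDirectedOrder I] (h : IsPres X F s) {A : D}
    (e : (lexYoneda.{w} E).obj A ≅ F) : ∃ i, ∀ j, i ≤ j → IsIso (s j) := by
  obtain ⟨i, m, hm⟩ := h.cover e.hom
  exact ⟨i, fun j hij => h.isIso_of_section e.hom hm hij⟩

end IsPres

variable (P : ObjectProperty D)

/-- For `i = j` the cokernel is zero and belongs to `P`; this allows reindexing along monotone maps
that are not strictly monotone. -/
theorem IsRelIndDiagram.map (hE : E.IsExact) (hP : E.IsExtensionClosed P) {I : Type w}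
    [PartialOrder I] {X : I ⥤ D} (hX : IsRelIndDiagram E P X) {i j : I} (h : i ≤ j) :
    ∃ (Z : D) (g : X.obj j ⟶ Z), E.Conf (X.map (homOfLE h)) g ∧ P Z := by
  obtain rfl | h' := h.eq_or_lt
  · obtain ⟨O, hO⟩ := hE.hasZeroObject
    refine ⟨O, 0, ?_, hP.zero hO⟩
    rw [show homOfLE h = 𝟙 i from rfl, X.map_id]
    exact hE.conf_id_zero _ hO
  · exact hX h'

variable {P}

/-- A section killed in the colimit is killed at a later stage, and the transition maps are
monomorphisms, so the terms embed. -/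
theorem exists_isPres (hE : E.IsExact) (hP : E.IsExtensionClosed P) {I : Type w}
    [PartialOrder I] [IsDirectedOrder I] [Nonempty I] {X : I ⥤ D} (hX : IsRelIndDiagram E P X) :
    ∃ (F : LexCat.{w} E) (s : ∀ i, (lexYoneda.{w} E).obj (X.obj i) ⟶ F), IsPres X F s := by
  obtain ⟨F, s, h1, h2, h3⟩ := LexCat.exists_colimit.{w} hE X
  refine ⟨F, s, h1, fun i B m hm => ?_, h3⟩
  obtain ⟨j, hij, hj⟩ := h2 i B m hm
  obtain ⟨Z, g, hg, -⟩ := hX.map P hE hP hij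
  have := hg.pair.mono
  exact (cancel_mono (X.map (homOfLE hij))).1 (hj.trans zero_comp.symm)

theorem isPres_of_isColimit (hE : E.IsExact) (hP : E.IsExtensionClosed P) {I : Type w}
    [PartialOrder I] [IsDirectedOrder I] [Nonempty I] {X : I ⥤ D} (hX : IsRelIndDiagram E P X)
    {c : Cocone (X ⋙ (lexYoneda.{w} E))} (hc : IsColimit c) : IsPres X c.pt c.ι.app := by
  obtain ⟨F, s, h⟩ := exists_isPres.{w} hE hP hX
  obtain ⟨h'⟩ := h.nonempty_isColimit hE
  convert h.of_iso (h'.coconePointUniqueUpToIso hc) with i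
  exact (h'.comp_coconePointUniqueUpToIso_hom hc i).symm

/-- Replaces the universal property in Lex(D) by an elementwise description, the form used from here
on. -/
theorem isRelInd_iff (hE : E.IsExact) (hP : E.IsExtensionClosed P) {κ : Cardinal.{w}}
    {F : LexCat.{w} E} : isRelInd E P κ F ↔ ∃ (I : Type w) (_ : PartialOrder I)
      (_ : IsDirectedOrder I) (_ : Nonempty I) (X : I ⥤ D) (s : ∀ i, (lexYoneda.{w} E).obj (X.obj i) ⟶ F),
      Cardinal.mk I ≤ κ ∧ IsRelIndDiagram E P X ∧ IsPres X F s := by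
  constructor
  · rintro ⟨I, i1, i2, i3, X, hI, hX, c, ⟨hc⟩, ⟨e⟩⟩
    exact ⟨I, i1, i2, i3, X, _, hI, hX, (isPres_of_isColimit hE hP hX hc).of_iso e⟩
  · rintro ⟨I, i1, i2, i3, X, s, hI, hX, h⟩
    exact ⟨I, i1, i2, i3, X, hI, hX, h.cocone, h.nonempty_isColimit hE, ⟨Iso.refl _⟩⟩

end

end RelTate

end

noncomputable section

namespace RelTate

/-! ### Straightening of short exact sequences -/

/-- A finite set has finitely many proper subsets, so upper bounds can be chosen by strong
induction. This replaces a directed preorder that may be too large and not antisymmetric, such as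
that of `SubExt`, by the poset of finite subsets of a small index set. -/
theorem exists_monotone_finset {T : Type*} [Preorder T] [IsDirectedOrder T] [Nonempty T]
    {L : Type*} (b : L → T) :
    ∃ τ : Finset L → T, Monotone τ ∧ ∀ (l : L) (S : Finset L), l ∈ S → b l ≤ τ S := by
  classical
  have ub (S : Finset T) : ∃ M, ∀ i ∈ S, i ≤ M := Finset.exists_le S
  choose m hm using ub
  let H (S : Finset L) (ih : ∀ R, R ⊂ S → T) : T :=
    m (S.ssubsets.attach.image (fun R => ih R.1 (Finset.mem_ssubsets.1 R.2)) ∪ S.image b)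
  let τ (S : Finset L) : T := Finset.strongInduction (p := fun _ => T) H S
  have hτ (S : Finset L) : τ S = H S (fun R _ => τ R) := Finset.strongInduction_eq _ _
  refine ⟨τ, fun R S hRS => ?_, fun l S hl => ?_⟩
  · obtain rfl | h := (show R ⊆ S from hRS).eq_or_ssubset
    · exact le_rfl
    · rw [hτ S]
      refine hm _ _ (Finset.mem_union_left _ (Finset.mem_image.2 ?_))
      exact ⟨⟨R, Finset.mem_ssubsets.2 h⟩, Finset.mem_attach _ _, rfl⟩
  · rw [hτ S]
    exact hm _ _ (Finset.mem_union_right _ (Finset.mem_image_of_mem b hl))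

theorem mk_finset_le {κ : Cardinal.{w}} (hκ : Cardinal.aleph0 ≤ κ) {L : Type w}
    (hL : Cardinal.mk L ≤ κ) : Cardinal.mk (Finset L) ≤ κ := by
  cases finite_or_infinite L
  · exact (Cardinal.mk_lt_aleph0).le.trans hκ
  · rwa [Cardinal.mk_finset_of_infinite]

variable {D : Type u} [Category.{v} D] [Preadditive D] {E : ConflationClass D}

/-- A pushout along an inflation is encoded by the conflation `X ⟶ Y ⊞ X' ⟶ Y'`, on which every left
exact presheaf is exact. Hence compatible sections over `Y` and `X'` glue over `Y'`. -/
theorem lexYoneda_isPushout (hE : E.IsExact) {X Y Z X' Y' : D} {i : X ⟶ Y} {p : Y ⟶ Z}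
    (h : E.Conf i p) {f : X ⟶ X'} {f' : Y ⟶ Y'} {i' : X' ⟶ Y'} (hp : IsPushout i f f' i') :
    IsPushout ((lexYoneda.{w} E).map i) ((lexYoneda.{w} E).map f) ((lexYoneda.{w} E).map f') ((lexYoneda.{w} E).map i') := by
  have := hE.hasBinaryBiproducts
  have hc := hE.conf_of_isPushout h hp biprod.inl biprod.inr biprod.fst biprod.snd (by simp)
    (by simp) (by simp) (by simp) (by simp)
  have w : (lexYoneda.{w} E).map i ≫ (lexYoneda.{w} E).map f' = (lexYoneda.{w} E).map f ≫ (lexYoneda.{w} E).map i' := by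
    rw [← Functor.map_comp, hp.w, Functor.map_comp]
  have key (c : PushoutCocone ((lexYoneda.{w} E).map i) ((lexYoneda.{w} E).map f)) : ∃ l : (lexYoneda.{w} E).obj Y' ⟶ c.pt,
      (lexYoneda.{w} E).map f' ≫ l = c.inl ∧ (lexYoneda.{w} E).map i' ≫ l = c.inr := by
    obtain ⟨l, hl⟩ := LexCat.exists_desc hE c.pt hc
      ((lexYoneda.{w} E).map biprod.fst ≫ c.inl + (lexYoneda.{w} E).map biprod.snd ≫ c.inr) (by
        simp only [Preadditive.comp_add, ← Functor.map_comp_assoc, Preadditive.sub_comp,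
          Category.assoc, biprod.inl_fst, biprod.inr_fst, biprod.inl_snd, biprod.inr_snd,
          comp_zero, Category.comp_id, sub_zero, zero_sub, Functor.map_neg, Preadditive.neg_comp,
          c.condition, add_neg_cancel])
    refine ⟨l, ?_, ?_⟩
    · have := congrArg ((lexYoneda.{w} E).map (biprod.inl : Y ⟶ Y ⊞ X') ≫ ·) hl
      simpa only [Preadditive.comp_add, ← Functor.map_comp_assoc, biprod.inl_fst_assoc,
        biprod.inl_snd_assoc, biprod.inl_fst, biprod.inl_snd, zero_comp, add_zero,
        CategoryTheory.Functor.map_id, Category.id_comp, Functor.map_zero] using this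
    · have := congrArg ((lexYoneda.{w} E).map (biprod.inr : X' ⟶ Y ⊞ X') ≫ ·) hl
      simpa only [Preadditive.comp_add, ← Functor.map_comp_assoc, biprod.inr_fst_assoc,
        biprod.inr_snd_assoc, biprod.inr_fst, biprod.inr_snd, zero_comp, zero_add,
        CategoryTheory.Functor.map_id, Category.id_comp, Functor.map_zero] using this
  refine ⟨⟨w⟩, ⟨PushoutCocone.IsColimit.mk w (fun c => (key c).choose)
    (fun c => (key c).choose_spec.1) (fun c => (key c).choose_spec.2) (fun c m h₁ h₂ => ?_)⟩⟩
  refine LexCat.cancel_epi _ hc ?_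
  simp only [Functor.map_add, Preadditive.add_comp, Functor.map_comp, Category.assoc, h₁, h₂,
    (key c).choose_spec.1, (key c).choose_spec.2]

section

variable {I J : Type w} [PartialOrder I] [PartialOrder J] {X : I ⥤ D} {Z : J ⥤ D}
  {F G H : LexCat.{w} E}

/-- A conflation of objects `X i` and `Z j`, embedded in a short exact sequence. -/
structure SubExt (x : ∀ i, (lexYoneda.{w} E).obj (X.obj i) ⟶ F) (z : ∀ j, (lexYoneda.{w} E).obj (Z.obj j) ⟶ H)
    (f : F ⟶ G) (g : G ⟶ H) where
  i : I
  j : J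
  W : D
  u : X.obj i ⟶ W
  v : W ⟶ Z.obj j
  y : (lexYoneda.{w} E).obj W ⟶ G
  conf : E.Conf u v
  map_u : (lexYoneda.{w} E).map u ≫ y = x i ≫ f
  map_v : y ≫ g = (lexYoneda.{w} E).map v ≫ z j

namespace SubExt

variable {x : ∀ i, (lexYoneda.{w} E).obj (X.obj i) ⟶ F} {z : ∀ j, (lexYoneda.{w} E).obj (Z.obj j) ⟶ H} {f : F ⟶ G} {g : G ⟶ H}

/-- Only compatibility with the maps to `G` is imposed. When the sequence is exact and `x`, `z` are
presentations, compatibility of `m` with `u` and `v` follows, because maps into `W` and `Z.obj j`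
are determined by their composites to `G` and `H`. -/
instance : Preorder (SubExt x z f g) where
  le s t := s.i ≤ t.i ∧ s.j ≤ t.j ∧ ∃ m : s.W ⟶ t.W, (lexYoneda.{w} E).map m ≫ t.y = s.y
  le_refl s := ⟨le_rfl, le_rfl, 𝟙 _, by simp⟩
  le_trans := by
    rintro s t r ⟨h1, h2, m, hm⟩ ⟨h3, h4, n, hn⟩
    exact ⟨h1.trans h3, h2.trans h4, m ≫ n, by rw [Functor.map_comp_assoc, hn, hm]⟩

variable (hE : E.IsExact) (hfg : LexExact f g) (hx : IsPres X F x) (hz : IsPres Z H z)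
include hE hfg hx hz

theorem eq_zero (t : SubExt x z f g) {B : D} (m : B ⟶ t.W) (hm : (lexYoneda.{w} E).map m ≫ t.y = 0) : m = 0 := by
  have := hfg.mono hE
  have h1 : m ≫ t.v = 0 := hz.eq_zero _ _ (by
    rw [Functor.map_comp_assoc, ← t.map_v, reassoc_of% hm, zero_comp])
  obtain ⟨l, rfl⟩ := t.conf.pair.exists_lift m h1
  rw [hx.eq_zero _ l, zero_comp]
  rw [← cancel_mono f, Category.assoc, ← t.map_u, ← Functor.map_comp_assoc, hm, zero_comp]

theorem eq (t : SubExt x z f g) {B : D} {m n : B ⟶ t.W} (h : (lexYoneda.{w} E).map m ≫ t.y = (lexYoneda.{w} E).map n ≫ t.y) :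
    m = n := by
  rw [← sub_eq_zero]
  refine t.eq_zero hE hfg hx hz _ ?_
  rw [Functor.map_sub, Preadditive.sub_comp, h, sub_self]

omit hz in
-- A lift of `z j₀` to `G` over a deflation `p : B ⟶ Z.obj j₀` restricts on the kernel of `p` to a
-- section of `F`, hence of some `X.obj i`. Pushing the conflation of `p` out along it gives the
-- extension `W`.
theorem exists_ge [IsDirectedOrder I] (i₀ : I) (j₀ : J) :
    ∃ t : SubExt x z f g, i₀ ≤ t.i ∧ j₀ ≤ t.j := by
  obtain ⟨B, p, b, ⟨N, n, hp⟩, hb⟩ := hfg.locEpi (z j₀)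
  obtain ⟨r, hr⟩ := hfg.exists_lift ((lexYoneda.{w} E).map n ≫ b) (by
    rw [Category.assoc, hb, ← Functor.map_comp_assoc, hp.pair.w, Functor.map_zero, zero_comp])
  obtain ⟨i, m, hi, rfl⟩ := hx.cover_ge i₀ r
  obtain ⟨W, f', u, v, hW, hc, hv⟩ := hE.exists_pushout_conf hp m
  have hY := lexYoneda_isPushout.{w} hE hp hW
  have hw : (lexYoneda.{w} E).map n ≫ b = (lexYoneda.{w} E).map m ≫ x i ≫ f := by rw [← hr, Category.assoc]
  refine ⟨⟨i, j₀, W, u, v, hY.desc b (x i ≫ f) hw, hc, by simp, hY.hom_ext ?_ ?_⟩, hi, le_rfl⟩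
  · rw [← Category.assoc, hY.inl_desc, hb, ← Functor.map_comp_assoc, hv]
  · rw [← Category.assoc, hY.inr_desc, Category.assoc, hfg.w, comp_zero, ← Functor.map_comp_assoc,
      hc.pair.w, Functor.map_zero, zero_comp]

omit hz in
theorem exists_ge_left [IsDirectedOrder I] (t : SubExt x z f g) (i₀ : I) :
    ∃ t', t ≤ t' ∧ i₀ ≤ t'.i := by
  obtain ⟨i, hi, hi'⟩ := exists_ge_ge t.i i₀
  obtain ⟨W, f', u, v, hW, hc, hv⟩ := hE.exists_pushout_conf t.conf (X.map (homOfLE hi))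
  have hY := lexYoneda_isPushout.{w} hE t.conf hW
  have hw : (lexYoneda.{w} E).map t.u ≫ t.y = (lexYoneda.{w} E).map (X.map (homOfLE hi)) ≫ x i ≫ f := by
    rw [t.map_u, ← Category.assoc, hx.nat]
  refine ⟨⟨i, t.j, W, u, v, hY.desc t.y (x i ≫ f) hw, hc, by simp, hY.hom_ext ?_ ?_⟩,
    ⟨hi, le_rfl, f', by simp⟩, hi'⟩
  · rw [← Category.assoc, hY.inl_desc, t.map_v, ← Functor.map_comp_assoc, hv]
  · rw [← Category.assoc, hY.inr_desc, Category.assoc, hfg.w, comp_zero, ← Functor.map_comp_assoc,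
      hc.pair.w, Functor.map_zero, zero_comp]

/-- Over the pullback `Q` of `t.conf` along `c`, the section `b` and the map through `t.W` agree in
`H`, so they differ by a section of `F`, which lies in some `X.obj i₀`. Once `i₀ ≤ t'.i` the
difference is absorbed in `t'.W`, and the corrected map descends from `Q` to `B`. -/
theorem exists_factor (t : SubExt x z f g) {B : D} (b : (lexYoneda.{w} E).obj B ⟶ G) (c : B ⟶ Z.obj t.j)
    (hb : b ≫ g = (lexYoneda.{w} E).map c ≫ z t.j) : ∃ i₀, ∀ t' : SubExt x z f g, t ≤ t' → i₀ ≤ t'.i →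
      ∃ m : B ⟶ t'.W, (lexYoneda.{w} E).map m ≫ t'.y = b := by
  obtain ⟨Q, a, q, k, hQ, hc, hk⟩ := hE.exists_pullback_conf t.conf c
  obtain ⟨r, hr⟩ := hfg.exists_lift ((lexYoneda.{w} E).map a ≫ t.y - (lexYoneda.{w} E).map q ≫ b) (by
    rw [Preadditive.sub_comp, Category.assoc, Category.assoc, t.map_v, hb,
      ← Functor.map_comp_assoc, ← Functor.map_comp_assoc, hQ.w, sub_self])
  obtain ⟨i₀, n, rfl⟩ := hx.cover r
  refine ⟨i₀, ?_⟩
  rintro t' ⟨hi, hj, m, hm⟩ hi'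
  have h1 : (lexYoneda.{w} E).map (n ≫ X.map (homOfLE hi') ≫ t'.u) ≫ t'.y = (lexYoneda.{w} E).map a ≫ t.y - (lexYoneda.{w} E).map q ≫ b := by
    rw [Functor.map_comp_assoc, Functor.map_comp_assoc, t'.map_u, ← hr, Category.assoc,
      ← hx.nat hi', Category.assoc]
  have h2 : (lexYoneda.{w} E).map (a ≫ m - n ≫ X.map (homOfLE hi') ≫ t'.u) ≫ t'.y = (lexYoneda.{w} E).map q ≫ b := by
    rw [Functor.map_sub, Preadditive.sub_comp, h1, Functor.map_comp_assoc, hm, sub_sub_cancel]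
  obtain ⟨l, hl⟩ := hc.pair.exists_desc (a ≫ m - n ≫ X.map (homOfLE hi') ≫ t'.u)
    (t'.eq_zero hE hfg hx hz _ (by
      rw [Functor.map_comp_assoc, h2, ← Functor.map_comp_assoc, hc.pair.w, Functor.map_zero,
        zero_comp]))
  exact ⟨l, LexCat.cancel_epi _ hc (by rw [← Functor.map_comp_assoc, hl, h2])⟩

theorem isDirectedOrder [IsDirectedOrder I] [IsDirectedOrder J] :
    IsDirectedOrder (SubExt x z f g) where
  directed s t := by
    obtain ⟨i, hi, hi'⟩ := exists_ge_ge s.i t.i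
    obtain ⟨j, hj, hj'⟩ := exists_ge_ge s.j t.j
    -- At first `r` only has large enough indices, with no maps from `s.W` and `t.W`; its subobject
    -- is then enlarged to absorb the obstructions to both maps.
    obtain ⟨r, hr, hr'⟩ := exists_ge hE hfg hx i j
    have key (s : SubExt x z f g) (hs : s.j ≤ r.j) := r.exists_factor hE hfg hx hz s.y
      (s.v ≫ Z.map (homOfLE hs)) (by rw [s.map_v, Functor.map_comp_assoc, hz.nat])
    obtain ⟨i₁, h₁⟩ := key s (hj.trans hr')
    obtain ⟨i₂, h₂⟩ := key t (hj'.trans hr')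
    obtain ⟨i₃, hi₁, hi₂⟩ := exists_ge_ge i₁ i₂
    obtain ⟨r', hrr, hi₃⟩ := r.exists_ge_left hE hfg hx i₃
    exact ⟨r', ⟨(hi.trans hr).trans hrr.1, (hj.trans hr').trans hrr.2.1,
      h₁ r' hrr (hi₁.trans hi₃)⟩, ⟨(hi'.trans hr).trans hrr.1, (hj'.trans hr').trans hrr.2.1,
      h₂ r' hrr (hi₂.trans hi₃)⟩⟩

end SubExt

end

variable (P : ObjectProperty D) (κ : Cardinal.{w})

/-- A presentation of a sequence of left exact presheaves as a directed union of conflations. -/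
structure ConfPres {F G H : LexCat.{w} E} (f : F ⟶ G) (g : G ⟶ H) where
  K : Type w
  [partialOrder : PartialOrder K]
  [isDirectedOrder : IsDirectedOrder K]
  [nonempty : Nonempty K]
  card_le : Cardinal.mk K ≤ κ
  X : K ⥤ D
  Y : K ⥤ D
  Z : K ⥤ D
  u : X ⟶ Y
  v : Y ⟶ Z
  conf : ∀ k, E.Conf (u.app k) (v.app k)
  diagX : IsRelIndDiagram E P X
  diagY : IsRelIndDiagram E P Y
  diagZ : IsRelIndDiagram E P Z
  x : ∀ k, (lexYoneda.{w} E).obj (X.obj k) ⟶ F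
  y : ∀ k, (lexYoneda.{w} E).obj (Y.obj k) ⟶ G
  z : ∀ k, (lexYoneda.{w} E).obj (Z.obj k) ⟶ H
  presX : IsPres X F x
  presY : IsPres Y G y
  presZ : IsPres Z H z
  map_u : ∀ k, (lexYoneda.{w} E).map (u.app k) ≫ y k = x k ≫ f
  map_v : ∀ k, y k ≫ g = (lexYoneda.{w} E).map (v.app k) ≫ z k

attribute [instance] ConfPres.partialOrder ConfPres.isDirectedOrder ConfPres.nonempty

variable {P κ}

/-- The extensions of terms of `Z` by terms of `X` inside `G` form a directed preorder exhausting
`G`. A monotone family over the finite subsets of `I × J` that dominates one extension for each pair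
of indices already covers all three presheaves. That the outer terms are terms of the given diagrams
matters when those terms are known to lie in `P`. -/
theorem exists_confPres (hE : E.IsExact) (hP : E.IsExtensionClosed P) (hκ : Cardinal.aleph0 ≤ κ)
    {F G H : LexCat.{w} E} {f : F ⟶ G} {g : G ⟶ H} (hfg : LexExact f g) {I J : Type w}
    [PartialOrder I] [IsDirectedOrder I] [Nonempty I] (hI : Cardinal.mk I ≤ κ)
    [PartialOrder J] [IsDirectedOrder J] [Nonempty J] (hJ : Cardinal.mk J ≤ κ)
    {X : I ⥤ D} (hX : IsRelIndDiagram E P X) {Z : J ⥤ D} (hZ : IsRelIndDiagram E P Z)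
    {x : ∀ i, (lexYoneda.{w} E).obj (X.obj i) ⟶ F} (hx : IsPres X F x)
    {z : ∀ j, (lexYoneda.{w} E).obj (Z.obj j) ⟶ H} (hz : IsPres Z H z) :
    ∃ c : ConfPres P κ f g, (∀ k, ∃ i, c.X.obj k = X.obj i) ∧ ∀ k, ∃ j, c.Z.obj k = Z.obj j := by
  have := SubExt.isDirectedOrder hE hfg hx hz
  obtain ⟨i₀⟩ := ‹Nonempty I›
  obtain ⟨j₀⟩ := ‹Nonempty J›
  have : Nonempty (SubExt x z f g) := ⟨(SubExt.exists_ge (z := z) hE hfg hx i₀ j₀).choose⟩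
  choose b hb hb' using fun l : I × J => SubExt.exists_ge (z := z) hE hfg hx l.1 l.2
  obtain ⟨τ, hτ, hbτ⟩ := exists_monotone_finset b
  have hα : Monotone fun k => (τ k).i := fun k l h => (hτ h).1
  have hβ : Monotone fun k => (τ k).j := fun k l h => (hτ h).2.1
  choose m hm using fun k l (h : k ≤ l) => (hτ h).2.2
  let X' : Finset (I × J) ⥤ D := hα.functor ⋙ X
  let Z' : Finset (I × J) ⥤ D := hβ.functor ⋙ Z
  let W : Finset (I × J) ⥤ D :=
    { obj := fun k => (τ k).W
      map := fun {k l} h => m k l (leOfHom h)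
      map_id := fun k => (τ k).eq hE hfg hx hz (by rw [hm]; simp)
      map_comp := fun {k l r} h h' => (τ r).eq hE hfg hx hz (by
        rw [hm, Functor.map_comp_assoc, hm, hm]) }
  have hX' {k l} (h : k ≤ l) : X'.map (homOfLE h) = X.map (homOfLE (hα h)) := rfl
  have hZ' {k l} (h : k ≤ l) : Z'.map (homOfLE h) = Z.map (homOfLE (hβ h)) := rfl
  have hu {k l} (h : k ≤ l) : X.map (homOfLE (hα h)) ≫ (τ l).u = (τ k).u ≫ m k l h :=
    (τ l).eq hE hfg hx hz (by
      rw [Functor.map_comp_assoc, (τ l).map_u, Functor.map_comp_assoc, hm, (τ k).map_u,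
        ← Category.assoc, hx.nat])
  have hv {k l} (h : k ≤ l) : m k l h ≫ (τ l).v = (τ k).v ≫ Z.map (homOfLE (hβ h)) :=
    hz.eq (by
      rw [Functor.map_comp_assoc, ← (τ l).map_v, ← Category.assoc, hm, (τ k).map_v,
        Functor.map_comp_assoc, hz.nat])
  refine ⟨{
    K := Finset (I × J)
    card_le := mk_finset_le hκ (by
      rw [Cardinal.mk_prod, Cardinal.lift_id, Cardinal.lift_id]
      exact (mul_le_mul' hI hJ).trans (Cardinal.mul_eq_self hκ).le)
    X := X'
    Y := W
    Z := Z'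
    u := { app := fun k => (τ k).u, naturality := fun k l h => hu (leOfHom h) }
    v := { app := fun k => (τ k).v, naturality := fun k l h => hv (leOfHom h) }
    conf := fun k => (τ k).conf
    diagX := fun k l h => hX.map P hE hP (hα h.le)
    diagZ := fun k l h => hZ.map P hE hP (hβ h.le)
    diagY := fun k l h => ?_
    x := fun k => x _
    y := fun k => (τ k).y
    z := fun k => z _
    presX := ⟨fun k l h => hx.nat (hα h), fun k => hx.eq_zero _, fun B t => ?_⟩
    presY := ⟨fun k l h => hm k l h, fun k B n => (τ k).eq_zero hE hfg hx hz n, fun B t => ?_⟩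
    presZ := ⟨fun k l h => hz.nat (hβ h), fun k => hz.eq_zero _, fun B t => ?_⟩
    map_u := fun k => (τ k).map_u
    map_v := fun k => (τ k).map_v }, fun k => ⟨_, rfl⟩, fun k => ⟨_, rfl⟩⟩
  · obtain ⟨A, a, ha, hA⟩ := hX.map P hE hP (hα h.le)
    obtain ⟨C, c, hc, hC⟩ := hZ.map P hE hP (hβ h.le)
    -- The cokernel between two middle terms is an extension of the outer cokernels, so it stays in
    -- `P`.
    obtain ⟨B, b', j, q, h1, h2, -⟩ := hE.conf_mid (τ k).conf (τ l).conf ha hc (hu h.le).symm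
      (hv h.le).symm
    exact ⟨B, b', h1, hP.extension _ _ h2 hA hC⟩
  · obtain ⟨i, n, hn⟩ := hx.cover t
    exact ⟨{(i, j₀)}, _, hx.factor_of_le ((hb (i, j₀)).trans (hbτ _ _ (by simp)).1) n hn⟩
  · obtain ⟨j, c, hc⟩ := hz.cover (t ≫ g)
    have hj : j ≤ (τ {(i₀, j)}).j := (hb' (i₀, j)).trans (hbτ _ _ (by simp)).2.1
    -- The index `j` accommodates the image of `t` in `H`. Only then is the `i` known that absorbs
    -- the remaining part in `F`, whence the union of two singletons below.
    obtain ⟨i, hi⟩ := (τ {(i₀, j)}).exists_factor hE hfg hx hz t (c ≫ Z.map (homOfLE hj))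
      (by rw [hz.factor_of_le hj c hc])
    classical
    obtain ⟨n, hn⟩ := hi (τ ({(i₀, j)} ∪ {(i, j)})) (hτ Finset.subset_union_left)
      ((hb (i, j)).trans (hbτ _ _ (by simp)).1)
    exact ⟨_, n, hn⟩
  · obtain ⟨j, n, hn⟩ := hz.cover t
    exact ⟨{(i₀, j)}, _, hz.factor_of_le ((hb' (i₀, j)).trans (hbτ _ _ (by simp)).2.1) n hn⟩

end RelTate

end

noncomputable section

namespace RelTate

/-! ### Colimits of conflations -/

namespace ConflationClass.IsExact

variable {D : Type u} [Category.{v} D] [Preadditive D] {E : ConflationClass D} (hE : E.IsExact)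
include hE

/-- The conflation of the cokernels of a composition of two inflations. -/
theorem conf_coker {X Y Z A B C : D} {f : X ⟶ Y} {p : Y ⟶ A} {g : Y ⟶ Z} {q : Z ⟶ B} {r : Z ⟶ C}
    (hf : E.Conf f p) (hg : E.Conf g q) (hr : E.Conf (f ≫ g) r) {a : A ⟶ C} (ha : p ≫ a = g ≫ r) :
    ∃ b : C ⟶ B, E.Conf a b := by
  obtain ⟨Q, r', a', b, h1, h2, h3, h4⟩ := hE.conf_comp hf hg
  have := hf.pair.epi
  obtain ⟨e, he⟩ := h1.pair.exists_iso hr.pair.w hr.pair.epi (fun T k => hr.pair.exists_desc k)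
  have : a = a' ≫ e.hom := by rw [← cancel_epi p, ha, reassoc_of% h3, he]
  rw [this]
  exact ⟨_, hE.conf_iso_mid h2 e⟩

omit hE in
theorem exists_cokernel_functor {K : Type*} [Category K] {X Y : K ⥤ D} (u : X ⟶ Y)
    (hu : ∀ k, E.Inflation (u.app k)) :
    ∃ (Z : K ⥤ D) (v : Y ⟶ Z), ∀ k, E.Conf (u.app k) (v.app k) := by
  choose Z v hv using hu
  have hepi (k) : Epi (v k) := (hv k).pair.epi
  choose m hm using fun (k l : K) (h : k ⟶ l) => (hv k).pair.exists_desc (Y.map h ≫ v l)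
    (by rw [← u.naturality_assoc, (hv l).pair.w, comp_zero])
  exact ⟨{ obj := Z
           map := fun {k l} h => m k l h
           map_id := fun k => by rw [← cancel_epi (v k), hm]; simp
           map_comp := fun {k l r} h h' => by
             rw [← cancel_epi (v k), hm, reassoc_of% hm k l h, hm]; simp },
    { app := v, naturality := fun k l h => (hm k l h).symm }, hv⟩

end ConflationClass.IsExact

section

variable {D : Type u} [Category.{v} D] [Preadditive D] {E : ConflationClass D}

/-- Each condition concerns a single section, which lives at a single stage, where it holds because
that stage is a conflation. -/
theorem LexExact.of_isPres (hE : E.IsExact) {K : Type w} [PartialOrder K] {X Y Z : K ⥤ D}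
    {F G H : LexCat.{w} E} {f : F ⟶ G} {g : G ⟶ H} {x : ∀ k, (lexYoneda.{w} E).obj (X.obj k) ⟶ F}
    {y : ∀ k, (lexYoneda.{w} E).obj (Y.obj k) ⟶ G} {z : ∀ k, (lexYoneda.{w} E).obj (Z.obj k) ⟶ H} (hx : IsPres X F x)
    (hy : IsPres Y G y) (hz : IsPres Z H z) (u : ∀ k, X.obj k ⟶ Y.obj k)
    (v : ∀ k, Y.obj k ⟶ Z.obj k) (h : ∀ k, E.Conf (u k) (v k))
    (hu : ∀ k, (lexYoneda.{w} E).map (u k) ≫ y k = x k ≫ f) (hv : ∀ k, y k ≫ g = (lexYoneda.{w} E).map (v k) ≫ z k) :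
    LexExact f g where
  w := hx.hom_ext hE fun k => by
    rw [← Category.assoc, ← hu, Category.assoc, hv, ← Functor.map_comp_assoc, (h k).pair.w,
      Functor.map_zero, zero_comp, comp_zero]
  eq_zero A s hs := by
    obtain ⟨k, m, rfl⟩ := hx.cover s
    have := (h k).pair.mono
    rw [Category.assoc, ← hu, ← Functor.map_comp_assoc] at hs
    rw [(cancel_mono (u k)).1 ((hy.eq_zero k _ hs).trans zero_comp.symm), Functor.map_zero,
      zero_comp]
  exists_lift A s hs := by
    obtain ⟨k, m, rfl⟩ := hy.cover s
    rw [Category.assoc, hv, ← Functor.map_comp_assoc] at hs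
    obtain ⟨l, rfl⟩ := (h k).pair.exists_lift m (hz.eq_zero k _ hs)
    exact ⟨(lexYoneda.{w} E).map l ≫ x k, by rw [Functor.map_comp_assoc, hu, Category.assoc]⟩
  locEpi A s := by
    obtain ⟨k, m, rfl⟩ := hz.cover s
    obtain ⟨C, q, a, hq, ha⟩ := hE.exists_cover ⟨_, _, h k⟩ m
    exact ⟨C, q, (lexYoneda.{w} E).map a ≫ y k, hq, by
      rw [Category.assoc, hv, ← Functor.map_comp_assoc, ha, Functor.map_comp_assoc]⟩

theorem IsPres.restrict {I K : Type w} [PartialOrder I] [PartialOrder K] {X : I ⥤ D}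
    {F : LexCat.{w} E} {x : ∀ i, (lexYoneda.{w} E).obj (X.obj i) ⟶ F} (hx : IsPres X F x) {α : K → I}
    (hα : Monotone α) (hα' : ∀ i, ∃ k, i ≤ α k) :
    IsPres (hα.functor ⋙ X) F (fun k => x (α k)) where
  nat k l h := hx.nat (hα h)
  eq_zero k := hx.eq_zero (α k)
  cover B t := by
    obtain ⟨i, m, hm⟩ := hx.cover t
    obtain ⟨k, hk⟩ := hα' i
    exact ⟨k, _, hx.factor_of_le hk m hm⟩

theorem isPres_const {I : Type w} [PartialOrder I] [Nonempty I] (A : D) :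
    IsPres ((Functor.const I).obj A) ((lexYoneda.{w} E).obj A) (fun _ => 𝟙 _) where
  nat i j h := by simp
  eq_zero i B m hm := by
    rw [Category.comp_id, Functor.map_eq_zero_iff] at hm
    exact hm
  cover B t := by
    obtain ⟨i⟩ := ‹Nonempty I›
    obtain ⟨m, hm⟩ := (lexYoneda.{w} E).map_surjective t
    exact ⟨i, m, by simpa using hm⟩

variable {P : ObjectProperty D} {κ : Cardinal.{w}}

variable (P κ) in
/-- The left exact presheaves which are directed unions of objects satisfying `P`. -/
def IsIndOf (F : LexCat.{w} E) : Prop :=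
  ∃ (I : Type w) (_ : PartialOrder I) (_ : IsDirectedOrder I) (_ : Nonempty I) (X : I ⥤ D)
    (s : ∀ i, (lexYoneda.{w} E).obj (X.obj i) ⟶ F),
    Cardinal.mk I ≤ κ ∧ IsRelIndDiagram E P X ∧ IsPres X F s ∧ ∀ i, P (X.obj i)

theorem IsIndOf.isRelInd (hE : E.IsExact) (hP : E.IsExtensionClosed P) {F : LexCat.{w} E}
    (h : IsIndOf P κ F) : isRelInd E P κ F := by
  obtain ⟨I, i1, i2, i3, X, s, hI, hX, h, -⟩ := h
  exact (isRelInd_iff hE hP).2 ⟨I, i1, i2, i3, X, s, hI, hX, h⟩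

/-- The quotient of an Ind object by a term of a presentation. -/
theorem exists_quotient (hE : E.IsExact) (hP : E.IsExtensionClosed P) {I : Type w}
    [PartialOrder I] [IsDirectedOrder I] (hI : Cardinal.mk I ≤ κ) {X : I ⥤ D}
    (hX : IsRelIndDiagram E P X) {F : LexCat.{w} E} {x : ∀ i, (lexYoneda.{w} E).obj (X.obj i) ⟶ F}
    (hx : IsPres X F x) (i₀ : I) :
    ∃ (Q : LexCat.{w} E) (q : F ⟶ Q), IsIndOf P κ Q ∧ LexExact (x i₀) q := by
  -- The stages above `i₀` are cofinal and contain `X.obj i₀`; `Z` below is the diagram of the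
  -- quotients `X i / X i₀`, whose transition cokernels are those of `X`.
  let K := { i : I // i₀ ≤ i }
  have hα : Monotone (fun k : K => k.1) := fun k l h => h
  have : Nonempty K := ⟨⟨i₀, le_rfl⟩⟩
  have : IsDirectedOrder K := ⟨fun k l => by
    obtain ⟨j, h1, h2⟩ := exists_ge_ge k.1 l.1
    exact ⟨⟨j, le_trans k.2 h1⟩, h1, h2⟩⟩
  have hα' (i : I) : ∃ k : K, i ≤ k.1 := by
    obtain ⟨j, h1, h2⟩ := exists_ge_ge i₀ i
    exact ⟨⟨j, h1⟩, h2⟩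
  let u : (Functor.const K).obj (X.obj i₀) ⟶ hα.functor ⋙ X :=
    { app := fun k => X.map (homOfLE k.2)
      naturality := fun k l h => (Category.id_comp _).trans
        (X.map_comp (homOfLE k.2) (homOfLE (leOfHom h))) }
  obtain ⟨Z, v, hv⟩ := ConflationClass.IsExact.exists_cokernel_functor (E := E) u
    (fun k => by
      obtain ⟨C, c, hc, -⟩ := hX.map P hE hP k.2
      exact ⟨C, c, hc⟩)
  have hZ : IsRelIndDiagram E P Z := by
    intro k l h
    obtain ⟨C, c, hc, hC⟩ := hX.map P hE hP (hα h.le)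
    have hcomp : u.app k ≫ X.map (homOfLE (hα h.le)) = u.app l :=
      (X.map_comp (homOfLE k.2) (homOfLE (hα h.le))).symm
    obtain ⟨b, hb⟩ := hE.conf_coker (hv k) hc (hcomp ▸ hv l) (a := Z.map (homOfLE h.le))
      (v.naturality (homOfLE h.le)).symm
    exact ⟨C, b, hb, hC⟩
  have hPZ (k : K) : P (Z.obj k) := by
    obtain ⟨C, c, hc, hC⟩ := hX.map P hE hP k.2
    obtain ⟨e, -⟩ := hc.pair.exists_iso (hv k).pair.w (hv k).pair.epi
      (fun T t => (hv k).pair.exists_desc t)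
    exact hP.of_iso e hC
  obtain ⟨Q, z, hz⟩ := exists_isPres.{w} hE hP hZ
  have hx' := hx.restrict hα hα'
  obtain ⟨q, hq⟩ := hx'.exists_desc hE (fun k => (lexYoneda.{w} E).map (v.app k) ≫ z k) (fun k l h => by
    rw [← Functor.map_comp_assoc, v.naturality, Functor.map_comp_assoc, hz.nat])
  refine ⟨Q, q, ⟨K, inferInstance, inferInstance, inferInstance, Z, z,
    (Cardinal.mk_subtype_le _).trans hI, hZ, hz, hPZ⟩, ?_⟩
  exact LexExact.of_isPres hE (isPres_const (I := K) (X.obj i₀)) hx' hz u.app v.app hv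
    (fun k => (hx.nat k.2).trans (Category.id_comp _).symm) hq

/-- The middle terms of a straightening present `G`; this is closure of the Ind objects under
extensions in Lex(D). -/
theorem isRelInd_of_lexExact (hE : E.IsExact) (hP : E.IsExtensionClosed P)
    (hκ : Cardinal.aleph0 ≤ κ) {F G H : LexCat.{w} E} {f : F ⟶ G} {g : G ⟶ H}
    (h : LexExact f g) (hF : isRelInd E P κ F) (hH : isRelInd E P κ H) :
    Nonempty (ConfPres P κ f g) ∧ isRelInd E P κ G := by
  obtain ⟨I, _, _, _, X, x, hI, hX, hx⟩ := (isRelInd_iff hE hP).1 hF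
  obtain ⟨J, _, _, _, Z, z, hJ, hZ, hz⟩ := (isRelInd_iff hE hP).1 hH
  obtain ⟨c, -⟩ := exists_confPres hE hP hκ h hI hJ hX hZ hx hz
  exact ⟨⟨c⟩, (isRelInd_iff hE hP).2 ⟨c.K, c.partialOrder, c.isDirectedOrder, c.nonempty, c.Y, c.y,
    c.card_le, c.diagY, c.presY⟩⟩

/-- The map `G ⊕ F' ⟶ G'` is a local epimorphism: a section of `G'` locally agrees in `H` with a
section of `G`, and the difference comes from `F'`. Its kernel is `F` embedded by `(f, -a)`, so maps
out of `G'` are compatible pairs. -/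
theorem LexExact.isPushout (hE : E.IsExact) {F G H F' G' : LexCat.{w} E} {f : F ⟶ G} {g : G ⟶ H}
    {f' : F' ⟶ G'} {g' : G' ⟶ H} (h : LexExact f g) (h' : LexExact f' g') {a : F ⟶ F'}
    {b : G ⟶ G'} (hw : f ≫ b = a ≫ f') (hg : b ≫ g' = g) : IsPushout f a b f' := by
  obtain ⟨Q, fst, snd, inl, inr, h1, h2, h3, h4, h5⟩ := LexCat.exists_prod G F'
  have hl : LocEpi (fst ≫ b + snd ≫ f') := by
    intro A s
    obtain ⟨B, p, t, hp, ht⟩ := h.locEpi (s ≫ g')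
    obtain ⟨r, hr⟩ := h'.exists_lift ((lexYoneda.{w} E).map p ≫ s - t ≫ b) (by
      rw [Preadditive.sub_comp, Category.assoc, Category.assoc, hg, ht, sub_self])
    refine ⟨B, p, t ≫ inl + r ≫ inr, hp, ?_⟩
    simp [reassoc_of% h1, reassoc_of% h2, reassoc_of% h3, reassoc_of% h4, hr]
  have hepi := LexCat.epi_of_locEpi hE hl
  have key (c : PushoutCocone f a) : ∃ l : G' ⟶ c.pt, (fst ≫ b + snd ≫ f') ≫ l =
      fst ≫ c.inl + snd ≫ c.inr := by
    refine LexCat.exists_desc_of_locEpi hE hl _ (fun A s hs => ?_)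
    have hs' : (s ≫ fst) ≫ b + (s ≫ snd) ≫ f' = 0 := by simpa using hs
    have h6 : (s ≫ fst) ≫ g = 0 := by
      have := congrArg (· ≫ g') hs'
      simpa [hg, h'.w] using this
    obtain ⟨r, hr⟩ := h.exists_lift _ h6
    have := h'.mono hE
    have h7 : s ≫ snd = - (r ≫ a) := by
      rw [← cancel_mono f', ← sub_eq_zero]
      rw [← hr, Category.assoc, hw] at hs'
      rw [← hs']
      simp [add_comm]
    rw [Preadditive.comp_add, ← Category.assoc, ← Category.assoc, ← hr, h7, Category.assoc,
      c.condition]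
    simp
  have hinl : inl ≫ (fst ≫ b + snd ≫ f') = b := by
    rw [Preadditive.comp_add, reassoc_of% h1, reassoc_of% h2, zero_comp, add_zero]
  have hinr : inr ≫ (fst ≫ b + snd ≫ f') = f' := by
    rw [Preadditive.comp_add, reassoc_of% h3, reassoc_of% h4, zero_comp, zero_add]
  refine ⟨⟨hw⟩, ⟨PushoutCocone.IsColimit.mk hw (fun c => (key c).choose) (fun c => ?_)
    (fun c => ?_) (fun c m hm hm' => ?_)⟩⟩
  · have := congrArg (inl ≫ ·) (key c).choose_spec
    rw [← Category.assoc, hinl] at this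
    rw [this, Preadditive.comp_add, reassoc_of% h1, reassoc_of% h2, zero_comp, add_zero]
  · have := congrArg (inr ≫ ·) (key c).choose_spec
    rw [← Category.assoc, hinr] at this
    rw [this, Preadditive.comp_add, reassoc_of% h3, reassoc_of% h4, zero_comp, zero_add]
  · rw [← cancel_epi (fst ≫ b + snd ≫ f'), (key c).choose_spec]
    simp [hm, hm']

/-- Pushouts of short exact sequences of Ind objects. -/
theorem exists_pushout_lexExact (hE : E.IsExact) (hP : E.IsExtensionClosed P)
    (hκ : Cardinal.aleph0 ≤ κ) {F G H F' : LexCat.{w} E} {f : F ⟶ G} {g : G ⟶ H}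
    (h : LexExact f g) (hF : isRelInd E P κ F) (hH : isRelInd E P κ H) (φ : F ⟶ F')
    (hF' : isRelInd E P κ F') :
    ∃ (G' : LexCat.{w} E) (b : G ⟶ G') (f' : F' ⟶ G') (g' : G' ⟶ H), LexExact f' g' ∧
      f ≫ b = φ ≫ f' ∧ b ≫ g' = g := by
  obtain ⟨⟨c⟩, -⟩ := isRelInd_of_lexExact hE hP hκ h hF hH
  obtain ⟨J, _, _, _, X', x', hJ, hX', hx'⟩ := (isRelInd_iff hE hP).1 hF'
  -- A pair `(k, j)` is admitted when `c.X.obj k ⟶ F ⟶ F'` factors through stage `j` of `F'`. Such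
  -- pairs are cofinal in both coordinates by `IsPres.cover_ge`, and the required sequence is the
  -- union of the termwise pushouts.
  let K : Type w := { k : c.K × J // ∃ n : c.X.obj k.1 ⟶ X'.obj k.2,
    (lexYoneda.{w} E).map n ≫ x' k.2 = c.x k.1 ≫ φ }
  have hα : Monotone (fun k : K => k.1.1) := fun k l h => h.1
  have hβ : Monotone (fun k : K => k.1.2) := fun k l h => h.2
  have hK (k : c.K) (j : J) : ∃ l : K, k ≤ l.1.1 ∧ j ≤ l.1.2 := by
    obtain ⟨j', m, hj, hm⟩ := hx'.cover_ge j (c.x k ≫ φ)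
    exact ⟨⟨(k, j'), m, hm⟩, le_rfl, hj⟩
  have hdir : IsDirectedOrder K := ⟨fun k l => by
    obtain ⟨k', h1, h2⟩ := exists_ge_ge k.1.1 l.1.1
    obtain ⟨j', h3, h4⟩ := exists_ge_ge k.1.2 l.1.2
    obtain ⟨r, hr, hr'⟩ := hK k' j'
    exact ⟨r, ⟨h1.trans hr, h3.trans hr'⟩, ⟨h2.trans hr, h4.trans hr'⟩⟩⟩
  obtain ⟨k₀⟩ := c.nonempty
  obtain ⟨j₀⟩ := ‹Nonempty J›
  have hne : Nonempty K := ⟨(hK k₀ j₀).choose⟩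
  have hα' (k : c.K) : ∃ l : K, k ≤ l.1.1 := (hK k j₀).imp fun _ h => h.1
  have hβ' (j : J) : ∃ l : K, j ≤ l.1.2 := (hK k₀ j).imp fun _ h => h.2
  have hcard : Cardinal.mk K ≤ κ := (Cardinal.mk_subtype_le _).trans (by
    rw [Cardinal.mk_prod, Cardinal.lift_id, Cardinal.lift_id]
    exact (mul_le_mul' c.card_le hJ).trans (Cardinal.mul_eq_self hκ).le)
  choose n hn using fun k : K => k.2
  choose W b i p hpush hconf hbp using fun k : K => hE.exists_pushout_conf (c.conf k.1.1) (n k)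
  have hnat {k l : K} (hkl : k ≤ l) : c.X.map (homOfLE (hα hkl)) ≫ n l =
      n k ≫ X'.map (homOfLE (hβ hkl)) := hx'.eq (by
    rw [Functor.map_comp_assoc, hn, Functor.map_comp_assoc, hx'.nat, hn, ← Category.assoc,
      c.presX.nat])
  have hw {k l : K} (hkl : k ≤ l) : c.u.app k.1.1 ≫ c.Y.map (homOfLE (hα hkl)) ≫ b l =
      n k ≫ X'.map (homOfLE (hβ hkl)) ≫ i l := by
    rw [← c.u.naturality_assoc, (hpush l).w, reassoc_of% hnat hkl]
  have Ymap {k l r : K} (h1 : k ≤ l) (h2 : l ≤ r) : c.Y.map (homOfLE (hα h1)) ≫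
      c.Y.map (homOfLE (hα h2)) = c.Y.map (homOfLE (hα (h1.trans h2))) := by
    rw [← Functor.map_comp]; rfl
  have Xmap {k l r : K} (h1 : k ≤ l) (h2 : l ≤ r) : X'.map (homOfLE (hβ h1)) ≫
      X'.map (homOfLE (hβ h2)) = X'.map (homOfLE (hβ (h1.trans h2))) := by
    rw [← Functor.map_comp]; rfl
  let WK : K ⥤ D :=
    { obj := W
      map := fun {k l} hkl => (hpush k).desc (c.Y.map (homOfLE (hα (leOfHom hkl))) ≫ b l)
        (X'.map (homOfLE (hβ (leOfHom hkl))) ≫ i l) (hw (leOfHom hkl))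
      map_id := fun k => (hpush k).hom_ext
        (by rw [IsPushout.inl_desc, show homOfLE _ = 𝟙 k.1.1 from rfl]; simp)
        (by rw [IsPushout.inr_desc, show homOfLE _ = 𝟙 k.1.2 from rfl]; simp)
      map_comp := fun {k l r} h1 h2 => (hpush k).hom_ext
        (by simp only [IsPushout.inl_desc, IsPushout.inl_desc_assoc, Category.assoc]
            rw [reassoc_of% Ymap (leOfHom h1) (leOfHom h2)])
        (by simp only [IsPushout.inr_desc, IsPushout.inr_desc_assoc, Category.assoc]
            rw [reassoc_of% Xmap (leOfHom h1) (leOfHom h2)]) }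
  have bW {k l : K} (hkl : k ≤ l) : b k ≫ WK.map (homOfLE hkl) =
      c.Y.map (homOfLE (hα hkl)) ≫ b l := (hpush k).inl_desc _ _ _
  have iW {k l : K} (hkl : k ≤ l) : i k ≫ WK.map (homOfLE hkl) =
      X'.map (homOfLE (hβ hkl)) ≫ i l := (hpush k).inr_desc _ _ _
  have pW {k l : K} (hkl : k ≤ l) : WK.map (homOfLE hkl) ≫ p l =
      p k ≫ c.Z.map (homOfLE (hα hkl)) := (hpush k).hom_ext
    (by rw [reassoc_of% bW hkl, hbp, reassoc_of% hbp k, c.v.naturality])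
    (by rw [reassoc_of% iW hkl, (hconf l).pair.w, comp_zero, reassoc_of% (hconf k).pair.w,
      zero_comp])
  have hWK : IsRelIndDiagram E P WK := by
    intro k l hkl
    obtain ⟨A, a, ha, hA⟩ := hX'.map P hE hP (hβ hkl.le)
    obtain ⟨C, d, hd, hC⟩ := c.diagZ.map P hE hP (hα hkl.le)
    obtain ⟨B, b', j, q, h1, h2, -⟩ := hE.conf_mid (hconf k) (hconf l) ha hd (iW hkl.le)
      (pW hkl.le).symm
    exact ⟨B, b', h1, hP.extension _ _ h2 hA hC⟩
  obtain ⟨G', y', hy'⟩ := exists_isPres.{w} hE hP hWK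
  have y_nat {k l : K} (hkl : k ≤ l) {A A' : D} {s : A ⟶ WK.obj k} {t : A ⟶ A'}
      {r : A' ⟶ WK.obj l} (hr : s ≫ WK.map (homOfLE hkl) = t ≫ r) :
      (lexYoneda.{w} E).map s ≫ y' k =
        (lexYoneda.{w} E).map t ≫ (lexYoneda.{w} E).map r ≫ y' l := by
    rw [← Functor.map_comp_assoc, ← hr, Functor.map_comp_assoc, hy'.nat]
  have px := c.presX.restrict hα hα'
  have py := c.presY.restrict hα hα'
  have pz := c.presZ.restrict hα hα'
  have px' := hx'.restrict hβ hβ'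
  obtain ⟨β, hβ₁⟩ := py.exists_desc hE (fun k => (lexYoneda.{w} E).map (b k) ≫ y' k) (fun k l hkl =>
    (y_nat hkl (bW hkl)).symm)
  obtain ⟨f', hf'⟩ := px'.exists_desc hE (fun k => (lexYoneda.{w} E).map (i k) ≫ y' k) (fun k l hkl =>
    (y_nat hkl (iW hkl)).symm)
  obtain ⟨g', hg'⟩ := hy'.exists_desc hE (fun k => (lexYoneda.{w} E).map (p k) ≫ c.z k.1.1) (fun k l hkl => by
    rw [← Functor.map_comp_assoc, pW hkl, Functor.map_comp_assoc, c.presZ.nat])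
  let y₁ (k : K) : (lexYoneda.{w} E).obj (W k) ⟶ G' := y' k
  have e₁ (k : K) : c.y k.1.1 ≫ β = (lexYoneda.{w} E).map (b k) ≫ y₁ k := hβ₁ k
  have e₂ (k : K) : x' k.1.2 ≫ f' = (lexYoneda.{w} E).map (i k) ≫ y₁ k := hf' k
  have e₃ (k : K) : y₁ k ≫ g' = (lexYoneda.{w} E).map (p k) ≫ c.z k.1.1 := hg' k
  refine ⟨G', β, f', g', LexExact.of_isPres hE px' hy' pz i p hconf (fun k => (e₂ k).symm) e₃,
    px.hom_ext hE fun k => ?_, py.hom_ext hE fun k => ?_⟩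
  · change c.x k.1.1 ≫ f ≫ β = c.x k.1.1 ≫ φ ≫ f'
    rw [← Category.assoc, ← c.map_u, Category.assoc, e₁, ← Functor.map_comp_assoc, (hpush k).w,
      Functor.map_comp_assoc, ← e₂, ← Category.assoc, hn, Category.assoc]
  · change c.y k.1.1 ≫ β ≫ g' = c.y k.1.1 ≫ g
    rw [← Category.assoc, e₁, Category.assoc, e₃, ← Functor.map_comp_assoc, hbp, c.map_v]

end

end RelTate

end

noncomputable section

namespace RelTate

/-! ### The exact category of relative admissible Ind objects -/

section

variable {D : Type u} [Category.{v} D] [Preadditive D] {E : ConflationClass D}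
  {P : ObjectProperty D} {κ : Cardinal.{w}}

theorem LexExact.of_eq_id (hE : E.IsExact) {F O : LexCat.{w} E} (hO : IsZero O) :
    LexExact (𝟙 F) (0 : F ⟶ O) where
  w := comp_zero
  eq_zero A s hs := by simpa using hs
  exists_lift A s hs := ⟨s, by simp⟩
  locEpi A s := ⟨A, 𝟙 A, 0, hE.deflation_id A, by rw [hO.eq_of_tgt s 0]; simp⟩

theorem LexExact.of_zero_id (hE : E.IsExact) {F O : LexCat.{w} E} (hO : IsZero O) :
    LexExact (0 : O ⟶ F) (𝟙 F) where
  w := zero_comp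
  eq_zero A s hs := hO.eq_of_tgt s 0
  exists_lift A s hs := ⟨0, by simpa using hs.symm⟩
  locEpi A s := ⟨A, 𝟙 A, s, hE.deflation_id A, by simp⟩

/-- A section of `W` is lifted to `Z` in two local steps: its image in `B` lifts through `q`, and
the remaining error lies in `V` and lifts through `p`. -/
theorem LexExact.comp_left (hE : E.IsExact) {X Y Z V B W : LexCat.{w} E} {f : X ⟶ Y} {p : Y ⟶ V}
    {g : Y ⟶ Z} {q : Z ⟶ B} {a : V ⟶ W} {b : W ⟶ B} {r : Z ⟶ W} (hf : LexExact f p)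
    (hg : LexExact g q) (hab : LexExact a b) (hr : g ≫ r = p ≫ a) (hb : r ≫ b = q) :
    LexExact (f ≫ g) r where
  w := by rw [Category.assoc, hr, reassoc_of% hf.w, zero_comp]
  eq_zero A s hs := hf.eq_zero s (hg.eq_zero _ (by simpa using hs))
  exists_lift A s hs := by
    have := hab.mono hE
    obtain ⟨t, rfl⟩ := hg.exists_lift s (by rw [← hb, reassoc_of% hs, zero_comp])
    obtain ⟨l, rfl⟩ := hf.exists_lift t (by
      rw [← cancel_mono a, Category.assoc, ← hr, zero_comp, ← Category.assoc, hs])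
    exact ⟨l, by simp⟩
  locEpi A s := by
    obtain ⟨C, c, z, hc, hz⟩ := hg.locEpi (s ≫ b)
    obtain ⟨v, hv⟩ := hab.exists_lift (z ≫ r - (lexYoneda.{w} E).map c ≫ s) (by simp [hb, hz])
    obtain ⟨C', c', d, hc', hd⟩ := hf.locEpi v
    refine ⟨C', c' ≫ c, (lexYoneda.{w} E).map c' ≫ z - d ≫ g, hE.deflation_comp _ _ hc' hc, ?_⟩
    rw [Preadditive.sub_comp, Category.assoc, Category.assoc, hr, reassoc_of% hd, hv]
    simp

theorem LexExact.exists_comp_right (hE : E.IsExact) {X Y Z K M : LexCat.{w} E} {p : X ⟶ Y}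
    {k : K ⟶ X} {q : Y ⟶ Z} {m : M ⟶ Y} (hp : LexExact k p) (hq : LexExact m q) :
    ∃ (N : LexCat.{w} E) (n : N ⟶ X) (a : K ⟶ N) (b : N ⟶ M),
      LexExact n (p ≫ q) ∧ LexExact a b := by
  obtain ⟨N, n, hn, hn', hl⟩ := LexCat.exists_kernel hE (p ≫ q)
  have := hp.mono hE
  have := hq.mono hE
  obtain ⟨a, ha⟩ := LexCat.exists_factor hE n k (fun A s => hl _ (by simp [reassoc_of% hp.w]))
  obtain ⟨b, hb⟩ := LexCat.exists_factor hE m (n ≫ p)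
    (fun A s => hq.exists_lift _ (by simp [hn']))
  refine ⟨N, n, a, b, ⟨hn', fun A s hs => by rw [← cancel_mono n, hs, zero_comp], hl,
    fun A s => ?_⟩, ⟨?_, fun A s hs => ?_, fun A s hs => ?_, fun A s => ?_⟩⟩
  · obtain ⟨B, c, t, hc, ht⟩ := hq.locEpi s
    obtain ⟨B', c', t', hc', ht'⟩ := hp.locEpi t
    exact ⟨B', c' ≫ c, t', hE.deflation_comp _ _ hc' hc, by
      rw [reassoc_of% ht', ht, Functor.map_comp_assoc]⟩
  · rw [← cancel_mono m, Category.assoc, hb, reassoc_of% ha, hp.w, zero_comp]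
  · rw [← cancel_mono k, ← ha, reassoc_of% hs, zero_comp, zero_comp]
  · obtain ⟨t, ht⟩ := hp.exists_lift (s ≫ n) (by
      rw [Category.assoc, ← hb, reassoc_of% hs, zero_comp])
    exact ⟨t, by rw [← cancel_mono n, Category.assoc, ha, ht]⟩
  · obtain ⟨B, c, t, hc, ht⟩ := hp.locEpi (s ≫ m)
    obtain ⟨t', ht'⟩ := hl t (by rw [reassoc_of% ht, hq.w, comp_zero, comp_zero])
    exact ⟨B, c, t', hc, by rw [← cancel_mono m, Category.assoc, hb, reassoc_of% ht', ht]; simp⟩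

theorem LexExact.pullback {X Y Z Y' Z' : LexCat.{w} E} {i : X ⟶ Y} {p : Y ⟶ Z}
    (h : LexExact i p) {f : Z' ⟶ Z} {f' : Y' ⟶ Y} {p' : Y' ⟶ Z'} (hp : IsPullback f' p' p f) :
    LexExact (hp.lift i 0 (by rw [h.w, zero_comp])) p' where
  w := hp.lift_snd _ _ _
  eq_zero A s hs := h.eq_zero s (by
    have := congrArg (· ≫ f') hs
    simpa using this)
  exists_lift A s hs := by
    obtain ⟨t, ht⟩ := h.exists_lift (s ≫ f') (by
      rw [Category.assoc, hp.w, reassoc_of% hs, zero_comp])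
    exact ⟨t, hp.hom_ext (by simp [ht]) (by simp [hs])⟩
  locEpi A s := by
    obtain ⟨B, c, t, hc, ht⟩ := h.locEpi (s ≫ f)
    exact ⟨B, c, hp.lift t ((lexYoneda.{w} E).map c ≫ s) (by simpa using ht), hc, by simp⟩

theorem isZero_lexYoneda {O : D} (hO : IsZero O) :
    IsZero ((lexYoneda.{w} E).obj O) := (lexYoneda.{w} E).map_isZero hO

theorem relIndClass_conf_iff (hE : E.IsExact) {X Y Z : RelInd E P κ} {f : X ⟶ Y} {g : Y ⟶ Z} :
    (relIndClass E P κ).Conf f g ↔ LexExact f.hom g.hom :=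
  (LexExact.iff_pair hE).symm

variable (hE : E.IsExact) (hP : E.IsExtensionClosed P) (hκ : Cardinal.aleph0 ≤ κ)

include hE hP hκ in
-- Kernels and pullbacks are formed in Lex(D), pushouts from presentations by
-- `exists_pushout_lexExact`. In each case the new object is an extension of Ind objects, hence an
-- Ind object.
theorem relIndClass_isExact : (relIndClass E P κ).IsExact where
  hasZeroObject := by
    obtain ⟨O, hO⟩ := hE.hasZeroObject
    refine ⟨(toRelInd E P hκ).obj O, ?_⟩
    rw [IsZero.iff_id_eq_zero]
    exact ObjectProperty.hom_ext _ ((isZero_lexYoneda hO).eq_of_src _ _)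
  hasBinaryBiproducts := by
    refine ⟨fun X Y => ?_⟩
    obtain ⟨Q, fst, snd, inl, inr, h1, h2, h3, h4, h5⟩ := LexCat.exists_prod X.obj Y.obj
    have hQ : isRelInd E P κ Q := by
      refine (isRelInd_of_lexExact hE hP hκ (f := inl) (g := snd) ⟨h2, fun A s hs => ?_,
        fun A s hs => ⟨s ≫ fst, ?_⟩, fun A s => ⟨A, 𝟙 A, s ≫ inr, hE.deflation_id A, ?_⟩⟩
        X.property Y.property).2
      · have := congrArg (· ≫ fst) hs
        simpa [h1] using this
      · have := congrArg (s ≫ ·) h5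
        simpa [reassoc_of% hs] using this
      · simp [h4]
    refine hasBinaryBiproduct_of_total
      { pt := ⟨Q, hQ⟩
        fst := ObjectProperty.homMk fst
        snd := ObjectProperty.homMk snd
        inl := ObjectProperty.homMk inl
        inr := ObjectProperty.homMk inr
        inl_fst := ObjectProperty.hom_ext _ h1
        inl_snd := ObjectProperty.hom_ext _ h2
        inr_fst := ObjectProperty.hom_ext _ h3
        inr_snd := ObjectProperty.hom_ext _ h4 } (ObjectProperty.hom_ext _ h5)
  conf_of_iso a b c h₁ h₂ h := by
    let ι := (isRelInd E P κ).ι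
    exact IsKernelCokernelPair.of_iso (ι.mapIso a) (ι.mapIso b) (ι.mapIso c)
      (congrArg ι.map h₁) (congrArg ι.map h₂) h
  inflation_id X := by
    obtain ⟨O, hO⟩ := hE.hasZeroObject
    exact ⟨(toRelInd E P hκ).obj O, 0, (LexExact.of_eq_id hE (isZero_lexYoneda hO)).pair hE⟩
  deflation_id X := by
    obtain ⟨O, hO⟩ := hE.hasZeroObject
    exact ⟨(toRelInd E P hκ).obj O, 0, (LexExact.of_zero_id hE (isZero_lexYoneda hO)).pair hE⟩
  inflation_comp := by
    rintro X Y Z f g ⟨V, p, hf⟩ ⟨B, q, hg⟩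
    rw [relIndClass_conf_iff hE] at hf hg
    -- The cokernel of `f ≫ g` is the pushout of `g` along `Y ⟶ Y / X`.
    obtain ⟨W, r, a, b, h1, h2, h3⟩ := exists_pushout_lexExact hE hP hκ hg Y.property B.property
      p.hom V.property
    have hW := (isRelInd_of_lexExact hE hP hκ h1 V.property B.property).2
    refine ⟨⟨W, hW⟩, ObjectProperty.homMk r, ?_⟩
    rw [relIndClass_conf_iff hE]
    exact LexExact.comp_left hE hf hg h1 h2 h3
  deflation_comp := by
    rintro X Y Z p q ⟨K, k, hp⟩ ⟨M, m, hq⟩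
    rw [relIndClass_conf_iff hE] at hp hq
    obtain ⟨N, n, a, b, h1, h2⟩ := LexExact.exists_comp_right hE hp hq
    have hN := (isRelInd_of_lexExact hE hP hκ h2 K.property M.property).2
    refine ⟨⟨N, hN⟩, ObjectProperty.homMk n, ?_⟩
    rw [relIndClass_conf_iff hE]
    exact h1
  exists_pushout := by
    rintro X Y X' i φ ⟨Z, p, hi⟩
    rw [relIndClass_conf_iff hE] at hi
    obtain ⟨Y', b, i', p', h1, h2, h3⟩ := exists_pushout_lexExact hE hP hκ hi X.property Z.property
      φ.hom X'.property
    have hY' := (isRelInd_of_lexExact hE hP hκ h1 X'.property Z.property).2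
    refine ⟨⟨Y', hY'⟩, ObjectProperty.homMk b, ObjectProperty.homMk i', ?_, Z,
      ObjectProperty.homMk p', h1.pair hE⟩
    exact IsPushout.of_map (isRelInd E P κ).ι (ObjectProperty.hom_ext _ h2)
      (hi.isPushout hE h1 h2 h3)
  exists_pullback := by
    rintro Y Z Z' p f ⟨X, i, hp⟩
    rw [relIndClass_conf_iff hE] at hp
    obtain ⟨Y', f', p', h⟩ := LexCat.exists_isPullback hE p.hom f.hom
    have h' := hp.pullback h
    have hY' := (isRelInd_of_lexExact hE hP hκ h' X.property Z'.property).2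
    refine ⟨⟨Y', hY'⟩, ObjectProperty.homMk f', ObjectProperty.homMk p', ?_, X,
      ObjectProperty.homMk (h.lift i.hom 0 (by rw [hp.w, zero_comp])), h'.pair hE⟩
    exact IsPullback.of_map (isRelInd E P κ).ι (ObjectProperty.hom_ext _ h.w) h

instance : (toRelInd E P hκ).Full := by
  unfold toRelInd; infer_instance

instance : (toRelInd E P hκ).Faithful := by
  unfold toRelInd; infer_instance

instance : (toRelInd E P hκ).Additive where
  map_add := ObjectProperty.hom_ext _ ((lexYoneda.{w} E).map_add)

include hE in
theorem toRelInd_exact : IsExactFunctor E (relIndClass E P κ) (toRelInd E P hκ) :=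
  fun _ _ _ _ _ h => (lexExact_map hE h).pair hE

theorem essImage_toRelInd_iff {X : RelInd E P κ} :
    (toRelInd E P hκ).essImage X ↔ ∃ A, Nonempty ((lexYoneda.{w} E).obj A ≅ X.obj) := by
  constructor
  · rintro ⟨A, ⟨e⟩⟩
    exact ⟨A, ⟨(isRelInd E P κ).ι.mapIso e⟩⟩
  · rintro ⟨A, ⟨e⟩⟩
    exact ⟨A, ⟨(isRelInd E P κ).ι.preimageIso (X := (toRelInd E P hκ).obj A) e⟩⟩

namespace ConfPres

variable {F G H : LexCat.{w} E} {f : F ⟶ G} {g : G ⟶ H} (c : ConfPres P κ f g)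

include hE in
-- When stage `k` of the middle is all of `G`, a section of `F` is a map into that stage killed in
-- `Z k`, so it comes from `X k`; and a section of `H` lifts locally to `G`, hence comes locally
-- from `Z k`.
theorem isIso_of_isIso_mid (hfg : LexExact f g) {k : c.K} (hk : IsIso (c.y k)) :
    IsIso (c.x k) ∧ IsIso (c.z k) := by
  have hx : Mono (c.x k) := LexCat.mono_of_sections hE fun A s hs => by
    obtain ⟨m, rfl⟩ := (lexYoneda.{w} E).map_surjective s
    rw [c.presX.eq_zero k m hs, Functor.map_zero]
  have hz : Mono (c.z k) := LexCat.mono_of_sections hE fun A s hs => by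
    obtain ⟨m, rfl⟩ := (lexYoneda.{w} E).map_surjective s
    rw [c.presZ.eq_zero k m hs, Functor.map_zero]
  constructor
  · refine LexCat.isIso_of_mono_locEpi hE _ fun A s => ⟨A, 𝟙 A, ?_⟩
    have h1 : (s ≫ f ≫ inv (c.y k)) ≫ (lexYoneda.{w} E).map (c.v.app k) = 0 := by
      rw [← cancel_mono (c.z k), Category.assoc, ← c.map_v]
      simp [hfg.w]
    obtain ⟨m, hm⟩ := (lexYoneda.{w} E).map_surjective (s ≫ f ≫ inv (c.y k))
    rw [← hm, ← Functor.map_comp, Functor.map_eq_zero_iff] at h1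
    obtain ⟨l, hl⟩ := (c.conf k).pair.exists_lift m h1
    have := hfg.mono hE
    refine ⟨(lexYoneda.{w} E).map l, hE.deflation_id A, ?_⟩
    rw [← cancel_mono f, Category.assoc, ← c.map_u, ← Functor.map_comp_assoc, hl, hm]
    simp
  · refine LexCat.isIso_of_mono_locEpi hE _ fun A s => ?_
    obtain ⟨B, p, t, hp, ht⟩ := hfg.locEpi s
    refine ⟨B, p, (t ≫ inv (c.y k)) ≫ (lexYoneda.{w} E).map (c.v.app k), hp, ?_⟩
    rw [Category.assoc, ← c.map_v]
    simp [ht]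

include hE in
theorem isIso_mid (hfg : LexExact f g) {k : c.K} (hx : IsIso (c.x k)) (hz : IsIso (c.z k)) :
    IsIso (c.y k) := by
  have hy : Mono (c.y k) := LexCat.mono_of_sections hE fun A s hs => by
    obtain ⟨m, rfl⟩ := (lexYoneda.{w} E).map_surjective s
    rw [c.presY.eq_zero k m hs, Functor.map_zero]
  refine LexCat.isIso_of_mono_locEpi hE _ fun A s => ?_
  obtain ⟨B, p, b, hp, hb⟩ := (lexExact_map hE (c.conf k)).locEpi (s ≫ g ≫ inv (c.z k))
  obtain ⟨t, ht⟩ := hfg.exists_lift ((lexYoneda.{w} E).map p ≫ s - b ≫ c.y k) (by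
    rw [Preadditive.sub_comp, Category.assoc b, c.map_v, reassoc_of% hb]
    simp)
  refine ⟨B, p, b + (t ≫ inv (c.x k)) ≫ (lexYoneda.{w} E).map (c.u.app k), hp, ?_⟩
  rw [Preadditive.add_comp, Category.assoc _ ((lexYoneda.{w} E).map _), c.map_u]
  simp [ht]

end ConfPres

include hE hP hκ in
/-- The essential image of `D` in `Ind(D, C)` is closed under admissible subobjects,
admissible quotients and extensions. -/
theorem essImage_toRelInd_conf {X Y Z : RelInd E P κ} {f : X ⟶ Y} {g : Y ⟶ Z}
    (h : (relIndClass E P κ).Conf f g) :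
    (toRelInd E P hκ).essImage Y ↔
      (toRelInd E P hκ).essImage X ∧ (toRelInd E P hκ).essImage Z := by
  rw [relIndClass_conf_iff hE] at h
  obtain ⟨c⟩ := (isRelInd_of_lexExact hE hP hκ h X.property Z.property).1
  simp only [essImage_toRelInd_iff]
  constructor
  · rintro ⟨A, ⟨e⟩⟩
    obtain ⟨k, hk⟩ := c.presY.exists_isIso e
    obtain ⟨h1, h2⟩ := c.isIso_of_isIso_mid hE h (hk k le_rfl)
    exact ⟨⟨_, ⟨asIso (c.x k)⟩⟩, ⟨_, ⟨asIso (c.z k)⟩⟩⟩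
  · rintro ⟨⟨A, ⟨e⟩⟩, ⟨B, ⟨e'⟩⟩⟩
    obtain ⟨k, hk⟩ := c.presX.exists_isIso e
    obtain ⟨l, hl⟩ := c.presZ.exists_isIso e'
    obtain ⟨m, hkm, hlm⟩ := exists_ge_ge k l
    have := c.isIso_mid hE h (hk m hkm) (hl m hlm)
    exact ⟨_, ⟨asIso (c.y m)⟩⟩

include hE hP in
/-- The inclusion of `D` in `Ind(D, C)` reflects conflations. -/
theorem conf_of_toRelInd {X Y Z : D} {f : X ⟶ Y} {g : Y ⟶ Z}
    (h : (relIndClass E P κ).Conf ((toRelInd E P hκ).map f) ((toRelInd E P hκ).map g)) :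
    E.Conf f g := by
  rw [relIndClass_conf_iff hE] at h
  obtain ⟨c⟩ := (isRelInd_of_lexExact hE hP hκ h ((toRelInd E P hκ).obj X).property
    ((toRelInd E P hκ).obj Z).property).1
  obtain ⟨k, hk⟩ := c.presY.exists_isIso (Iso.refl ((lexYoneda.{w} E).obj Y))
  have h2 : IsIso (c.y k) := hk k le_rfl
  obtain ⟨h1, h3⟩ := c.isIso_of_isIso_mid hE h (hk k le_rfl)
  refine hE.conf_of_iso ((lexYoneda.{w} E).preimageIso (@asIso _ _ _ _ (c.x k) h1))
    ((lexYoneda.{w} E).preimageIso (@asIso _ _ _ _ (c.y k) h2))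
    ((lexYoneda.{w} E).preimageIso (@asIso _ _ _ _ (c.z k) h3)) ?_ ?_ (c.conf k)
  · apply (lexYoneda.{w} E).map_injective
    simp only [Functor.map_comp, Functor.preimageIso_hom, Functor.map_preimage]
    exact c.map_u k
  · apply (lexYoneda.{w} E).map_injective
    simp only [Functor.map_comp, Functor.preimageIso_hom, Functor.map_preimage]
    exact (c.map_v k).symm

/-- A term of a presentation, as a subobject in `Ind(D, C)`. -/
def presHom {I : Type w} [PartialOrder I] {X : I ⥤ D} {F : RelInd E P κ}
    (x : ∀ i, (lexYoneda.{w} E).obj (X.obj i) ⟶ F.obj) (i : I) : (toRelInd E P hκ).obj (X.obj i) ⟶ F :=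
  ObjectProperty.homMk (x i)

include hE hP in
theorem inflation_presHom {I : Type w} [PartialOrder I] [IsDirectedOrder I]
    (hI : Cardinal.mk I ≤ κ) {X : I ⥤ D} (hX : IsRelIndDiagram E P X) {F : RelInd E P κ}
    {x : ∀ i, (lexYoneda.{w} E).obj (X.obj i) ⟶ F.obj} (hx : IsPres X F.obj x) (i : I) :
    (relIndClass E P κ).Inflation (presHom hκ x i) := by
  obtain ⟨Q, q, hQ, h⟩ := exists_quotient hE hP hI hX hx i
  exact ⟨⟨Q, hQ.isRelInd hE hP⟩, ObjectProperty.homMk q, h.pair hE⟩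

include hE hP in
-- Left filtering: a map from a representable factors through a stage, and stages are admissible
-- subobjects. Left special: straighten the conflation and take a stage at which `Z` has been
-- reached.
theorem toRelInd_isLeftSFiltering :
    IsLeftSFiltering E (relIndClass E P κ) (toRelInd E P hκ) where
  isExact_source := hE
  isExact_target := relIndClass_isExact hE hP hκ
  full := inferInstance
  faithful := inferInstance
  exact := toRelInd_exact hE hκ
  left_filtering A Y s := by
    obtain ⟨I, _, _, _, X, x, hI, hX, hx⟩ := (isRelInd_iff hE hP).1 Y.property
    obtain ⟨i, m, hm⟩ := hx.cover (s.hom : (lexYoneda.{w} E).obj A ⟶ Y.obj)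
    exact ⟨X.obj i, m, presHom hκ x i, inflation_presHom hE hP hκ hI hX hx i,
      ObjectProperty.hom_ext _ hm⟩
  left_special G Z p hp := by
    obtain ⟨F, k, hk⟩ := hp
    have h := (relIndClass_conf_iff hE).1 hk
    obtain ⟨c⟩ := (isRelInd_of_lexExact hE hP hκ h F.property
      ((toRelInd E P hκ).obj Z).property).1
    obtain ⟨i, hi⟩ := c.presZ.exists_isIso (Iso.refl ((lexYoneda.{w} E).obj Z))
    have hz : IsIso (c.z i) := hi i le_rfl
    let e : c.Z.obj i ≅ Z := (lexYoneda.{w} E).preimageIso (@asIso _ _ _ _ (c.z i) hz)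
    refine ⟨F, k, c.X.obj i, c.Y.obj i, c.u.app i, c.v.app i ≫ e.hom, presHom hκ c.x i,
      presHom hκ c.y i, hk, hE.conf_iso_right (c.conf i) e, ObjectProperty.hom_ext _ (c.map_u i),
      ObjectProperty.hom_ext _ ?_⟩
    change c.y i ≫ p.hom = (lexYoneda.{w} E).map (c.v.app i ≫ e.hom)
    rw [c.map_v, Functor.map_comp]
    simp only [e, Functor.preimageIso_hom, Functor.map_preimage]
    rfl

end

/-- A full subcategory, given by `A`, of an exact category which is closed under admissible
subobjects, admissible quotients and extensions, and such that every morphism from an object of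
`A` to a term of a conflation factors through a subconflation of objects of `A`. -/
structure IsFilteringSerre {U : Type u₁} [Category.{v₁} U] [Preadditive U]
    (EU : ConflationClass U) (A : ObjectProperty U) : Prop where
  iff_of_conf : ∀ ⦃X Y Z : U⦄ (f : X ⟶ Y) (g : Y ⟶ Z), EU.Conf f g → (A Y ↔ A X ∧ A Z)
  exists_isZero : ∃ O, IsZero O ∧ A O
  exists_subconf : ∀ ⦃X Y Z T T' : U⦄ (f : X ⟶ Y) (g : Y ⟶ Z) (t : T ⟶ Y) (t' : T' ⟶ Z),
    EU.Conf f g → A T → A T' →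
    ∃ (X₀ Y₀ Z₀ : U) (f₀ : X₀ ⟶ Y₀) (g₀ : Y₀ ⟶ Z₀) (i : X₀ ⟶ X) (j : Y₀ ⟶ Y) (k : Z₀ ⟶ Z)
      (s : T ⟶ Y₀) (s' : T' ⟶ Z₀), A X₀ ∧ A Y₀ ∧ A Z₀ ∧ EU.Conf f₀ g₀ ∧ EU.Inflation i ∧
      EU.Inflation j ∧ EU.Inflation k ∧ f₀ ≫ j = i ≫ f ∧ g₀ ≫ k = j ≫ g ∧ s ≫ j = t ∧ s' ≫ k = t'

section

variable {D : Type u} [Category.{v} D] [Preadditive D] {E : ConflationClass D}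
  {P : ObjectProperty D} {κ : Cardinal.{w}}

/-- One stage of a straightened conflation, far enough to absorb both given morphisms, is the
required subconflation. -/
theorem isFilteringSerre_toRelInd (hE : E.IsExact) (hP : E.IsExtensionClosed P)
    (hκ : Cardinal.aleph0 ≤ κ) :
    IsFilteringSerre (relIndClass E P κ) (toRelInd E P hκ).essImage where
  iff_of_conf _ _ _ _ _ h := essImage_toRelInd_conf hE hP hκ h
  exists_isZero := by
    obtain ⟨O, hO⟩ := hE.hasZeroObject
    exact ⟨_, (toRelInd E P hκ).map_isZero hO, (toRelInd E P hκ).obj_mem_essImage O⟩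
  exists_subconf := by
    rintro X Y Z T T' f g t t' h ⟨A, ⟨e⟩⟩ ⟨A', ⟨e'⟩⟩
    rw [relIndClass_conf_iff hE] at h
    obtain ⟨c⟩ := (isRelInd_of_lexExact hE hP hκ h X.property Z.property).1
    obtain ⟨k, m, hm⟩ := c.presY.cover ((e.hom ≫ t).hom : (lexYoneda.{w} E).obj A ⟶ Y.obj)
    obtain ⟨l, m', hl, hm'⟩ := c.presZ.cover_ge k ((e'.hom ≫ t').hom : (lexYoneda.{w} E).obj A' ⟶ Z.obj)
    let ι := toRelInd E P hκ
    refine ⟨ι.obj (c.X.obj l), ι.obj (c.Y.obj l), ι.obj (c.Z.obj l), ι.map (c.u.app l),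
      ι.map (c.v.app l), presHom hκ c.x l, presHom hκ c.y l, presHom hκ c.z l,
      e.inv ≫ ι.map (m ≫ c.Y.map (homOfLE hl)), e'.inv ≫ ι.map m', ι.obj_mem_essImage _,
      ι.obj_mem_essImage _, ι.obj_mem_essImage _, toRelInd_exact hE hκ _ _ (c.conf l),
      inflation_presHom hE hP hκ c.card_le c.diagX c.presX l,
      inflation_presHom hE hP hκ c.card_le c.diagY c.presY l,
      inflation_presHom hE hP hκ c.card_le c.diagZ c.presZ l,
      ObjectProperty.hom_ext _ (c.map_u l), ObjectProperty.hom_ext _ (c.map_v l).symm, ?_, ?_⟩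
    · rw [Category.assoc, Iso.inv_comp_eq]
      exact ObjectProperty.hom_ext _ (c.presY.factor_of_le hl m hm)
    · rw [Category.assoc, Iso.inv_comp_eq]
      exact ObjectProperty.hom_ext _ hm'

end

end RelTate

end

noncomputable section
namespace RelTate

/-! ### The quotient of an exact category by a filtering Serre subcategory -/

/-- Admissible epimorphisms whose kernel is in `A`. -/
def serreDeflation {U : Type u₁} [Category.{v₁} U] [Preadditive U] (EU : ConflationClass U)
    (A : ObjectProperty U) : MorphismProperty U :=
  fun X _ f => ∃ (K : U) (k : K ⟶ X), EU.Conf k f ∧ A K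

section

variable {U : Type u₁} [Category.{v₁} U] [Preadditive U] {EU : ConflationClass U}
  {A : ObjectProperty U}

theorem serreDeflation.epi {X Y : U} {f : X ⟶ Y} (hf : serreDeflation EU A f) : Epi f := by
  obtain ⟨K, k, h, -⟩ := hf
  exact h.pair.epi

theorem serreDeflation_le_weakIso : serreDeflation EU A ≤ weakIso EU A :=
  fun _ _ _ hf => MorphismProperty.le_multiplicativeClosure _ _ (Or.inr hf)

namespace IsFilteringSerre

variable (hU : EU.IsExact) (hA : IsFilteringSerre EU A)

include hA hU

theorem biprod [HasBinaryBiproducts U] {X Y : U} (hX : A X) (hY : A Y) : A (X ⊞ Y) :=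
  (hA.iff_of_conf _ _ (hU.conf_inl X Y)).2 ⟨hX, hY⟩

/-- Every morphism `t` from an object of `A` is killed by an admissible epimorphism with kernel
in `A`. -/
theorem exists_comp_eq_zero {T Y : U} (t : T ⟶ Y) (hT : A T) :
    ∃ (Q : U) (q : Y ⟶ Q), serreDeflation EU A q ∧ t ≫ q = 0 := by
  obtain ⟨O, hO, hAO⟩ := hA.exists_isZero
  obtain ⟨X₀, Y₀, Z₀, f₀, g₀, i, j, k, s, s', -, hY₀, -, -, -, ⟨Q, q, hj⟩, -, -, -, hs, -⟩ :=
    hA.exists_subconf _ _ t (0 : O ⟶ _) (hU.conf_zero_id Y hO) hT hAO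
  exact ⟨Q, q, ⟨_, _, hj, hY₀⟩, by rw [← hs, Category.assoc, hj.pair.w, comp_zero]⟩

theorem isMultiplicative : (serreDeflation EU A).IsMultiplicative where
  id_mem X := by
    obtain ⟨O, hO, hAO⟩ := hA.exists_isZero
    exact ⟨O, 0, hU.conf_zero_id X hO, hAO⟩
  comp_mem := by
    rintro X Y Z f g ⟨K, k, hk, hK⟩ ⟨M, m, hm, hM⟩
    obtain ⟨N, n, a, b, h1, h2, -⟩ := hU.conf_comp' hk hm
    exact ⟨N, n, h1, (hA.iff_of_conf _ _ h2).2 ⟨hK, hM⟩⟩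

/-- The restriction of a morphism to the kernel of the denominator is killed by some `q` of the
class, so the morphism followed by `q` descends along the denominator. Cancellation is automatic,
deflations being epimorphisms. -/
theorem hasLeftCalculusOfFractions : (serreDeflation EU A).HasLeftCalculusOfFractions where
  toIsMultiplicative := hA.isMultiplicative hU
  exists_leftFraction X Y φ := by
    obtain ⟨K, k, hk, hK⟩ := φ.hs
    obtain ⟨Q, q, hq, h⟩ := hA.exists_comp_eq_zero hU (k ≫ φ.f) hK
    obtain ⟨l, hl⟩ := hk.pair.exists_desc (φ.f ≫ q) (by rw [← Category.assoc, h])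
    exact ⟨⟨l, q, hq⟩, hl.symm⟩
  ext X' X Y f₁ f₂ s hs h := by
    have := hs.epi
    have := hA.isMultiplicative hU
    exact ⟨Y, 𝟙 Y, MorphismProperty.id_mem _ _, by rw [(cancel_epi s).1 h]⟩

/-- A quotient of a conflation by a subconflation of objects of `A` which contains given
morphisms from objects of `A`. -/
theorem exists_quotient_conf {X Y Z T T' : U} {f : X ⟶ Y} {g : Y ⟶ Z} (h : EU.Conf f g)
    (t : T ⟶ Y) (t' : T' ⟶ Z) (hT : A T) (hT' : A T') :
    ∃ (X₁ Y₁ Z₁ : U) (f₁ : X₁ ⟶ Y₁) (g₁ : Y₁ ⟶ Z₁) (a : X ⟶ X₁) (b : Y ⟶ Y₁) (c : Z ⟶ Z₁),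
      EU.Conf f₁ g₁ ∧ serreDeflation EU A a ∧ serreDeflation EU A b ∧ serreDeflation EU A c ∧
      f ≫ b = a ≫ f₁ ∧ g ≫ c = b ≫ g₁ ∧ t ≫ b = 0 ∧ t' ≫ c = 0 := by
  obtain ⟨X₀, Y₀, Z₀, f₀, g₀, i, j, k, s, s', hX₀, hY₀, hZ₀, h₀, ⟨X₁, a, hi⟩, -, ⟨Z₁, c, hk⟩,
    h1, h2, h3, h4⟩ := hA.exists_subconf f g t t' h hT hT'
  obtain ⟨Y₁, b, f₁, g₁, hb, h₁, h5, h6⟩ := hU.conf_mid h₀ h hi hk h1 h2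
  exact ⟨X₁, Y₁, Z₁, f₁, g₁, a, b, c, h₁, ⟨_, _, hi, hX₀⟩, ⟨_, _, hb, hY₀⟩, ⟨_, _, hk, hZ₀⟩,
    h5.symm, h6.symm, by rw [← h3, Category.assoc, hb.pair.w, comp_zero],
    by rw [← h4, Category.assoc, hk.pair.w, comp_zero]⟩

/-- Given morphisms of `serreDeflation EU A` out of the terms of a conflation, there is a
quotient of the conflation which refines them. -/
theorem exists_refinement {X Y Z X' Y' Z' : U} {f : X ⟶ Y} {g : Y ⟶ Z} (h : EU.Conf f g)
    {s : X ⟶ X'} {t : Y ⟶ Y'} {r : Z ⟶ Z'} (hs : serreDeflation EU A s)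
    (ht : serreDeflation EU A t) (hr : serreDeflation EU A r) :
    ∃ (X₁ Y₁ Z₁ : U) (f₁ : X₁ ⟶ Y₁) (g₁ : Y₁ ⟶ Z₁) (a : X ⟶ X₁) (b : Y ⟶ Y₁) (c : Z ⟶ Z₁)
      (a' : X' ⟶ X₁) (b' : Y' ⟶ Y₁) (c' : Z' ⟶ Z₁),
      EU.Conf f₁ g₁ ∧ serreDeflation EU A a ∧ serreDeflation EU A b ∧ serreDeflation EU A c ∧
      f ≫ b = a ≫ f₁ ∧ g ≫ c = b ≫ g₁ ∧ s ≫ a' = a ∧ t ≫ b' = b ∧ r ≫ c' = c := by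
  have := hU.hasBinaryBiproducts
  obtain ⟨K, k, hk, hK⟩ := hs
  obtain ⟨M, m, hm, hM⟩ := ht
  obtain ⟨N, n, hn, hN⟩ := hr
  -- The subconflation divided out must contain the kernels of `t` and `r` and, inside `Y`, the
  -- kernel of `s`; that the last one dies in `X₁` follows because `f₁` is a monomorphism.
  obtain ⟨X₁, Y₁, Z₁, f₁, g₁, a, b, c, h₁, ha, hb, hc, h2, h3, h4, h5⟩ :=
    hA.exists_quotient_conf hU h (biprod.desc (k ≫ f) m) n (hA.biprod hU hK hM) hN
  have := h₁.pair.mono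
  obtain ⟨a', ha'⟩ := hk.pair.exists_desc a (by
    rw [← cancel_mono f₁, Category.assoc, ← h2, zero_comp]
    simpa using congrArg (biprod.inl ≫ ·) h4)
  obtain ⟨b', hb'⟩ := hm.pair.exists_desc b (by simpa using congrArg (biprod.inr ≫ ·) h4)
  obtain ⟨c', hc'⟩ := hn.pair.exists_desc c h5
  exact ⟨X₁, Y₁, Z₁, f₁, g₁, a, b, c, a', b', c', h₁, ha, hb, hc, h2, h3, ha', hb', hc'⟩

/-- Functors inverting `serreDeflation EU A` invert all weak isomorphisms. -/
theorem weakIso_isInvertedBy {V : Type u₂} [Category.{v₂} V] (H : U ⥤ V)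
    (hH : (serreDeflation EU A).IsInvertedBy H) : (weakIso EU A).IsInvertedBy H := by
  rw [MorphismProperty.IsInvertedBy.iff_le_inverseImage_isomorphisms]
  refine (MorphismProperty.multiplicativeClosure_le_iff _ _).2 ?_
  rintro X Y f (⟨Z, g, h, hZ⟩ | hf)
  · obtain ⟨X₁, Y₁, Z₁, f₁, g₁, a, b, c, h₁, ha, hb, hc, h2, -, -, h5⟩ :=
      hA.exists_quotient_conf hU h (0 : Z ⟶ Y) (𝟙 Z) hZ hZ
    have := hc.epi
    have hZ₁ : IsZero Z₁ := by
      rw [Category.id_comp] at h5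
      rw [IsZero.iff_id_eq_zero, ← cancel_epi c, h5]
      simp
    have := ConflationClass.IsExact.isIso_of_conf_zero h₁ hZ₁
    have h6 : H.map f ≫ H.map b = H.map a ≫ H.map f₁ := by rw [← H.map_comp, h2, H.map_comp]
    have := hH a ha
    have := hH b hb
    have : IsIso (H.map f ≫ H.map b) := by rw [h6]; infer_instance
    exact IsIso.of_isIso_comp_right (H.map f) (H.map b)
  · exact hH f hf

/-- Both classes are inverted by the same functors, so they have the same localization; the smaller
one has a calculus of fractions. -/
theorem toQuot_isLocalization : (toQuot EU A).IsLocalization (serreDeflation EU A) := by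
  have hW : (serreDeflation EU A).IsInvertedBy (toQuot EU A) :=
    fun _ _ f hf => (weakIso EU A).Q_inverts f (serreDeflation_le_weakIso f hf)
  exact Functor.IsLocalization.mk' _ _
    { inverts := hW
      lift := fun F hF => Localization.Construction.lift F (hA.weakIso_isInvertedBy hU F hF)
      fac := fun F hF => Localization.Construction.fac F _
      uniq := Localization.Construction.uniq }
    { inverts := hW
      lift := fun F hF => Localization.Construction.lift F (hA.weakIso_isInvertedBy hU F hF)
      fac := fun F hF => Localization.Construction.fac F _
      uniq := Localization.Construction.uniq }

end IsFilteringSerre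

end

/-! #### Squares in preadditive categories -/

section

variable {D : Type u} [Category.{v} D] [Preadditive D]

/-- The biproduct is an arbitrary model `Q`, so that the image of a biproduct under an additive
functor can be used directly. -/
theorem isPushout_of_pair {X Y X' Y' Q : D} {i : X ⟶ Y} {f : X ⟶ X'} {f' : Y ⟶ Y'}
    {i' : X' ⟶ Y'} {inl : Y ⟶ Q} {inr : X' ⟶ Q} {fst : Q ⟶ Y} {snd : Q ⟶ X'}
    (h₁ : inl ≫ fst = 𝟙 Y) (h₂ : inl ≫ snd = 0) (h₃ : inr ≫ fst = 0) (h₄ : inr ≫ snd = 𝟙 X')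
    (h : IsKernelCokernelPair (i ≫ inl - f ≫ inr) (fst ≫ f' + snd ≫ i')) :
    IsPushout i f f' i' := by
  have hw : i ≫ f' = f ≫ i' := by
    have := h.w
    rw [Preadditive.sub_comp, sub_eq_zero] at this
    simpa [reassoc_of% h₁, reassoc_of% h₂, reassoc_of% h₃, reassoc_of% h₄] using this
  have := h.epi
  have key (T : D) (x : Y ⟶ T) (y : X' ⟶ T) (hxy : i ≫ x = f ≫ y) :
      ∃ l, f' ≫ l = x ∧ i' ≫ l = y := by
    obtain ⟨l, hl⟩ := h.exists_desc (fst ≫ x + snd ≫ y) (by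
      simp [reassoc_of% h₁, reassoc_of% h₂, reassoc_of% h₃, reassoc_of% h₄, hxy])
    refine ⟨l, ?_, ?_⟩
    · have := congrArg (inl ≫ ·) hl
      simpa [reassoc_of% h₁, reassoc_of% h₂] using this
    · have := congrArg (inr ≫ ·) hl
      simpa [reassoc_of% h₃, reassoc_of% h₄] using this
  refine ⟨⟨hw⟩, ⟨PushoutCocone.IsColimit.mk _ (fun s => (key _ _ _ s.condition).choose)
    (fun s => (key _ _ _ s.condition).choose_spec.1)
    (fun s => (key _ _ _ s.condition).choose_spec.2) fun s m h6 h7 => ?_⟩⟩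
  rw [← cancel_epi (fst ≫ f' + snd ≫ i'), Preadditive.add_comp, Preadditive.add_comp,
    Category.assoc, Category.assoc, Category.assoc, Category.assoc, h6, h7,
    (key _ _ _ s.condition).choose_spec.1, (key _ _ _ s.condition).choose_spec.2]

theorem isPullback_of_pair {Y Z Z' Y' Q : D} {p : Y ⟶ Z} {f : Z' ⟶ Z} {f' : Y' ⟶ Y}
    {p' : Y' ⟶ Z'} {inl : Y ⟶ Q} {inr : Z' ⟶ Q} {fst : Q ⟶ Y} {snd : Q ⟶ Z'}
    (h₁ : inl ≫ fst = 𝟙 Y) (h₂ : inl ≫ snd = 0) (h₃ : inr ≫ fst = 0) (h₄ : inr ≫ snd = 𝟙 Z')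
    (h : IsKernelCokernelPair (f' ≫ inl + p' ≫ inr) (fst ≫ p - snd ≫ f)) :
    IsPullback f' p' p f :=
  (isPushout_of_pair (i := p.op) (f := f.op) (f' := f'.op) (i' := p'.op) (inl := fst.op)
    (inr := snd.op) (fst := inl.op) (snd := inr.op) (congrArg Quiver.Hom.op h₁)
    (congrArg Quiver.Hom.op h₃) (congrArg Quiver.Hom.op h₂) (congrArg Quiver.Hom.op h₄) h.op).unop.flip

end

end RelTate
end

/-! ### Conflations, pushouts and pullbacks under the localization functor. -/

noncomputable section
namespace RelTate

section

variable {U : Type u₁} [Category.{v₁} U] [Preadditive U] {EU : ConflationClass U}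
  {A : ObjectProperty U}

variable (L : U ⥤ Quot EU A) [L.IsLocalization (serreDeflation EU A)]

theorem isIso_of_serreDeflation {X Y : U} {f : X ⟶ Y} (hf : serreDeflation EU A f) :
    IsIso (L.map f) :=
  Localization.inverts L (serreDeflation EU A) f hf

variable [(serreDeflation EU A).HasLeftCalculusOfFractions]

theorem exists_fraction {X Y : U} (φ : L.obj X ⟶ L.obj Y) :
    ∃ (Y' : U) (h : X ⟶ Y') (s : Y ⟶ Y'), serreDeflation EU A s ∧ φ ≫ L.map s = L.map h := by
  obtain ⟨ψ, rfl⟩ := Localization.exists_leftFraction L (serreDeflation EU A) φ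
  exact ⟨_, ψ.f, ψ.s, ψ.hs, ψ.map_comp_map_s _ _⟩

variable [Preadditive (Quot EU A)] [L.Additive]

theorem map_eq_zero_iff_exists {X Y : U} (f : X ⟶ Y) :
    L.map f = 0 ↔ ∃ (Y' : U) (s : Y ⟶ Y'), serreDeflation EU A s ∧ f ≫ s = 0 := by
  rw [← L.map_zero X Y, MorphismProperty.map_eq_iff_postcomp L (serreDeflation EU A)]
  simp

namespace IsFilteringSerre

variable (hU : EU.IsExact) (hA : IsFilteringSerre EU A)

include hA hU

/-- A morphism of the quotient into a term of the conflation is a fraction, and a morphism of `U`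
vanishes in the quotient when a member of the class kills it. By `exists_refinement`, such
denominators and killing maps are dominated by quotients of the whole conflation, which are
isomorphic to it after localization; there the kernel property in `U` applies. Morphisms out of the
conflation need no refinement, their denominators being at the other end. -/
theorem map_pair {X Y Z : U} {f : X ⟶ Y} {g : Y ⟶ Z} (h : EU.Conf f g) :
    IsKernelCokernelPair (L.map f) (L.map g) := by
  have := Localization.essSurj L (serreDeflation EU A)
  have hS := hA.isMultiplicative hU
  have hinv {X Y : U} {f : X ⟶ Y} (hf : serreDeflation EU A f) : IsIso (L.map f) :=
    isIso_of_serreDeflation L hf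
  refine IsKernelCokernelPair.of_exists (by rw [← L.map_comp, h.pair.w, L.map_zero]) ?_ ?_ ?_ ?_
  · refine Preadditive.mono_of_cancel_zero _ fun {W} φ hφ => ?_
    obtain ⟨X', m, s, hs, hm⟩ := exists_fraction L ((L.objObjPreimageIso W).hom ≫ φ)
    obtain ⟨X₁, Y₁, Z₁, f₁, g₁, a, b, c, a', b', c', h₁, ha, hb, hc, h2, h3, h4, h5, h6⟩ :=
      hA.exists_refinement hU h hs (hS.id_mem Y) (hS.id_mem Z)
    have := hinv ha
    have h7 : L.map (m ≫ a' ≫ f₁) = 0 := by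
      rw [L.map_comp, ← hm, Category.assoc, ← L.map_comp, reassoc_of% h4, ← h2, L.map_comp,
        Category.assoc, reassoc_of% hφ, zero_comp, comp_zero]
    -- Vanishing in the quotient becomes vanishing in `U` after `t`; a second refinement replaces
    -- `t` by the middle map of a morphism of conflations, so that the monomorphism `f₃` can be
    -- cancelled.
    obtain ⟨Y₂, t, ht, h8⟩ := (map_eq_zero_iff_exists L _).1 h7
    obtain ⟨X₃, Y₃, Z₃, f₃, g₃, a₃, b₃, c₃, a₄, b₄, c₄, h₃, ha₃, hb₃, hc₃, h9, h10, h11, h12, h13⟩ :=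
      hA.exists_refinement hU h₁ (hS.id_mem X₁) ht (hS.id_mem Z₁)
    have := h₃.pair.mono
    have h14 : m ≫ a' ≫ a₃ = 0 := by
      rw [← cancel_mono f₃]
      simp only [Category.assoc, ← h9, zero_comp, ← h12]
      simp only [Category.assoc] at h8
      rw [reassoc_of% h8, zero_comp]
    have := hinv ha₃
    have h15 : ((L.objObjPreimageIso W).hom ≫ φ) ≫ L.map a ≫ L.map a₃ = 0 := by
      rw [← h4, L.map_comp, Category.assoc (L.map s),
        ← Category.assoc ((L.objObjPreimageIso W).hom ≫ φ) (L.map s), hm, ← L.map_comp,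
        ← L.map_comp, h14, L.map_zero]
    rw [← cancel_mono (L.map a ≫ L.map a₃), ← cancel_epi (L.objObjPreimageIso W).hom]
    simpa using h15
  · refine Preadditive.epi_of_cancel_zero _ fun {W} φ hφ => ?_
    obtain ⟨W', m, s, hs, hm⟩ := exists_fraction L (φ ≫ (L.objObjPreimageIso W).inv)
    have h7 : L.map (g ≫ m) = 0 := by
      rw [L.map_comp, ← hm, Category.assoc, reassoc_of% hφ, zero_comp]
    obtain ⟨W₂, t, ht, h8⟩ := (map_eq_zero_iff_exists L _).1 h7
    have := h.pair.epi
    have h9 : m ≫ t = 0 := by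
      rw [← cancel_epi g, ← Category.assoc, h8, comp_zero]
    have := hinv hs
    have := (map_eq_zero_iff_exists L m).2 ⟨_, t, ht, h9⟩
    rw [← cancel_mono (L.objObjPreimageIso W).inv, ← cancel_mono (L.map s), hm, this]
    simp
  · intro W φ hφ
    obtain ⟨Y', m, s, hs, hm⟩ := exists_fraction L ((L.objObjPreimageIso W).hom ≫ φ)
    obtain ⟨X₁, Y₁, Z₁, f₁, g₁, a, b, c, a', b', c', h₁, ha, hb, hc, h2, h3, h4, h5, h6⟩ :=
      hA.exists_refinement hU h (hS.id_mem X) hs (hS.id_mem Z)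
    have h7 : L.map (m ≫ b' ≫ g₁) = 0 := by
      rw [L.map_comp, ← hm, Category.assoc, ← L.map_comp, reassoc_of% h5, ← h3, L.map_comp,
        Category.assoc, reassoc_of% hφ, zero_comp, comp_zero]
    obtain ⟨Z₂, t, ht, h8⟩ := (map_eq_zero_iff_exists L _).1 h7
    obtain ⟨X₃, Y₃, Z₃, f₃, g₃, a₃, b₃, c₃, a₄, b₄, c₄, h₃, ha₃, hb₃, hc₃, h9, h10, h11, h12, h13⟩ :=
      hA.exists_refinement hU h₁ (hS.id_mem X₁) (hS.id_mem Y₁) ht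
    obtain ⟨l, hl⟩ := h₃.pair.exists_lift (m ≫ b' ≫ b₃) (by
      simp only [Category.assoc, ← h10, ← h13]
      simp only [Category.assoc] at h8
      rw [reassoc_of% h8, zero_comp])
    have := hinv ha
    have := hinv ha₃
    have := hinv hb
    have := hinv hb₃
    obtain ⟨j, hj⟩ : ∃ j, j ≫ L.map a ≫ L.map a₃ = 𝟙 _ := ⟨inv (L.map a ≫ L.map a₃), by simp⟩
    refine ⟨(L.objObjPreimageIso W).inv ≫ L.map l ≫ j, ?_⟩
    have h14 : L.map f ≫ L.map b ≫ L.map b₃ = L.map a ≫ L.map a₃ ≫ L.map f₃ := by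
      rw [← L.map_comp_assoc, h2, L.map_comp, Category.assoc, ← L.map_comp, h9, L.map_comp]
    rw [← cancel_mono (L.map b ≫ L.map b₃)]
    simp only [Category.assoc, h14, reassoc_of% hj]
    rw [← cancel_epi (L.objObjPreimageIso W).hom, Iso.hom_inv_id_assoc, ← L.map_comp, hl, ← h5,
      L.map_comp s, L.map_comp m, ← hm, L.map_comp]
    simp
  · intro W φ hφ
    obtain ⟨W', m, s, hs, hm⟩ := exists_fraction L (φ ≫ (L.objObjPreimageIso W).inv)
    have h7 : L.map (f ≫ m) = 0 := by
      rw [L.map_comp, ← hm, Category.assoc, reassoc_of% hφ, zero_comp]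
    obtain ⟨W₂, t, ht, h8⟩ := (map_eq_zero_iff_exists L _).1 h7
    obtain ⟨l, hl⟩ := h.pair.exists_desc (m ≫ t) (by rw [← Category.assoc, h8])
    have := hinv hs
    have := hinv ht
    refine ⟨L.map l ≫ inv (L.map s ≫ L.map t) ≫ (L.objObjPreimageIso W).hom, ?_⟩
    rw [← cancel_mono (L.objObjPreimageIso W).inv, ← cancel_mono (L.map s ≫ L.map t)]
    simp only [Category.assoc, Iso.hom_inv_id_assoc, IsIso.inv_hom_id, Category.comp_id]
    rw [← L.map_comp, hl, L.map_comp, ← hm]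
    simp

/-- The conflation `X ⟶ Y ⊞ X' ⟶ Y'` encodes the square, and `map_pair` applies to it. -/
theorem map_isPushout {X Y X' Y' : U} {i : X ⟶ Y} {f : X ⟶ X'} {f' : Y ⟶ Y'} {i' : X' ⟶ Y'}
    (hi : EU.Inflation i) (h : IsPushout i f f' i') :
    IsPushout (L.map i) (L.map f) (L.map f') (L.map i') := by
  have := hU.hasBinaryBiproducts
  obtain ⟨Z, p, hp⟩ := hi
  have := hA.map_pair L hU (hU.conf_of_isPushout hp h (Q := Y ⊞ X') biprod.inl biprod.inr
    biprod.fst biprod.snd (by simp) (by simp) (by simp) (by simp) (by simp))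
  simp only [L.map_sub, L.map_add, L.map_comp] at this
  refine isPushout_of_pair ?_ ?_ ?_ ?_ this <;>
    simp only [← L.map_comp] <;> simp

theorem map_isPullback {Y Z Z' Y' : U} {p : Y ⟶ Z} {f : Z' ⟶ Z} {f' : Y' ⟶ Y} {p' : Y' ⟶ Z'}
    (hp : EU.Deflation p) (h : IsPullback f' p' p f) :
    IsPullback (L.map f') (L.map p') (L.map p) (L.map f) := by
  have := hU.hasBinaryBiproducts
  obtain ⟨X, i, hi⟩ := hp
  have := hA.map_pair L hU (hU.conf_of_isPullback hi h (Q := Y ⊞ Z') biprod.inl biprod.inr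
    biprod.fst biprod.snd (by simp) (by simp) (by simp) (by simp) (by simp))
  simp only [L.map_sub, L.map_add, L.map_comp] at this
  refine isPullback_of_pair ?_ ?_ ?_ ?_ this <;>
    simp only [← L.map_comp] <;> simp

end IsFilteringSerre

end

/-! ### The exact structure on the quotient. -/

section

variable {U : Type u₁} [Category.{v₁} U] [Preadditive U] {EU : ConflationClass U}
  {A : ObjectProperty U} [Preadditive (Quot EU A)]

omit [Preadditive (Quot EU A)] in
theorem quotConf.of_iso {X Y Z X' Y' Z' : Quot EU A} {f : X ⟶ Y} {g : Y ⟶ Z} {f' : X' ⟶ Y'}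
    {g' : Y' ⟶ Z'} (h : quotConf EU A f g) (a : X ≅ X') (b : Y ≅ Y') (c : Z ≅ Z')
    (h₁ : f ≫ b.hom = a.hom ≫ f') (h₂ : g ≫ c.hom = b.hom ≫ g') : quotConf EU A f' g' := by
  obtain ⟨X₁, Y₁, Z₁, f₁, g₁, a', b', c', h, h3, h4⟩ := h
  exact ⟨X₁, Y₁, Z₁, f₁, g₁, a' ≪≫ a, b' ≪≫ b, c' ≪≫ c, h, by simp [reassoc_of% h3, h₁],
    by simp [reassoc_of% h4, h₂]⟩

variable {E : ConflationClass (Quot EU A)} (hE : E.Conf = quotConf EU A)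

include hE

theorem inflation_quot_iff {X Y : Quot EU A} (f : X ⟶ Y) :
    E.Inflation f ↔ ∃ (X' Y' : U) (f' : X' ⟶ Y') (a : (toQuot EU A).obj X' ≅ X)
      (b : (toQuot EU A).obj Y' ≅ Y), EU.Inflation f' ∧
        (toQuot EU A).map f' ≫ b.hom = a.hom ≫ f := by
  constructor
  · rintro ⟨Z, g, h⟩
    rw [hE] at h
    obtain ⟨X', Y', Z', f', g', a, b, c, h, h1, h2⟩ := h
    exact ⟨X', Y', f', a, b, ⟨_, _, h⟩, h1⟩
  · rintro ⟨X', Y', f', a, b, ⟨Z', g', h⟩, h1⟩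
    refine ⟨(toQuot EU A).obj Z', b.inv ≫ (toQuot EU A).map g', ?_⟩
    rw [hE]
    exact ⟨X', Y', Z', f', g', a, b, Iso.refl _, h, h1, by simp⟩

theorem deflation_quot_iff {X Y : Quot EU A} (f : X ⟶ Y) :
    E.Deflation f ↔ ∃ (X' Y' : U) (f' : X' ⟶ Y') (a : (toQuot EU A).obj X' ≅ X)
      (b : (toQuot EU A).obj Y' ≅ Y), EU.Deflation f' ∧
        (toQuot EU A).map f' ≫ b.hom = a.hom ≫ f := by
  constructor
  · rintro ⟨Z, g, h⟩
    rw [hE] at h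
    obtain ⟨X', Y', Z', f', g', a, b, c, h, h1, h2⟩ := h
    exact ⟨Y', Z', g', b, c, ⟨_, _, h⟩, h2⟩
  · rintro ⟨Y', Z', f', a, b, ⟨X', g', h⟩, h1⟩
    refine ⟨(toQuot EU A).obj X', (toQuot EU A).map g' ≫ a.hom, ?_⟩
    rw [hE]
    exact ⟨X', Y', Z', g', f', Iso.refl _, a, b, h, by simp, h1⟩

variable [(toQuot EU A).Additive] [(toQuot EU A).IsLocalization (serreDeflation EU A)]
  [(serreDeflation EU A).HasLeftCalculusOfFractions]

namespace IsFilteringSerre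

variable (hU : EU.IsExact) (hA : IsFilteringSerre EU A)

include hU hA

/-- Representatives in `U` of the two inflations meet in `Y` only up to an isomorphism of the
quotient, i.e. a fraction. Its denominator is absorbed by refining the first conflation; the second
inflation is then pushed out along a map that becomes invertible, and the two compose in `U`. -/
theorem quot_inflation_comp {X Y Z : Quot EU A} (f : X ⟶ Y) (g : Y ⟶ Z) (hf : E.Inflation f)
    (hg : E.Inflation g) : E.Inflation (f ≫ g) := by
  have hS := hA.isMultiplicative hU
  let L := toQuot EU A
  obtain ⟨X₁, Y₁, f', a, b₁, ⟨Z₁, p, hp⟩, h1⟩ := (inflation_quot_iff hE f).1 hf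
  obtain ⟨Y₂, Z₂, g', b₂, c, hg', h2⟩ := (inflation_quot_iff hE g).1 hg
  obtain ⟨Y₃, m, s, hs, hm⟩ := exists_fraction L (b₂.hom ≫ b₁.inv)
  obtain ⟨X₄, Y₄, Z₄, f₄, g₄, a₄, b₄, c₄, a', b', c', h₄, ha₄, hb₄, hc₄, h3, -, -, h4, -⟩ :=
    hA.exists_refinement hU hp (hS.id_mem _) hs (hS.id_mem _)
  have h5 : L.map (m ≫ b') = b₂.hom ≫ b₁.inv ≫ L.map b₄ := by
    rw [L.map_comp, ← hm, ← h4, L.map_comp]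
    simp
  have := isIso_of_serreDeflation L ha₄
  have := isIso_of_serreDeflation L hb₄
  have : IsIso (L.map (m ≫ b')) := by rw [h5]; infer_instance
  obtain ⟨Z₃, m', g'', hpo, hg''⟩ := hU.exists_pushout g' (m ≫ b') hg'
  have hpo' := hA.map_isPushout L hU hg' hpo
  have : IsIso (L.map m') := hpo'.isIso_inl_of_isIso
  refine (inflation_quot_iff hE _).2 ⟨X₄, Z₃, f₄ ≫ g'', (asIso (L.map a₄)).symm ≪≫ a,
    (asIso (L.map m')).symm ≪≫ c, hU.inflation_comp _ _ ⟨_, _, h₄⟩ hg'', ?_⟩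
  have h6 : L.map b₄ ≫ L.map g'' = b₁.hom ≫ b₂.inv ≫ L.map g' ≫ L.map m' := by
    rw [hpo'.w, h5]
    simp
  change L.map (f₄ ≫ g'') ≫ inv (L.map m') ≫ c.hom = (inv (L.map a₄) ≫ a.hom) ≫ f ≫ g
  rw [← cancel_epi (L.map a₄)]
  simp only [Category.assoc, IsIso.hom_inv_id_assoc]
  rw [← L.map_comp_assoc, ← Category.assoc a₄, ← h3, Category.assoc, L.map_comp, L.map_comp,
    Category.assoc, h6, ← reassoc_of% h1]
  simp only [Category.assoc, IsIso.hom_inv_id_assoc]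
  change _ ≫ _ ≫ _ ≫ (toQuot EU A).map g' ≫ _ = _
  rw [h2]
  simp [L]

/-- Here the denominator `s` is itself a deflation and is composed with `f'`; the numerator is
handled by a pullback. -/
theorem quot_deflation_comp {X Y Z : Quot EU A} (f : X ⟶ Y) (g : Y ⟶ Z) (hf : E.Deflation f)
    (hg : E.Deflation g) : E.Deflation (f ≫ g) := by
  let L := toQuot EU A
  obtain ⟨X₁, Y₁, f', a, b₁, hf', h1⟩ := (deflation_quot_iff hE f).1 hf
  obtain ⟨Y₂, Z₂, g', b₂, c, hg', h2⟩ := (deflation_quot_iff hE g).1 hg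
  obtain ⟨Y₃, m, s, hs, hm⟩ := exists_fraction L (b₂.hom ≫ b₁.inv)
  have := isIso_of_serreDeflation L hs
  have : IsIso (L.map m) := by rw [← hm]; infer_instance
  have hfs : EU.Deflation (f' ≫ s) :=
    hU.deflation_comp _ _ hf' (by obtain ⟨K, k, hk, -⟩ := hs; exact ⟨K, k, hk⟩)
  obtain ⟨X₃, m', f'', hpb, hf''⟩ := hU.exists_pullback (f' ≫ s) m hfs
  have hpb' := hA.map_isPullback L hU hfs hpb
  have : IsIso (L.map m') := hpb'.isIso_fst_of_isIso
  refine (deflation_quot_iff hE _).2 ⟨X₃, Z₂, f'' ≫ g', asIso (L.map m') ≪≫ a, c,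
    hU.deflation_comp _ _ hf'' hg', ?_⟩
  change L.map (f'' ≫ g') ≫ c.hom = (L.map m' ≫ a.hom) ≫ f ≫ g
  have h3 : L.map f'' = L.map m' ≫ L.map f' ≫ b₁.hom ≫ b₂.inv := by
    have h4 := hpb'.w
    rw [← cancel_mono (L.map m), ← h4, ← hm, L.map_comp]
    simp
  rw [L.map_comp, Category.assoc, Category.assoc, ← reassoc_of% h1, h3]
  change _ ≫ (toQuot EU A).map g' ≫ _ = _
  rw [h2]
  simp [L]

theorem quot_exists_pushout {X Y X' : Quot EU A} (i : X ⟶ Y) (f : X ⟶ X') (hi : E.Inflation i) :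
    ∃ (Y' : Quot EU A) (f' : Y ⟶ Y') (i' : X' ⟶ Y'), IsPushout i f f' i' ∧ E.Inflation i' := by
  let L := toQuot EU A
  have := Localization.essSurj L (serreDeflation EU A)
  obtain ⟨X₁, Y₁, j, a, b, hj, h1⟩ := (inflation_quot_iff hE i).1 hi
  let e := L.objObjPreimageIso X'
  obtain ⟨X₃, m, s, hs, hm⟩ := exists_fraction L (a.hom ≫ f ≫ e.inv)
  have := isIso_of_serreDeflation L hs
  obtain ⟨Y₃, m', j', hpo, hj'⟩ := hU.exists_pushout j m hj
  have hpo' := hA.map_isPushout L hU hj hpo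
  let e' : L.obj X₃ ≅ X' := (asIso (L.map s)).symm ≪≫ e
  refine ⟨L.obj Y₃, b.inv ≫ L.map m', e'.inv ≫ L.map j', ?_, ?_⟩
  · refine hpo'.of_iso a b e' (Iso.refl _) h1 ?_ (by simp) (by simp)
    rw [← hm]
    simp [e']
  · exact (inflation_quot_iff hE _).2 ⟨_, _, j', e', Iso.refl _, hj', by simp [L]⟩

theorem quot_exists_pullback {Y Z Z' : Quot EU A} (p : Y ⟶ Z) (f : Z' ⟶ Z) (hp : E.Deflation p) :
    ∃ (Y' : Quot EU A) (f' : Y' ⟶ Y) (p' : Y' ⟶ Z'), IsPullback f' p' p f ∧ E.Deflation p' := by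
  let L := toQuot EU A
  have := Localization.essSurj L (serreDeflation EU A)
  obtain ⟨Y₁, Z₁, q, a, b, hq, h1⟩ := (deflation_quot_iff hE p).1 hp
  let e := L.objObjPreimageIso Z'
  obtain ⟨Z₃, m, s, hs, hm⟩ := exists_fraction L (e.hom ≫ f ≫ b.inv)
  have := isIso_of_serreDeflation L hs
  have hqs : EU.Deflation (q ≫ s) :=
    hU.deflation_comp _ _ hq (by obtain ⟨K, k, hk, -⟩ := hs; exact ⟨K, k, hk⟩)
  obtain ⟨Y₃, m', q', hpb, hq'⟩ := hU.exists_pullback (q ≫ s) m hqs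
  have hpb' := hA.map_isPullback L hU hqs hpb
  refine ⟨L.obj Y₃, L.map m' ≫ a.hom, L.map q' ≫ e.hom, ?_, ?_⟩
  · refine hpb'.of_iso (Iso.refl _) a e ((asIso (L.map s)).symm ≪≫ b) (by simp) (by simp) ?_ ?_
    · change L.map (q ≫ s) ≫ inv (L.map s) ≫ b.hom = _
      rw [← h1]
      simp [L]
    · rw [← hm]
      simp
  · exact (deflation_quot_iff hE _).2 ⟨_, _, q', Iso.refl _, e, hq', by simp [L]⟩

theorem quot_isExact : E.IsExact where
  hasZeroObject := by
    have := hU.hasZeroObject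
    exact (toQuot EU A).hasZeroObject_of_additive
  hasBinaryBiproducts := by
    have := hU.hasBinaryBiproducts
    let L := toQuot EU A
    have := Localization.essSurj L (serreDeflation EU A)
    refine ⟨fun X Y => ?_⟩
    let e := L.objObjPreimageIso X
    let e' := L.objObjPreimageIso Y
    refine hasBinaryBiproduct_of_total
      { pt := L.obj (L.objPreimage X ⊞ L.objPreimage Y)
        fst := L.map biprod.fst ≫ e.hom
        snd := L.map biprod.snd ≫ e'.hom
        inl := e.inv ≫ L.map biprod.inl
        inr := e'.inv ≫ L.map biprod.inr
        inl_fst := ?_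
        inl_snd := ?_
        inr_fst := ?_
        inr_snd := ?_ } ?_
    · simp [← L.map_comp_assoc]
    · simp [← L.map_comp_assoc]
    · simp [← L.map_comp_assoc]
    · simp [← L.map_comp_assoc]
    · simp only [Category.assoc, Iso.hom_inv_id_assoc, ← L.map_comp, ← L.map_add,
        biprod.total, L.map_id]
  conf_of_iso a b c h1 h2 h := by
    rw [hE] at h ⊢
    exact h.of_iso a b c h1 h2
  inflation_id X := by
    have := Localization.essSurj (toQuot EU A) (serreDeflation EU A)
    exact (inflation_quot_iff hE _).2 ⟨_, _, 𝟙 _, (toQuot EU A).objObjPreimageIso X,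
      (toQuot EU A).objObjPreimageIso X, hU.inflation_id _, by simp⟩
  deflation_id X := by
    have := Localization.essSurj (toQuot EU A) (serreDeflation EU A)
    exact (deflation_quot_iff hE _).2 ⟨_, _, 𝟙 _, (toQuot EU A).objObjPreimageIso X,
      (toQuot EU A).objObjPreimageIso X, hU.deflation_id _, by simp⟩
  inflation_comp := hA.quot_inflation_comp hE hU
  deflation_comp := hA.quot_deflation_comp hE hU
  exists_pushout := hA.quot_exists_pushout hE hU
  exists_pullback := hA.quot_exists_pullback hE hU

end IsFilteringSerre

end

theorem IsFilteringSerre.quotIsExact {U : Type u₁} [Category.{v₁} U] [Preadditive U]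
    {EU : ConflationClass U} {A : ObjectProperty U} (hU : EU.IsExact)
    (hA : IsFilteringSerre EU A) : QuotIsExact EU A := by
  have := hA.hasLeftCalculusOfFractions hU
  have := hA.toQuot_isLocalization hU
  let : Preadditive (Quot EU A) :=
    Localization.preadditive (toQuot EU A) (serreDeflation EU A)
  have : (toQuot EU A).Additive := Localization.functor_additive (toQuot EU A) (serreDeflation EU A)
  let E : ConflationClass (Quot EU A) :=
    { Conf := quotConf EU A
      isKernelCokernelPair := by
        rintro X Y Z f g ⟨X', Y', Z', f', g', a, b, c, h, h1, h2⟩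
        exact (hA.map_pair (toQuot EU A) hU h).of_iso a b c h1 h2 }
  exact ⟨inferInstance, E, inferInstance, rfl, hA.quot_isExact rfl hU⟩

end RelTate
end

/-! ### Transfers and the functor they induce on Ind objects. -/

noncomputable section
namespace RelTate

/-! ### Functoriality of relative Ind objects -/

section

variable {A : Type u₁} [Category.{v₁} A] [Preadditive A] {EA : ConflationClass A}
  {PA : ObjectProperty A} {B : Type u₂} [Category.{v₂} B] [Preadditive B]
  {EB : ConflationClass B} {PB : ObjectProperty B} {κ : Cardinal.{w}} {φ : A ⥤ B}

variable (EA PA EB PB φ) in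
/-- `φ` is a fully faithful functor of exact categories which preserves and reflects conflations,
and which identifies the subcategories given by `PA` and `PB`. -/
structure IsIndTransfer : Prop where
  isExact_source : EA.IsExact
  isExact_target : EB.IsExact
  extensionClosed_source : EA.IsExtensionClosed PA
  extensionClosed_target : EB.IsExtensionClosed PB
  full : φ.Full
  faithful : φ.Faithful
  conf_iff : ∀ ⦃X Y Z : A⦄ (f : X ⟶ Y) (g : Y ⟶ Z), EA.Conf f g ↔ EB.Conf (φ.map f) (φ.map g)
  map_prop : ∀ ⦃X : A⦄, PA X → PB (φ.obj X)
  exists_preimage : ∀ ⦃Y : B⦄, PB Y → ∃ X, PA X ∧ Nonempty (φ.obj X ≅ Y)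

theorem IsIndTransfer.map_diagram (h : IsIndTransfer EA PA EB PB φ) {I : Type w} [PartialOrder I]
    {X : I ⥤ A} (hX : IsRelIndDiagram EA PA X) : IsRelIndDiagram EB PB (X ⋙ φ) := by
  intro i j hij
  obtain ⟨Z, g, hg, hZ⟩ := hX hij
  exact ⟨_, φ.map g, (h.conf_iff _ _).1 hg, h.map_prop hZ⟩

/-- The objects and the transition cokernels lie in `PB`, so they lift; reflection of conflations
makes the lifted transition maps inflations with cokernels in `PA`. -/
theorem IsIndTransfer.exists_lift_diagram (h : IsIndTransfer EA PA EB PB φ) {I : Type w}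
    [PartialOrder I] {Z : I ⥤ B} (hZ : IsRelIndDiagram EB PB Z) (hZ' : ∀ i, PB (Z.obj i)) :
    ∃ X : I ⥤ A, Nonempty (X ⋙ φ ≅ Z) ∧ IsRelIndDiagram EA PA X := by
  have := h.full
  have := h.faithful
  choose X hX e using fun i => h.exists_preimage (hZ' i)
  let e' (i : I) : φ.obj (X i) ≅ Z.obj i := (e i).some
  let X' : I ⥤ A :=
    { obj := X
      map := fun {i j} f => φ.preimage ((e' i).hom ≫ Z.map f ≫ (e' j).inv)
      map_id := fun i => φ.map_injective (by simp)
      map_comp := fun f g => φ.map_injective (by simp) }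
  refine ⟨X', ⟨NatIso.ofComponents e' (fun f => by simp [X'])⟩, fun i j hij => ?_⟩
  obtain ⟨C, g, hg, hC⟩ := hZ hij
  obtain ⟨W, hW, ⟨d⟩⟩ := h.exists_preimage hC
  refine ⟨W, φ.preimage ((e' j).hom ≫ g ≫ d.inv), (h.conf_iff _ _).2 ?_, hW⟩
  refine h.isExact_target.conf_of_iso (e' i).symm (e' j).symm d.symm ?_ ?_ hg <;> simp [X']

/-- Two factorizations of a section through a presentation agree after applying `φ`. -/
theorem IsPres.map_agree {I : Type w} [PartialOrder I] [IsDirectedOrder I] {X : I ⥤ A}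
    {F : LexCat.{w} EA} {x : ∀ i, (lexYoneda.{w} EA).obj (X.obj i) ⟶ F} (hx : IsPres X F x) {G : LexCat.{w} EB}
    {y : ∀ i, (lexYoneda.{w} EB).obj ((X ⋙ φ).obj i) ⟶ G} (hy : IsPres (X ⋙ φ) G y) {T : A} {i j : I}
    {m : T ⟶ X.obj i} {n : T ⟶ X.obj j} (hmn : (lexYoneda.{w} EA).map m ≫ x i = (lexYoneda.{w} EA).map n ≫ x j) :
    (lexYoneda.{w} EB).map (φ.map m) ≫ y i = (lexYoneda.{w} EB).map (φ.map n) ≫ y j := by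
  obtain ⟨k, hik, hjk⟩ := exists_ge_ge i j
  have h1 : m ≫ X.map (homOfLE hik) = n ≫ X.map (homOfLE hjk) := by
    refine hx.eq (i := k) ?_
    rw [Functor.map_comp_assoc, Functor.map_comp_assoc, hx.nat, hx.nat, hmn]
  rw [← hy.nat hik, ← hy.nat hjk, ← Functor.map_comp_assoc, ← Functor.map_comp_assoc]
  change (lexYoneda.{w} EB).map (φ.map m ≫ φ.map _) ≫ _ = (lexYoneda.{w} EB).map (φ.map n ≫ φ.map _) ≫ _
  rw [← φ.map_comp, ← φ.map_comp, h1]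

variable (φ) in
/-- `g` is the morphism induced by `f`, with respect to presentations `x`, `x'` of the source and
the target of `f`, and `y`, `y'` of the source and the target of `g`. -/
def IsIndMap {I J : Type w} [PartialOrder I] [PartialOrder J] {X : I ⥤ A} {X' : J ⥤ A}
    {F F' : LexCat.{w} EA} (x : ∀ i, (lexYoneda.{w} EA).obj (X.obj i) ⟶ F) (x' : ∀ i, (lexYoneda.{w} EA).obj (X'.obj i) ⟶ F')
    {G G' : LexCat.{w} EB} (y : ∀ i, (lexYoneda.{w} EB).obj ((X ⋙ φ).obj i) ⟶ G)
    (y' : ∀ i, (lexYoneda.{w} EB).obj ((X' ⋙ φ).obj i) ⟶ G') (f : F ⟶ F') (g : G ⟶ G') : Prop :=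
  ∀ ⦃i j⦄ (m : X.obj i ⟶ X'.obj j), x i ≫ f = (lexYoneda.{w} EA).map m ≫ x' j →
    y i ≫ g = (lexYoneda.{w} EB).map (φ.map m) ≫ y' j

section

variable {I J K : Type w} [PartialOrder I] [PartialOrder J] [PartialOrder K]
  [IsDirectedOrder I] [IsDirectedOrder J] [IsDirectedOrder K]
  {X : I ⥤ A} {X' : J ⥤ A} {X'' : K ⥤ A} {F F' F'' : LexCat.{w} EA}
  {x : ∀ i, (lexYoneda.{w} EA).obj (X.obj i) ⟶ F} {x' : ∀ i, (lexYoneda.{w} EA).obj (X'.obj i) ⟶ F'}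
  {x'' : ∀ i, (lexYoneda.{w} EA).obj (X''.obj i) ⟶ F''} {G G' G'' : LexCat.{w} EB}
  {y : ∀ i, (lexYoneda.{w} EB).obj ((X ⋙ φ).obj i) ⟶ G} {y' : ∀ i, (lexYoneda.{w} EB).obj ((X' ⋙ φ).obj i) ⟶ G'}
  {y'' : ∀ i, (lexYoneda.{w} EB).obj ((X'' ⋙ φ).obj i) ⟶ G''}

omit [IsDirectedOrder I] [IsDirectedOrder J] in
-- Uniqueness makes functoriality and independence of the presentations formal.
theorem IsIndMap.eq (hE : EB.IsExact) (hx' : IsPres X' F' x') (hy : IsPres (X ⋙ φ) G y)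
    {f : F ⟶ F'} {g g' : G ⟶ G'} (h : IsIndMap φ x x' y y' f g) (h' : IsIndMap φ x x' y y' f g') :
    g = g' := by
  refine hy.hom_ext hE fun i => ?_
  obtain ⟨j, m, hm⟩ := hx'.cover (x i ≫ f)
  rw [h m hm.symm, h' m hm.symm]

theorem exists_isIndMap (hE : EB.IsExact) (hx : IsPres X F x) (hx' : IsPres X' F' x')
    (hy : IsPres (X ⋙ φ) G y) (hy' : IsPres (X' ⋙ φ) G' y') (f : F ⟶ F') :
    ∃ g, IsIndMap φ x x' y y' f g := by
  choose j m hm using fun i => hx'.cover (x i ≫ f)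
  obtain ⟨g, hg⟩ := hy.exists_desc hE (fun i => (lexYoneda.{w} EB).map (φ.map (m i)) ≫ y' (j i)) (by
    intro i k h
    change (lexYoneda.{w} EB).map (φ.map _) ≫ _ = _
    rw [← Functor.map_comp_assoc, ← φ.map_comp]
    refine hx'.map_agree hy' ?_
    rw [Functor.map_comp_assoc, hm, hm, ← Category.assoc, hx.nat])
  exact ⟨g, fun i k n hn => by rw [hg]; exact hx'.map_agree hy' (by rw [hm, hn])⟩

omit [IsDirectedOrder I] [IsDirectedOrder J] in
theorem IsIndMap.comp (hx' : IsPres X' F' x') (hx'' : IsPres X'' F'' x'')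
    (hy'' : IsPres (X'' ⋙ φ) G'' y'')
    {f : F ⟶ F'} {f' : F' ⟶ F''} {g : G ⟶ G'} {g' : G' ⟶ G''} (h : IsIndMap φ x x' y y' f g)
    (h' : IsIndMap φ x' x'' y' y'' f' g') : IsIndMap φ x x'' y y'' (f ≫ f') (g ≫ g') := by
  intro i k n hn
  obtain ⟨j, m, hm⟩ := hx'.cover (x i ≫ f)
  obtain ⟨l, m', hm'⟩ := hx''.cover (x' j ≫ f')
  rw [← Category.assoc, h m hm.symm, Category.assoc, h' m' hm'.symm, ← Functor.map_comp_assoc,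
    ← φ.map_comp]
  exact hx''.map_agree hy'' (by rw [Functor.map_comp_assoc, hm', reassoc_of% hm, hn])

theorem IsIndMap.id (hx : IsPres X F x) (hy : IsPres (X ⋙ φ) G y) :
    IsIndMap φ x x y y (𝟙 F) (𝟙 G) := by
  intro i j m hm
  have := hx.map_agree hy (m := 𝟙 (X.obj i)) (n := m) (by rw [CategoryTheory.Functor.map_id]; simpa using hm)
  rw [φ.map_id, CategoryTheory.Functor.map_id] at this
  rw [← this]
  exact (Category.comp_id _).trans (Category.id_comp _).symm

end

omit [Preadditive A] in
theorem isPres_punit (T : A) :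
    IsPres ((Functor.const PUnit.{w + 1}).obj T ⋙ φ) ((lexYoneda.{w} EB).obj (φ.obj T)) (fun _ => 𝟙 _) where
  nat i j h := by simp
  eq_zero i B m hm := by
    rw [Category.comp_id] at hm
    exact (lexYoneda.{w} EB).map_injective (hm.trans ((lexYoneda.{w} EB).map_zero _ _).symm)
  cover B t := by
    obtain ⟨m, rfl⟩ := (lexYoneda.{w} EB).map_surjective t
    exact ⟨⟨⟩, m, by simp⟩

variable (PA EB PB φ) in
/-- A presentation of `F`, and an object presented by its image under `φ`. -/
structure LiftedPres (F : RelInd EA PA κ) where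
  I : Type w
  [partialOrder : PartialOrder I]
  [isDirectedOrder : IsDirectedOrder I]
  X : I ⥤ A
  x : ∀ i, (lexYoneda.{w} EA).obj (X.obj i) ⟶ F.obj
  pres : IsPres X F.obj x
  G : RelInd EB PB κ
  y : ∀ i, (lexYoneda.{w} EB).obj ((X ⋙ φ).obj i) ⟶ G.obj
  pres' : IsPres (X ⋙ φ) G.obj y

attribute [instance] LiftedPres.partialOrder LiftedPres.isDirectedOrder

theorem IsIndTransfer.exists_target (h : IsIndTransfer EA PA EB PB φ) {I : Type w}
    [PartialOrder I] [IsDirectedOrder I] [Nonempty I] (hI : Cardinal.mk I ≤ κ) {X : I ⥤ A}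
    (hX : IsRelIndDiagram EA PA X) : ∃ (G : RelInd EB PB κ)
      (y : ∀ i, (lexYoneda.{w} EB).obj ((X ⋙ φ).obj i) ⟶ G.obj), IsPres (X ⋙ φ) G.obj y := by
  obtain ⟨G, y, hy⟩ := exists_isPres h.isExact_target h.extensionClosed_target (h.map_diagram hX)
  exact ⟨⟨G, (isRelInd_iff h.isExact_target h.extensionClosed_target).2
    ⟨I, _, ‹_›, ‹_›, X ⋙ φ, y, hI, h.map_diagram hX, hy⟩⟩, y, hy⟩

theorem IsIndTransfer.nonempty_liftedPres (h : IsIndTransfer EA PA EB PB φ)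
    (F : RelInd EA PA κ) : Nonempty (LiftedPres PA EB PB φ F) := by
  obtain ⟨I, _, _, _, X, x, hI, hX, hx⟩ :=
    (isRelInd_iff h.isExact_source h.extensionClosed_source).1 F.property
  obtain ⟨G, y, hy⟩ := h.exists_target hI hX
  exact ⟨{ I := I, X := X, x := x, pres := hx, G := G, y := y, pres' := hy }⟩

/-- A choice of presentations. -/
def IsIndTransfer.chosen (h : IsIndTransfer EA PA EB PB φ) (F : RelInd EA PA κ) :
    LiftedPres PA EB PB φ F := (h.nonempty_liftedPres F).some

/-- The morphism induced on the objects presented by the images under `φ`. -/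
def IsIndTransfer.indMap (h : IsIndTransfer EA PA EB PB φ) {F F' : RelInd EA PA κ}
    (c : LiftedPres PA EB PB φ F) (c' : LiftedPres PA EB PB φ F') (f : F ⟶ F') : c.G ⟶ c'.G :=
  ObjectProperty.homMk (exists_isIndMap h.isExact_target c.pres c'.pres c.pres' c'.pres' f.hom).choose

theorem IsIndTransfer.isIndMap_indMap (h : IsIndTransfer EA PA EB PB φ) {F F' : RelInd EA PA κ}
    (c : LiftedPres PA EB PB φ F) (c' : LiftedPres PA EB PB φ F') (f : F ⟶ F') :
    IsIndMap φ c.x c'.x c.y c'.y f.hom (h.indMap c c' f).hom :=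
  (exists_isIndMap h.isExact_target c.pres c'.pres c.pres' c'.pres' f.hom).choose_spec

theorem IsIndTransfer.eq_indMap (h : IsIndTransfer EA PA EB PB φ) {F F' : RelInd EA PA κ}
    {c : LiftedPres PA EB PB φ F} {c' : LiftedPres PA EB PB φ F'} {f : F ⟶ F'} {g : c.G ⟶ c'.G}
    (hg : IsIndMap φ c.x c'.x c.y c'.y f.hom g.hom) : h.indMap c c' f = g :=
  ObjectProperty.hom_ext _ ((h.isIndMap_indMap c c' f).eq h.isExact_target c'.pres c.pres' hg)

theorem IsIndTransfer.indMap_id (h : IsIndTransfer EA PA EB PB φ) {F : RelInd EA PA κ}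
    (c : LiftedPres PA EB PB φ F) : h.indMap c c (𝟙 F) = 𝟙 c.G :=
  h.eq_indMap (IsIndMap.id c.pres c.pres')

theorem IsIndTransfer.indMap_comp (h : IsIndTransfer EA PA EB PB φ) {F F' F'' : RelInd EA PA κ}
    (c : LiftedPres PA EB PB φ F) (c' : LiftedPres PA EB PB φ F') (c'' : LiftedPres PA EB PB φ F'')
    (f : F ⟶ F') (f' : F' ⟶ F'') :
    h.indMap c c'' (f ≫ f') = h.indMap c c' f ≫ h.indMap c' c'' f' :=
  h.eq_indMap ((h.isIndMap_indMap c c' f).comp c'.pres c''.pres c''.pres'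
    (h.isIndMap_indMap c' c'' f'))

/-- The functor `Ind(A, PA) ⥤ Ind(B, PB)` induced by `φ`. -/
def IsIndTransfer.indFunctor (h : IsIndTransfer EA PA EB PB φ) (κ : Cardinal.{w}) :
    RelInd EA PA κ ⥤ RelInd EB PB κ where
  obj F := (h.chosen F).G
  map f := h.indMap _ _ f
  map_id _ := h.indMap_id _
  map_comp _ _ := h.indMap_comp _ _ _ _ _

variable (PA EB PB φ) in
/-- The constant presentation of an object of `A`. -/
def LiftedPres.const (hκ : Cardinal.aleph0 ≤ κ) (T : A) :
    LiftedPres PA EB PB φ ((toRelInd EA PA hκ).obj T) where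
  I := PUnit
  X := (Functor.const _).obj T
  x _ := 𝟙 _
  pres := isPres_const T
  G := (toRelInd EB PB hκ).obj (φ.obj T)
  y _ := 𝟙 _
  pres' := isPres_punit T

/-- Identifies the structure maps of the target presentation with the images of those of the source,
which is how preservation of the Ind colimits is checked. -/
theorem IsIndTransfer.indMap_const (h : IsIndTransfer EA PA EB PB φ) (hκ : Cardinal.aleph0 ≤ κ)
    {F : RelInd EA PA κ} (c : LiftedPres PA EB PB φ F) (i : c.I) :
    h.indMap (LiftedPres.const PA EB PB φ hκ (c.X.obj i)) c (presHom hκ c.x i) =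
      (presHom hκ c.y i : (toRelInd EB PB hκ).obj (φ.obj (c.X.obj i)) ⟶ c.G) := by
  refine h.eq_indMap fun k j (m : c.X.obj i ⟶ c.X.obj j) hm => ?_
  have := c.pres.map_agree c.pres' (m := 𝟙 (c.X.obj i)) (n := m)
    (by rw [CategoryTheory.Functor.map_id]; exact hm)
  rw [φ.map_id, CategoryTheory.Functor.map_id] at this
  exact this

theorem IsIndTransfer.indMap_const_const (h : IsIndTransfer EA PA EB PB φ)
    (hκ : Cardinal.aleph0 ≤ κ) {S T : A} (m : S ⟶ T) :
    h.indMap (LiftedPres.const PA EB PB φ hκ S) (LiftedPres.const PA EB PB φ hκ T)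
      ((toRelInd EA PA hκ).map m) = (toRelInd EB PB hκ).map (φ.map m) := by
  refine h.eq_indMap fun i j (n : S ⟶ T) hn => ?_
  have hn' : (lexYoneda.{w} EA).map m = (lexYoneda.{w} EA).map n :=
    ((Category.id_comp _).symm.trans hn).trans (Category.comp_id _)
  rw [← (lexYoneda.{w} EA).map_injective hn']
  exact (Category.id_comp _).trans (Category.comp_id _).symm

/-- The induced functor extends `φ`. -/
def IsIndTransfer.indFunctorIso (h : IsIndTransfer EA PA EB PB φ) (hκ : Cardinal.aleph0 ≤ κ) :
    toRelInd EA PA hκ ⋙ h.indFunctor κ ≅ φ ⋙ toRelInd EB PB hκ :=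
  NatIso.ofComponents (fun T =>
    { hom := h.indMap (h.chosen _) (LiftedPres.const PA EB PB φ hκ T) (𝟙 _)
      inv := h.indMap (LiftedPres.const PA EB PB φ hκ T) (h.chosen _) (𝟙 _)
      hom_inv_id := by
        exact (h.indMap_comp _ _ _ _ _).symm.trans
          ((congrArg _ (Category.comp_id _)).trans (h.indMap_id _))
      inv_hom_id := by
        exact (h.indMap_comp _ _ _ _ _).symm.trans
          ((congrArg _ (Category.comp_id _)).trans (h.indMap_id _)) }) (fun {S T} m => by
    have h1 := (h.indMap_comp (h.chosen _) (h.chosen _) (LiftedPres.const PA EB PB φ hκ T)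
      ((toRelInd EA PA hκ).map m) (𝟙 _)).symm
    have h2 := (h.indMap_comp (h.chosen _) (LiftedPres.const PA EB PB φ hκ S)
      (LiftedPres.const PA EB PB φ hκ T) (𝟙 _) ((toRelInd EA PA hκ).map m))
    rw [h.indMap_const_const hκ m, Category.id_comp] at h2
    rw [Category.comp_id] at h1
    exact h1.trans h2)

end

section

variable {D : Type u} [Category.{v} D] [Preadditive D] {E : ConflationClass D}
  {P : ObjectProperty D} {κ : Cardinal.{w}}

theorem isColimit_of_isPres (hE : E.IsExact) (hκ : Cardinal.aleph0 ≤ κ) {I : Type w}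
    [PartialOrder I] [IsDirectedOrder I] {X : I ⥤ D} (t : Cocone (X ⋙ toRelInd E P hκ))
    (h : IsPres X t.pt.obj (fun i => (t.ι.app i).hom)) : Nonempty (IsColimit t) := by
  have key (s : Cocone (X ⋙ toRelInd E P hκ)) := h.exists_desc hE (G := s.pt.obj)
    (fun i => (s.ι.app i).hom)
    (fun _ _ hij => congrArg InducedCategory.Hom.hom (s.w (homOfLE hij)))
  exact ⟨{
    desc := fun s => ObjectProperty.homMk (key s).choose
    fac := fun s i => ObjectProperty.hom_ext _ ((key s).choose_spec i)
    uniq := fun s m hm => ObjectProperty.hom_ext _ (h.hom_ext hE fun i =>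
      (congrArg InducedCategory.Hom.hom (hm i)).trans ((key s).choose_spec i).symm) }⟩

/-- The cocone given by a presentation. -/
def presCocone (hκ : Cardinal.aleph0 ≤ κ) {I : Type w} [PartialOrder I] {X : I ⥤ D}
    {F : RelInd E P κ} {x : ∀ i, (lexYoneda.{w} E).obj (X.obj i) ⟶ F.obj} (hx : IsPres X F.obj x) :
    Cocone (X ⋙ toRelInd E P hκ) where
  pt := F
  ι :=
    { app := presHom hκ x
      naturality := fun _ _ f => ObjectProperty.hom_ext _
        ((hx.nat (leOfHom f)).trans (Category.comp_id _).symm) }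

/-- The union in Lex(D) of an Ind diagram lies in Ind(D, C) and is a colimit there as well;
uniqueness of colimits does the rest. -/
theorem isPres_of_isColimit_relInd (hE : E.IsExact) (hP : E.IsExtensionClosed P)
    (hκ : Cardinal.aleph0 ≤ κ) {I : Type w}
    [PartialOrder I] [IsDirectedOrder I] [Nonempty I] (hI : Cardinal.mk I ≤ κ) {X : I ⥤ D}
    (hX : IsRelIndDiagram E P X) (t : Cocone (X ⋙ toRelInd E P hκ)) (ht : IsColimit t) :
    IsPres X t.pt.obj (fun i => (t.ι.app i).hom) := by
  obtain ⟨G, y, hy⟩ := exists_isPres hE hP hX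
  let G' : RelInd E P κ := ⟨G, (isRelInd_iff hE hP).2 ⟨I, _, ‹_›, ‹_›, X, y, hI, hX, hy⟩⟩
  obtain ⟨hc⟩ := isColimit_of_isPres hE hκ (presCocone hκ (F := G') hy) hy
  let e := hc.coconePointUniqueUpToIso ht
  have := hy.of_iso ((isRelInd E P κ).ι.mapIso e)
  have h (i : I) : (t.ι.app i).hom = y i ≫ ((isRelInd E P κ).ι.mapIso e).hom :=
    (congrArg InducedCategory.Hom.hom (hc.comp_coconePointUniqueUpToIso_hom ht i)).symm
  rw [funext h]
  exact this

end

end RelTate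
end

/-! ### Passage to unions of objects of C; transport of presentations along an extension of φ. -/

noncomputable section
namespace RelTate

section

variable {D : Type u} [Category.{v} D] [Preadditive D] {E : ConflationClass D}

theorem IsPres.of_natIso {I : Type w} [PartialOrder I] {X X' : I ⥤ D} {F : LexCat.{w} E}
    {x : ∀ i, (lexYoneda.{w} E).obj (X.obj i) ⟶ F} (hx : IsPres X F x) (e : X' ≅ X) :
    IsPres X' F (fun i => (lexYoneda.{w} E).map (e.hom.app i) ≫ x i) where
  nat i j h := by
    rw [← Functor.map_comp_assoc, e.hom.naturality, Functor.map_comp_assoc, hx.nat]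
  eq_zero i B m hm := by
    rw [← Functor.map_comp_assoc] at hm
    have := hx.eq_zero i _ hm
    rw [← cancel_mono (e.hom.app i), this, zero_comp]
  cover B t := by
    obtain ⟨i, m, hm⟩ := hx.cover t
    exact ⟨i, m ≫ e.inv.app i, by rw [← hm, ← Functor.map_comp_assoc]; simp⟩

theorem IsPres.exists_iso (hE : E.IsExact) {I : Type w} [PartialOrder I] [IsDirectedOrder I]
    {X : I ⥤ D} {F F' : LexCat.{w} E} {x : ∀ i, (lexYoneda.{w} E).obj (X.obj i) ⟶ F}
    {x' : ∀ i, (lexYoneda.{w} E).obj (X.obj i) ⟶ F'} (hx : IsPres X F x) (hx' : IsPres X F' x') :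
    ∃ e : F ≅ F', ∀ i, x i ≫ e.hom = x' i := by
  obtain ⟨a, ha⟩ := hx.exists_desc hE x' hx'.nat
  obtain ⟨b, hb⟩ := hx'.exists_desc hE x hx.nat
  exact ⟨⟨a, b, hx.hom_ext hE fun i => by rw [reassoc_of% ha, hb, Category.comp_id],
    hx'.hom_ext hE fun i => by rw [reassoc_of% hb, ha, Category.comp_id]⟩, ha⟩

variable {P : ObjectProperty D} {κ : Cardinal.{w}}

/-- Every conflation of `Ind(D, C)` is, up to weak isomorphisms, a conflation whose outer terms
are in `Ind(C)`. -/
theorem exists_isIndOf_quotient (hE : E.IsExact) (hP : E.IsExtensionClosed P)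
    (hκ : Cardinal.aleph0 ≤ κ) {X Y Z : RelInd E P κ} {f : X ⟶ Y} {g : Y ⟶ Z}
    (h : (relIndClass E P κ).Conf f g) :
    ∃ (X₁ Y₁ Z₁ : RelInd E P κ) (f₁ : X₁ ⟶ Y₁) (g₁ : Y₁ ⟶ Z₁) (a : X ⟶ X₁) (b : Y ⟶ Y₁)
      (c : Z ⟶ Z₁), (relIndClass E P κ).Conf f₁ g₁ ∧
      serreDeflation (relIndClass E P κ) (toRelInd E P hκ).essImage a ∧
      serreDeflation (relIndClass E P κ) (toRelInd E P hκ).essImage b ∧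
      serreDeflation (relIndClass E P κ) (toRelInd E P hκ).essImage c ∧
      f ≫ b = a ≫ f₁ ∧ g ≫ c = b ≫ g₁ ∧ IsIndOf P κ X₁.obj ∧ IsIndOf P κ Z₁.obj := by
  have h' := (relIndClass_conf_iff hE).1 h
  obtain ⟨c⟩ := (isRelInd_of_lexExact hE hP hκ h' X.property Z.property).1
  obtain ⟨k⟩ := c.nonempty
  -- Any stage `k` will do: dividing by one conflation of objects of `D` leaves as outer terms the
  -- unions of the `X l / X k` and of the `Z l / Z k`, which lie in `P`.
  obtain ⟨Q, q, hQ, hq⟩ := exists_quotient hE hP c.card_le c.diagX c.presX k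
  obtain ⟨R, r, hR, hr⟩ := exists_quotient hE hP c.card_le c.diagZ c.presZ k
  let Q' : RelInd E P κ := ⟨Q, hQ.isRelInd hE hP⟩
  let R' : RelInd E P κ := ⟨R, hR.isRelInd hE hP⟩
  have hq' : (relIndClass E P κ).Conf (presHom hκ c.x k) (ObjectProperty.homMk q : X ⟶ Q') :=
    (relIndClass_conf_iff hE).2 hq
  have hr' : (relIndClass E P κ).Conf (presHom hκ c.z k) (ObjectProperty.homMk r : Z ⟶ R') :=
    (relIndClass_conf_iff hE).2 hr
  obtain ⟨W, b, f₁, g₁, hb, h₁, h2, h3⟩ := (relIndClass_isExact hE hP hκ).conf_mid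
    (toRelInd_exact hE hκ _ _ (c.conf k)) h hq' hr' (b := presHom hκ c.y k)
    (ObjectProperty.hom_ext _ (c.map_u k)) (ObjectProperty.hom_ext _ (c.map_v k).symm)
  exact ⟨Q', W, R', f₁, g₁, _, b, _, h₁, ⟨_, _, hq', Functor.obj_mem_essImage _ _⟩,
    ⟨_, _, hb, Functor.obj_mem_essImage _ _⟩, ⟨_, _, hr', Functor.obj_mem_essImage _ _⟩,
    h2.symm, h3.symm, hQ, hR⟩

/-- Every object of `Ind(D, C)` is weakly isomorphic to an object of `Ind(C)`. -/
theorem exists_isIndOf_quotient_obj (hE : E.IsExact) (hP : E.IsExtensionClosed P)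
    (hκ : Cardinal.aleph0 ≤ κ) (X : RelInd E P κ) :
    ∃ (X₁ : RelInd E P κ) (a : X ⟶ X₁),
      serreDeflation (relIndClass E P κ) (toRelInd E P hκ).essImage a ∧ IsIndOf P κ X₁.obj := by
  have hI := relIndClass_isExact hE hP hκ
  obtain ⟨O, hO⟩ := hI.hasZeroObject
  obtain ⟨X₁, Y₁, Z₁, f₁, g₁, a, b, c, h₁, ha, hb, hc, h2, h3, h4, h5⟩ :=
    exists_isIndOf_quotient hE hP hκ (hI.conf_id_zero X hO)
  exact ⟨X₁, a, ha, h4⟩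

end

section

variable {A : Type u₁} [Category.{v₁} A] [Preadditive A] {EA : ConflationClass A}
  {PA : ObjectProperty A} {B : Type u₂} [Category.{v₂} B] [Preadditive B]
  {EB : ConflationClass B} {PB : ObjectProperty B} {κ : Cardinal.{w}} {φ : A ⥤ B}

/-- `IsPres.map_agree` in the other direction. -/
theorem IsPres.agree_of_map [φ.Faithful] {I : Type w} [PartialOrder I] [IsDirectedOrder I]
    {X : I ⥤ A} {F : LexCat.{w} EA} {x : ∀ i, (lexYoneda.{w} EA).obj (X.obj i) ⟶ F} (hx : IsPres X F x)
    {G : LexCat.{w} EB} {y : ∀ i, (lexYoneda.{w} EB).obj ((X ⋙ φ).obj i) ⟶ G} (hy : IsPres (X ⋙ φ) G y) {T : A}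
    {i j : I} {m : T ⟶ X.obj i} {n : T ⟶ X.obj j}
    (hmn : (lexYoneda.{w} EB).map (φ.map m) ≫ y i = (lexYoneda.{w} EB).map (φ.map n) ≫ y j) :
    (lexYoneda.{w} EA).map m ≫ x i = (lexYoneda.{w} EA).map n ≫ x j := by
  obtain ⟨k, hik, hjk⟩ := exists_ge_ge i j
  have h1 : φ.map (m ≫ X.map (homOfLE hik)) = φ.map (n ≫ X.map (homOfLE hjk)) := by
    refine hy.eq (i := k) ?_
    rw [φ.map_comp, φ.map_comp, Functor.map_comp_assoc, Functor.map_comp_assoc]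
    exact (congrArg _ (hy.nat hik)).trans (hmn.trans (congrArg _ (hy.nat hjk)).symm)
  rw [← hx.nat hik, ← hx.nat hjk, ← Functor.map_comp_assoc, ← Functor.map_comp_assoc,
    φ.map_injective h1]

section

variable (hκ : Cardinal.aleph0 ≤ κ) {J : RelInd EA PA κ ⥤ RelInd EB PB κ}
  (α : toRelInd EA PA hκ ⋙ J ≅ φ ⋙ toRelInd EB PB hκ)
  {I : Type w} [PartialOrder I] {X : I ⥤ A} {F : RelInd EA PA κ}

/-- The image under `J` of the morphisms of a presentation of `F`. -/
def transferHom (x : ∀ i, (lexYoneda.{w} EA).obj (X.obj i) ⟶ F.obj) (i : I) :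
    (lexYoneda.{w} EB).obj ((X ⋙ φ).obj i) ⟶ (J.obj F).obj :=
  (α.inv.app (X.obj i) ≫ J.map (presHom hκ x i)).hom

theorem transferHom_map {I' : Type w} [PartialOrder I'] {X' : I' ⥤ A} {F' : RelInd EA PA κ}
    {x : ∀ i, (lexYoneda.{w} EA).obj (X.obj i) ⟶ F.obj} {x' : ∀ i, (lexYoneda.{w} EA).obj (X'.obj i) ⟶ F'.obj} {f : F ⟶ F'}
    {i : I} {j : I'} {m : X.obj i ⟶ X'.obj j} (hm : x i ≫ f.hom = (lexYoneda.{w} EA).map m ≫ x' j) :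
    transferHom hκ α x i ≫ (J.map f).hom = (lexYoneda.{w} EB).map (φ.map m) ≫ transferHom hκ α x' j := by
  have h1 : presHom hκ x i ≫ f = (toRelInd EA PA hκ).map m ≫ presHom hκ x' j :=
    ObjectProperty.hom_ext _ hm
  have h2 : (α.inv.app (X.obj i) ≫ J.map (presHom hκ x i)) ≫ J.map f =
      (toRelInd EB PB hκ).map (φ.map m) ≫ α.inv.app (X'.obj j) ≫ J.map (presHom hκ x' j) := by
    rw [Category.assoc, ← J.map_comp, h1, J.map_comp]
    exact (α.inv.naturality_assoc m _).symm
  exact congrArg InducedCategory.Hom.hom h2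

variable [IsDirectedOrder I]

/-- The isomorphism of diagrams induced by `α`. -/
def transferIso (X : I ⥤ A) :
    (X ⋙ toRelInd EA PA hκ) ⋙ J ≅ (X ⋙ φ) ⋙ toRelInd EB PB hκ :=
  Functor.isoWhiskerLeft X α

theorem preservesColimit_of_isPres (hA : EA.IsExact) (hB : EB.IsExact)
    {x : ∀ i, (lexYoneda.{w} EA).obj (X.obj i) ⟶ F.obj} (hx : IsPres X F.obj x)
    (hy : IsPres (X ⋙ φ) (J.obj F).obj (transferHom hκ α x)) :
    PreservesColimit (X ⋙ toRelInd EA PA hκ) J := by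
  obtain ⟨ht⟩ := isColimit_of_isPres hA hκ (presCocone hκ hx) hx
  obtain ⟨hc⟩ := isColimit_of_isPres hB hκ ((Cocone.precompose (transferIso hκ α X).inv).obj
    (J.mapCocone (presCocone hκ hx))) hy
  exact preservesColimit_of_preserves_colimit_cocone ht
    (IsColimit.precomposeInvEquiv (transferIso hκ α X) _ hc)

/-- With `preservesColimit_of_isPres`, this says that an extension of `φ` preserves the colimit of
an Ind diagram exactly when it carries the presentation to a presentation. -/
theorem isPres_transferHom (h : IsIndTransfer EA PA EB PB φ) [Nonempty I]
    (hI : Cardinal.mk I ≤ κ) (hX : IsRelIndDiagram EA PA X)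
    {x : ∀ i, (lexYoneda.{w} EA).obj (X.obj i) ⟶ F.obj} (hx : IsPres X F.obj x)
    [PreservesColimit (X ⋙ toRelInd EA PA hκ) J] :
    IsPres (X ⋙ φ) (J.obj F).obj (transferHom hκ α x) := by
  obtain ⟨ht⟩ := isColimit_of_isPres h.isExact_source hκ (presCocone hκ hx) hx
  exact isPres_of_isColimit_relInd h.isExact_target h.extensionClosed_target hκ hI
    (h.map_diagram hX) _ ((IsColimit.precomposeInvEquiv (transferIso hκ α X) _).symm
      (isColimitOfPreserves J ht))

end

theorem IsIndTransfer.isIndExtension_indFunctor (h : IsIndTransfer EA PA EB PB φ)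
    (hκ : Cardinal.aleph0 ≤ κ) : IsIndExtension EA PA EB PB hκ φ (h.indFunctor κ) where
  extends_functor := ⟨h.indFunctorIso hκ⟩
  preserves I _ _ _ X hI hX := by
    obtain ⟨F', x, hx⟩ := exists_isPres h.isExact_source h.extensionClosed_source hX
    let F : RelInd EA PA κ := ⟨F', (isRelInd_iff h.isExact_source h.extensionClosed_source).2
      ⟨I, _, ‹_›, ‹_›, X, x, hI, hX, hx⟩⟩
    obtain ⟨G, y, hy⟩ := h.exists_target hI hX
    let c : LiftedPres PA EB PB φ F := { I := I, X := X, x := x, pres := hx, G := G, y := y, pres' := hy }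
    refine preservesColimit_of_isPres hκ (h.indFunctorIso hκ) (F := F) h.isExact_source
      h.isExact_target hx ?_
    -- The functor was defined through a chosen presentation of `F`; the identity of `F` induces an
    -- isomorphism with the object presented by `X ⋙ φ`.
    let e : G ≅ (h.indFunctor κ).obj F :=
      { hom := h.indMap c (h.chosen F) (𝟙 F)
        inv := h.indMap (h.chosen F) c (𝟙 F)
        hom_inv_id := (h.indMap_comp _ _ _ _ _).symm.trans
          ((congrArg _ (Category.comp_id _)).trans (h.indMap_id _))
        inv_hom_id := (h.indMap_comp _ _ _ _ _).symm.trans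
          ((congrArg _ (Category.comp_id _)).trans (h.indMap_id _)) }
    have h1 (i : I) : transferHom hκ (h.indFunctorIso hκ) (F := F) x i =
        y i ≫ ((isRelInd EB PB κ).ι.mapIso e).hom := by
      have h2 := h.indMap_comp (LiftedPres.const PA EB PB φ hκ (X.obj i)) (h.chosen _)
        (h.chosen F) (𝟙 _) (presHom hκ c.x i)
      have h3 := h.indMap_comp (LiftedPres.const PA EB PB φ hκ (X.obj i)) c
        (h.chosen F) (presHom hκ c.x i) (𝟙 _)
      rw [Category.id_comp] at h2
      rw [Category.comp_id, h.indMap_const hκ c i] at h3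
      exact congrArg InducedCategory.Hom.hom (h2.symm.trans h3)
    rw [funext h1]
    exact hy.of_iso _

end

end RelTate
end

/-! ### Exactness, full faithfulness and lifting for an extension of φ. -/

noncomputable section
namespace RelTate

section

variable {A : Type u₁} [Category.{v₁} A] [Preadditive A] {EA : ConflationClass A}
  {PA : ObjectProperty A} {B : Type u₂} [Category.{v₂} B] [Preadditive B]
  {EB : ConflationClass B} {PB : ObjectProperty B} {κ : Cardinal.{w}} {φ : A ⥤ B}
  (h : IsIndTransfer EA PA EB PB φ) (hκ : Cardinal.aleph0 ≤ κ)
  {J : RelInd EA PA κ ⥤ RelInd EB PB κ} (α : toRelInd EA PA hκ ⋙ J ≅ φ ⋙ toRelInd EB PB hκ)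
  (hJ : ∀ (I : Type w) [PartialOrder I] [IsDirectedOrder I] [Nonempty I] (X : I ⥤ A),
    Cardinal.mk I ≤ κ → IsRelIndDiagram EA PA X → PreservesColimit (X ⋙ toRelInd EA PA hκ) J)

include h hJ

theorem isPres_of_preserves {I : Type w} [PartialOrder I] [IsDirectedOrder I] [Nonempty I]
    {X : I ⥤ A} {F : RelInd EA PA κ} (hI : Cardinal.mk I ≤ κ) (hX : IsRelIndDiagram EA PA X)
    {x : ∀ i, (lexYoneda.{w} EA).obj (X.obj i) ⟶ F.obj} (hx : IsPres X F.obj x) :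
    IsPres (X ⋙ φ) (J.obj F).obj (transferHom hκ α x) :=
  have := hJ I X hI hX
  isPres_transferHom hκ α h hI hX hx

include α

/-- A straightened conflation is mapped term by term to conflations of `B`, and a union of
conflations is exact. -/
theorem indExtension_exact : IsExactFunctor (relIndClass EA PA κ) (relIndClass EB PB κ) J := by
  intro F G H f g hfg
  rw [relIndClass_conf_iff h.isExact_source] at hfg
  obtain ⟨c⟩ := (isRelInd_of_lexExact h.isExact_source h.extensionClosed_source hκ hfg
    F.property H.property).1
  rw [relIndClass_conf_iff h.isExact_target]
  exact LexExact.of_isPres h.isExact_target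
    (isPres_of_preserves h hκ α hJ c.card_le c.diagX c.presX)
    (isPres_of_preserves h hκ α hJ c.card_le c.diagY c.presY)
    (isPres_of_preserves h hκ α hJ c.card_le c.diagZ c.presZ)
    (fun k => φ.map (c.u.app k)) (fun k => φ.map (c.v.app k))
    (fun k => (h.conf_iff _ _).1 (c.conf k))
    (fun k => (transferHom_map hκ α (c.map_u k).symm).symm)
    (fun k => transferHom_map hκ α (c.map_v k))

theorem indExtension_faithful : J.Faithful where
  map_injective {F F'} f f' hff := by
    have := h.faithful
    obtain ⟨I, _, _, _, X, x, hI, hX, hx⟩ :=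
      (isRelInd_iff h.isExact_source h.extensionClosed_source).1 F.property
    obtain ⟨I', _, _, _, X', x', hI', hX', hx'⟩ :=
      (isRelInd_iff h.isExact_source h.extensionClosed_source).1 F'.property
    refine ObjectProperty.hom_ext _ (hx.hom_ext h.isExact_source fun i => ?_)
    obtain ⟨j, m, hm⟩ := hx'.cover (x i ≫ f.hom)
    obtain ⟨j', m', hm'⟩ := hx'.cover (x i ≫ f'.hom)
    rw [← hm, ← hm']
    refine hx'.agree_of_map (isPres_of_preserves h hκ α hJ hI' hX' hx') ?_
    rw [← transferHom_map hκ α hm.symm, ← transferHom_map hκ α hm'.symm, hff]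

/-- On a term of the source, `g` factors through the image under `φ` of a term of the target, where
`φ` is full; faithfulness makes the lifts compatible. -/
theorem indExtension_full : J.Full where
  map_surjective {F F'} g := by
    have := h.faithful
    have := h.full
    obtain ⟨I, _, _, _, X, x, hI, hX, hx⟩ :=
      (isRelInd_iff h.isExact_source h.extensionClosed_source).1 F.property
    obtain ⟨I', _, _, _, X', x', hI', hX', hx'⟩ :=
      (isRelInd_iff h.isExact_source h.extensionClosed_source).1 F'.property
    have hy := isPres_of_preserves h hκ α hJ hI hX hx
    have hy' := isPres_of_preserves h hκ α hJ hI' hX' hx'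
    have key (i : I) : ∃ (j : I') (m : X.obj i ⟶ X'.obj j),
        (lexYoneda.{w} EB).map (φ.map m) ≫ transferHom hκ α x' j = transferHom hκ α x i ≫ g.hom := by
      obtain ⟨j, m, hm⟩ := hy'.cover (transferHom hκ α x i ≫ g.hom)
      obtain ⟨m, rfl⟩ := φ.map_surjective m
      exact ⟨j, m, hm⟩
    choose j m hm using key
    obtain ⟨f, hf⟩ := hx.exists_desc h.isExact_source (G := F'.obj)
      (fun i => (lexYoneda.{w} EA).map (m i) ≫ x' (j i)) (by
        intro i k hik
        rw [← Functor.map_comp_assoc]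
        refine hx'.agree_of_map hy' ?_
        rw [φ.map_comp, Functor.map_comp_assoc, hm, hm, ← Category.assoc]
        exact congrArg (· ≫ g.hom) (hy.nat hik))
    refine ⟨ObjectProperty.homMk f, ObjectProperty.hom_ext _ (hy.hom_ext h.isExact_target
      fun i => ?_)⟩
    rw [transferHom_map hκ α (f := ObjectProperty.homMk f) (hf i), hm]

omit h hJ in
theorem essImage_indExtension {F : RelInd EA PA κ} (hF : (toRelInd EA PA hκ).essImage F) :
    (toRelInd EB PB hκ).essImage (J.obj F) := by
  obtain ⟨T, ⟨e⟩⟩ := hF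
  exact ⟨φ.obj T, ⟨(α.app T).symm ≪≫ J.mapIso e⟩⟩

theorem serreDeflation_indExtension {F G : RelInd EA PA κ} {f : F ⟶ G}
    (hf : serreDeflation (relIndClass EA PA κ) (toRelInd EA PA hκ).essImage f) :
    serreDeflation (relIndClass EB PB κ) (toRelInd EB PB hκ).essImage (J.map f) := by
  obtain ⟨K, k, hk, hK⟩ := hf
  exact ⟨_, _, indExtension_exact h hκ α hJ _ _ hk, essImage_indExtension hκ α hK⟩

/-- Weak isomorphisms out of `J F` are refined by images of weak isomorphisms out of `F`. -/
theorem exists_refinement_indExtension {F : RelInd EA PA κ} {W : RelInd EB PB κ} {s : J.obj F ⟶ W}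
    (hs : serreDeflation (relIndClass EB PB κ) (toRelInd EB PB hκ).essImage s) :
    ∃ (Q : RelInd EA PA κ) (q : F ⟶ Q) (r : W ⟶ J.obj Q),
      serreDeflation (relIndClass EA PA κ) (toRelInd EA PA hκ).essImage q ∧ s ≫ r = J.map q := by
  obtain ⟨K, k, hk, T, ⟨e⟩⟩ := hs
  obtain ⟨I, _, _, _, X, x, hI, hX, hx⟩ :=
    (isRelInd_iff h.isExact_source h.extensionClosed_source).1 F.property
  have hy := isPres_of_preserves h hκ α hJ hI hX hx
  -- The kernel of `s` comes from an object of `B`, so it maps through a single stage `φ (X i)`;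
  -- hence the image of `F ⟶ F / X i` factors through `s`.
  obtain ⟨i, m, hm⟩ := hy.cover ((e.hom ≫ k).hom : (lexYoneda.{w} EB).obj T ⟶ (J.obj F).obj)
  obtain ⟨Q', q', hQ, hq⟩ := exists_quotient h.isExact_source h.extensionClosed_source hI hX hx i
  let Q : RelInd EA PA κ := ⟨Q', hQ.isRelInd h.isExact_source h.extensionClosed_source⟩
  let q : F ⟶ Q := ObjectProperty.homMk q'
  have hq' : (relIndClass EA PA κ).Conf (presHom hκ x i) q :=
    (relIndClass_conf_iff h.isExact_source).2 hq
  have h1 := (indExtension_exact h hκ α hJ _ _ hq').pair.w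
  have h2 : k ≫ J.map q = 0 := by
    rw [← cancel_epi e.hom, ← Category.assoc, comp_zero]
    have h3 : e.hom ≫ k = (toRelInd EB PB hκ).map m ≫ α.inv.app (X.obj i) ≫
      J.map (presHom hκ x i) := ObjectProperty.hom_ext _ hm.symm
    rw [h3, Category.assoc, Category.assoc, h1, comp_zero, comp_zero]
  obtain ⟨r, hr⟩ := hk.pair.exists_desc (J.map q) h2
  exact ⟨Q, q, r, ⟨_, _, hq', Functor.obj_mem_essImage _ _⟩, hr⟩

/-- Objects of `Ind(PB)` lift along `J`, together with a given presentation. -/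
theorem exists_lift_isIndOf {I : Type w} [PartialOrder I] [IsDirectedOrder I] [Nonempty I]
    (hI : Cardinal.mk I ≤ κ) {Z : I ⥤ B} (hZ : IsRelIndDiagram EB PB Z)
    (hZ' : ∀ i, PB (Z.obj i)) {W : RelInd EB PB κ} {z : ∀ i, (lexYoneda.{w} EB).obj (Z.obj i) ⟶ W.obj}
    (hz : IsPres Z W.obj z) :
    ∃ (X : I ⥤ A) (e : X ⋙ φ ≅ Z) (F : RelInd EA PA κ) (x : ∀ i, (lexYoneda.{w} EA).obj (X.obj i) ⟶ F.obj)
      (a : J.obj F ≅ W), IsRelIndDiagram EA PA X ∧ IsPres X F.obj x ∧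
        ∀ i, transferHom hκ α x i ≫ a.hom.hom = (lexYoneda.{w} EB).map (e.hom.app i) ≫ z i := by
  obtain ⟨X, ⟨e⟩, hX⟩ := h.exists_lift_diagram hZ hZ'
  obtain ⟨F', x, hx⟩ := exists_isPres h.isExact_source h.extensionClosed_source hX
  let F : RelInd EA PA κ := ⟨F', (isRelInd_iff h.isExact_source h.extensionClosed_source).2
    ⟨I, _, ‹_›, ‹_›, X, x, hI, hX, hx⟩⟩
  obtain ⟨a, ha⟩ := (isPres_of_preserves h hκ α hJ (F := F) hI hX hx).exists_iso
    h.isExact_target (hz.of_natIso e)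
  exact ⟨X, e, F, x, ⟨ObjectProperty.homMk a.hom, ObjectProperty.homMk a.inv,
    ObjectProperty.hom_ext _ a.hom_inv_id, ObjectProperty.hom_ext _ a.inv_hom_id⟩, hX, hx, ha⟩

/-- Conflations whose outer terms are in `Ind(PB)` lift along `J`. -/
theorem exists_lift_conf {X Y Z : RelInd EB PB κ} {f : X ⟶ Y} {g : Y ⟶ Z}
    (hfg : (relIndClass EB PB κ).Conf f g) (hX : IsIndOf PB κ X.obj) (hZ : IsIndOf PB κ Z.obj) :
    ∃ (X' Y' Z' : RelInd EA PA κ) (f' : X' ⟶ Y') (g' : Y' ⟶ Z') (a : J.obj X' ≅ X)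
      (b : J.obj Y' ≅ Y) (c : J.obj Z' ≅ Z), (relIndClass EA PA κ).Conf f' g' ∧
      J.map f' ≫ b.hom = a.hom ≫ f ∧ J.map g' ≫ c.hom = b.hom ≫ g := by
  have := h.full
  have := h.faithful
  have := indExtension_full h hκ α hJ
  rw [relIndClass_conf_iff h.isExact_target] at hfg
  obtain ⟨I, _, _, _, X₁, x₁, hI, hX₁, hx₁, hPX⟩ := hX
  obtain ⟨I', _, _, _, Z₁, z₁, hI', hZ₁, hz₁, hPZ⟩ := hZ
  -- Straightening reuses the given outer terms, which lie in `PB`; by extension closure so do the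
  -- middle terms, and the whole presentation lifts to `A`.
  obtain ⟨d, hdX, hdZ⟩ := exists_confPres h.isExact_target h.extensionClosed_target hκ hfg
    hI hI' hX₁ hZ₁ hx₁ hz₁
  have hPX' (k) : PB (d.X.obj k) := by
    obtain ⟨i, hi⟩ := hdX k
    rw [hi]
    exact hPX i
  have hPZ' (k) : PB (d.Z.obj k) := by
    obtain ⟨i, hi⟩ := hdZ k
    rw [hi]
    exact hPZ i
  have hPY' (k) : PB (d.Y.obj k) :=
    h.extensionClosed_target.extension _ _ (d.conf k) (hPX' k) (hPZ' k)
  obtain ⟨X₂, eX, X', x', a, hX₂, hx', ha⟩ :=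
    exists_lift_isIndOf h hκ α hJ d.card_le d.diagX hPX' d.presX
  obtain ⟨Y₂, eY, Y', y', b, hY₂, hy', hb⟩ :=
    exists_lift_isIndOf h hκ α hJ d.card_le d.diagY hPY' d.presY
  obtain ⟨Z₂, eZ, Z', z', c, hZ₂, hz', hc⟩ :=
    exists_lift_isIndOf h hκ α hJ d.card_le d.diagZ hPZ' d.presZ
  let u (k : d.K) : X₂.obj k ⟶ Y₂.obj k :=
    φ.preimage (eX.hom.app k ≫ d.u.app k ≫ eY.inv.app k)
  let v (k : d.K) : Y₂.obj k ⟶ Z₂.obj k :=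
    φ.preimage (eY.hom.app k ≫ d.v.app k ≫ eZ.inv.app k)
  obtain ⟨f', hf'⟩ := J.map_surjective (a.hom ≫ f ≫ b.inv)
  obtain ⟨g', hg'⟩ := J.map_surjective (b.hom ≫ g ≫ c.inv)
  have hconf (k) : EA.Conf (u k) (v k) := by
    rw [h.conf_iff]
    refine h.isExact_target.conf_of_iso (eX.app k).symm (eY.app k).symm (eZ.app k).symm ?_ ?_
      (d.conf k) <;> simp [u, v]
  -- Two sections of `G` can be compared after `J`, by `IsPres.agree_of_map`; there the equality is
  -- the corresponding square in Ind(B, PB).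
  have lift {S T : d.K ⥤ A} {S₁ T₁ : d.K ⥤ B} {F G : RelInd EA PA κ} {F₁ G₁ : RelInd EB PB κ}
      {s : ∀ k, (lexYoneda.{w} EA).obj (S.obj k) ⟶ F.obj} {t : ∀ k, (lexYoneda.{w} EA).obj (T.obj k) ⟶ G.obj}
      {s₁ : ∀ k, (lexYoneda.{w} EB).obj (S₁.obj k) ⟶ F₁.obj} {t₁ : ∀ k, (lexYoneda.{w} EB).obj (T₁.obj k) ⟶ G₁.obj}
      (eS : S ⋙ φ ≅ S₁) (eT : T ⋙ φ ≅ T₁) {a : J.obj F ≅ F₁} {b : J.obj G ≅ G₁}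
      (hT : IsRelIndDiagram EA PA T) (ht : IsPres T G.obj t)
      (ha : ∀ k, transferHom hκ α s k ≫ a.hom.hom = (lexYoneda.{w} EB).map (eS.hom.app k) ≫ s₁ k)
      (hb : ∀ k, transferHom hκ α t k ≫ b.hom.hom = (lexYoneda.{w} EB).map (eT.hom.app k) ≫ t₁ k)
      {f : F ⟶ G} {f₁ : F₁ ⟶ G₁} (hf : J.map f ≫ b.hom = a.hom ≫ f₁)
      {k : d.K} {m : S.obj k ⟶ T.obj k} {m₁ : S₁.obj k ⟶ T₁.obj k}
      (hm : φ.map m ≫ eT.hom.app k = eS.hom.app k ≫ m₁)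
      (h₁ : s₁ k ≫ f₁.hom = (lexYoneda.{w} EB).map m₁ ≫ t₁ k) : s k ≫ f.hom = (lexYoneda.{w} EA).map m ≫ t k := by
    obtain ⟨j, n, hn⟩ := ht.cover (s k ≫ f.hom)
    rw [← hn]
    refine ht.agree_of_map (isPres_of_preserves h hκ α hJ d.card_le hT ht) ?_
    rw [← transferHom_map hκ α hn.symm]
    have hf' : (J.map f).hom ≫ b.hom.hom = a.hom.hom ≫ f₁.hom :=
      congrArg InducedCategory.Hom.hom hf
    have : Mono b.hom.hom := inferInstanceAs (Mono ((isRelInd EB PB κ).ι.map b.hom))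
    rw [← cancel_mono b.hom.hom, Category.assoc, hf', Category.assoc, hb, ← Category.assoc, ha,
      Category.assoc, h₁, ← Functor.map_comp_assoc, ← Functor.map_comp_assoc, hm]
  have hf'' : J.map f' ≫ b.hom = a.hom ≫ f := by simp [hf']
  have hg'' : J.map g' ≫ c.hom = b.hom ≫ g := by simp [hg']
  refine ⟨X', Y', Z', f', g', a, b, c, ?_, hf'', hg''⟩
  rw [relIndClass_conf_iff h.isExact_source]
  exact LexExact.of_isPres h.isExact_source hx' hy' hz' u v hconf
    (fun k => (lift eX eY hY₂ hy' ha hb hf'' (by simp [u]) (d.map_u k).symm).symm)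
    (fun k => lift eY eZ hZ₂ hz' hb hc hg'' (by simp [v]) (d.map_v k))

end

end RelTate
end

/-! ### The induced functor on the quotients. -/

noncomputable section
namespace RelTate

theorem exists_toQuot_obj_eq {U : Type u₁} [Category.{v₁} U] [Preadditive U]
    {EU : ConflationClass U} {A : ObjectProperty U} (X : Quot EU A) :
    ∃ X', (toQuot EU A).obj X' = X :=
  (Localization.Construction.objEquiv (weakIso EU A)).surjective X

/-- A criterion for the functor induced by `J` on the localizations to be fully faithful. -/
theorem full_faithful_of_refinement {U : Type u₁} [Category.{v₁} U] [Preadditive U]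
    {EU : ConflationClass U} {A : ObjectProperty U} {V : Type u₂} [Category.{v₂} V]
    [Preadditive V] {EV : ConflationClass V} {B : ObjectProperty V} (hU : EU.IsExact)
    (hA : IsFilteringSerre EU A) (hV : EV.IsExact) (hB : IsFilteringSerre EV B) {J : U ⥤ V}
    [J.Full] [J.Faithful] (F : Quot EU A ⥤ Quot EV B)
    (e : toQuot EU A ⋙ F ≅ J ⋙ toQuot EV B)
    (hJ : ∀ ⦃X : U⦄ ⦃W : V⦄ (s : J.obj X ⟶ W), serreDeflation EV B s →
      ∃ (Q : U) (q : X ⟶ Q) (r : W ⟶ J.obj Q), serreDeflation EU A q ∧ s ≫ r = J.map q) :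
    F.Full ∧ F.Faithful := by
  have := hA.hasLeftCalculusOfFractions hU
  have := hA.toQuot_isLocalization hU
  have := hB.hasLeftCalculusOfFractions hV
  have := hB.toQuot_isLocalization hV
  have he {X Y : U} (f : X ⟶ Y) : F.map ((toQuot EU A).map f) =
      e.hom.app X ≫ (toQuot EV B).map (J.map f) ≫ e.inv.app Y :=
    (NatIso.naturality_2 e f).symm
  constructor
  · refine ⟨fun {X Y} g => ?_⟩
    obtain ⟨X, rfl⟩ := exists_toQuot_obj_eq X
    obtain ⟨Y, rfl⟩ := exists_toQuot_obj_eq Y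
    obtain ⟨W, m, s, hs, hm⟩ := exists_fraction (toQuot EV B)
      (e.inv.app X ≫ g ≫ e.hom.app Y : (toQuot EV B).obj (J.obj X) ⟶ (toQuot EV B).obj (J.obj Y))
    -- The denominator `s` is enlarged to `J.map q`, so the fraction lives between objects in the
    -- image of `J`, where fullness applies.
    obtain ⟨Q, q, r, hq, hr⟩ := hJ s hs
    obtain ⟨n, hn⟩ := J.map_surjective (m ≫ r)
    have := isIso_of_serreDeflation (toQuot EU A) hq
    refine ⟨(toQuot EU A).map n ≫ inv ((toQuot EU A).map q), ?_⟩
    rw [← cancel_mono (F.map ((toQuot EU A).map q)), ← F.map_comp, Category.assoc,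
      IsIso.inv_hom_id, Category.comp_id, he, he, hn, ← hr, Functor.map_comp, Functor.map_comp,
      ← hm]
    simp
  · refine ⟨fun {X Y} f f' hff => ?_⟩
    obtain ⟨X, rfl⟩ := exists_toQuot_obj_eq X
    obtain ⟨Y, rfl⟩ := exists_toQuot_obj_eq Y
    obtain ⟨ψ, h1, h2⟩ := Localization.exists_leftFraction₂ (toQuot EU A) (serreDeflation EU A) f f'
    have h3 : f ≫ (toQuot EU A).map ψ.s = (toQuot EU A).map ψ.f := by
      rw [h1]
      exact ψ.fst.map_comp_map_s _ _
    have h4 : f' ≫ (toQuot EU A).map ψ.s = (toQuot EU A).map ψ.f' := by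
      rw [h2]
      exact ψ.snd.map_comp_map_s _ _
    have := isIso_of_serreDeflation (toQuot EU A) ψ.hs
    have h5 : (toQuot EV B).map (J.map ψ.f) = (toQuot EV B).map (J.map ψ.f') := by
      have h6 : F.map ((toQuot EU A).map ψ.f) = F.map ((toQuot EU A).map ψ.f') := by
        rw [← h3, ← h4, F.map_comp, F.map_comp, hff]
      rw [he, he] at h6
      exact (cancel_mono (e.inv.app ψ.Y')).1 ((cancel_epi (e.hom.app X)).1 h6)
    obtain ⟨W, s, hs, h6⟩ :=
      (MorphismProperty.map_eq_iff_postcomp (toQuot EV B) (serreDeflation EV B) _ _).1 h5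
    obtain ⟨Q, q, r, hq, hr⟩ := hJ s hs
    have h7 : ψ.f ≫ q = ψ.f' ≫ q := J.map_injective (by
      rw [J.map_comp, J.map_comp, ← hr, reassoc_of% h6])
    rw [← cancel_mono ((toQuot EU A).map ψ.s), h3, h4]
    exact (MorphismProperty.map_eq_iff_postcomp (toQuot EU A) (serreDeflation EU A) _ _).2
      ⟨Q, q, hq, h7⟩

section

variable {A : Type u₁} [Category.{v₁} A] [Preadditive A] {EA : ConflationClass A}
  {PA : ObjectProperty A} {B : Type u₂} [Category.{v₂} B] [Preadditive B]
  {EB : ConflationClass B} {PB : ObjectProperty B} {κ : Cardinal.{w}} {φ : A ⥤ B}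

theorem IsIndTransfer.exact (h : IsIndTransfer EA PA EB PB φ) (hκ : Cardinal.aleph0 ≤ κ)
    {J : RelInd EA PA κ ⥤ RelInd EB PB κ} (hJ : IsIndExtension EA PA EB PB hκ φ J) :
    IsExactFunctor (relIndClass EA PA κ) (relIndClass EB PB κ) J := by
  obtain ⟨⟨α⟩, hJ⟩ := hJ
  exact indExtension_exact h hκ α hJ

/-- Dividing out one stage replaces objects and conflations of the target by ones built from unions
of objects of `PB`, and these lift to `A`. Full faithfulness comes from the domination of
denominators. -/
theorem IsIndTransfer.inducesExactEquivalence (h : IsIndTransfer EA PA EB PB φ)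
    (hκ : Cardinal.aleph0 ≤ κ) {J : RelInd EA PA κ ⥤ RelInd EB PB κ}
    (hJ : IsIndExtension EA PA EB PB hκ φ J) :
    InducesExactEquivalence (relIndClass EA PA κ) (toRelInd EA PA hκ).essImage
      (relIndClass EB PB κ) (toRelInd EB PB hκ).essImage J := by
  obtain ⟨⟨α⟩, hJ⟩ := hJ
  have hU := relIndClass_isExact h.isExact_source h.extensionClosed_source hκ
  have hV := relIndClass_isExact h.isExact_target h.extensionClosed_target hκ
  have hA := isFilteringSerre_toRelInd h.isExact_source h.extensionClosed_source hκ
  have hB := isFilteringSerre_toRelInd h.isExact_target h.extensionClosed_target hκ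
  have := hA.toQuot_isLocalization hU
  have := hB.toQuot_isLocalization hV
  have := indExtension_full h hκ α hJ
  have := indExtension_faithful h hκ α hJ
  let LA := toQuot (relIndClass EA PA κ) (toRelInd EA PA hκ).essImage
  let LB := toQuot (relIndClass EB PB κ) (toRelInd EB PB hκ).essImage
  let SA := serreDeflation (relIndClass EA PA κ) (toRelInd EA PA hκ).essImage
  have hinv : SA.IsInvertedBy (J ⋙ LB) := fun _ _ f hf =>
    isIso_of_serreDeflation LB (serreDeflation_indExtension h hκ α hJ hf)
  let F := Localization.lift (J ⋙ LB) hinv LA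
  let e : LA ⋙ F ≅ J ⋙ LB := Localization.fac (J ⋙ LB) hinv LA
  obtain ⟨hfull, hfaithful⟩ := full_faithful_of_refinement hU hA hV hB F e
    (fun _ _ _ hs => exists_refinement_indExtension h hκ α hJ hs)
  have hess : F.EssSurj := by
    refine ⟨fun Y => ?_⟩
    obtain ⟨Y, rfl⟩ := exists_toQuot_obj_eq Y
    obtain ⟨Y₁, a, ha, I, _, _, _, Z, z, hI, hZ, hz, hZ'⟩ :=
      exists_isIndOf_quotient_obj h.isExact_target h.extensionClosed_target hκ Y
    obtain ⟨X, -, X', x, b, -⟩ := exists_lift_isIndOf h hκ α hJ hI hZ hZ' hz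
    have := isIso_of_serreDeflation LB ha
    exact ⟨LA.obj X', ⟨e.app X' ≪≫ LB.mapIso b ≪≫ (asIso (LB.map a)).symm⟩⟩
  refine ⟨F, ⟨e⟩, ⟨hfaithful, hfull, hess⟩, fun X Y Z f g => ⟨?_, ?_⟩⟩
  · rintro ⟨X', Y', Z', f', g', a, b, c, hc, h1, h2⟩
    refine ⟨J.obj X', J.obj Y', J.obj Z', J.map f', J.map g', (e.app X').symm ≪≫ F.mapIso a,
      (e.app Y').symm ≪≫ F.mapIso b, (e.app Z').symm ≪≫ F.mapIso c,
      indExtension_exact h hκ α hJ _ _ hc, ?_, ?_⟩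
    · have := e.inv.naturality f'
      simp only [Iso.trans_hom, Iso.symm_hom, Iso.app_inv, Functor.mapIso_hom, Category.assoc]
      rw [← F.map_comp, ← h1, F.map_comp, ← Category.assoc, ← Category.assoc]
      exact congrArg (· ≫ F.map b.hom) this
    · have := e.inv.naturality g'
      simp only [Iso.trans_hom, Iso.symm_hom, Iso.app_inv, Functor.mapIso_hom, Category.assoc]
      rw [← F.map_comp, ← h2, F.map_comp, ← Category.assoc, ← Category.assoc]
      exact congrArg (· ≫ F.map c.hom) this
  · rintro ⟨X', Y', Z', f', g', a, b, c, hc, h1, h2⟩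
    obtain ⟨X₁, Y₁, Z₁, f₁, g₁, a₁, b₁, c₁, hc₁, ha₁, hb₁, hcc₁, h3, h4, hX₁, hZ₁⟩ :=
      exists_isIndOf_quotient h.isExact_target h.extensionClosed_target hκ hc
    obtain ⟨X₂, Y₂, Z₂, f₂, g₂, a₂, b₂, c₂, hc₂, h5, h6⟩ :=
      exists_lift_conf h hκ α hJ hc₁ hX₁ hZ₁
    have := isIso_of_serreDeflation LB ha₁
    have := isIso_of_serreDeflation LB hb₁
    have := isIso_of_serreDeflation LB hcc₁
    -- The lifted object is compared with the given one through `e`, the lifting isomorphism, the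
    -- inverse of the dividing map and the given isomorphism; full faithfulness of `F` brings the
    -- composite back to the source quotient.
    let iso {S : RelInd EA PA κ} {T T' : RelInd EB PB κ} {R} (d : J.obj S ≅ T) (t : T' ⟶ T)
      [IsIso (LB.map t)] (r : LB.obj T' ≅ F.obj R) : LA.obj S ≅ R :=
      F.preimageIso (e.app S ≪≫ LB.mapIso d ≪≫ (asIso (LB.map t)).symm ≪≫ r)
    have key {S S' : RelInd EA PA κ} {T T' T₁ T₁' : RelInd EB PB κ} {R R'} {d : J.obj S ≅ T}
        {d' : J.obj S' ≅ T'} {t : T₁ ⟶ T} {t' : T₁' ⟶ T'} [IsIso (LB.map t)]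
        [IsIso (LB.map t')] {r : LB.obj T₁ ≅ F.obj R} {r' : LB.obj T₁' ≅ F.obj R'}
        {m : S ⟶ S'} {m₁ : T ⟶ T'} {m₂ : T₁ ⟶ T₁'} {m₃ : R ⟶ R'}
        (k1 : J.map m ≫ d'.hom = d.hom ≫ m₁) (k2 : m₂ ≫ t' = t ≫ m₁)
        (k3 : LB.map m₂ ≫ r'.hom = r.hom ≫ F.map m₃) :
        LA.map m ≫ (iso d' t' r').hom = (iso d t r).hom ≫ m₃ := by
      apply F.map_injective
      have k4 : LB.map m₁ ≫ inv (LB.map t') = inv (LB.map t) ≫ LB.map m₂ := by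
        rw [IsIso.comp_inv_eq, Category.assoc, ← LB.map_comp, k2, LB.map_comp,
          IsIso.inv_hom_id_assoc]
      have k5 : F.map (LA.map m) ≫ e.hom.app S' = e.hom.app S ≫ LB.map (J.map m) :=
        e.hom.naturality m
      have k6 : LB.map (J.map m) ≫ LB.map d'.hom = LB.map d.hom ≫ LB.map m₁ := by
        rw [← LB.map_comp, k1, LB.map_comp]
      simp only [iso, F.map_comp, Functor.preimageIso_hom, Functor.map_preimage, Iso.trans_hom,
        Iso.symm_hom, asIso_inv, Iso.app_hom, Functor.mapIso_hom, Category.assoc]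
      rw [reassoc_of% k5, reassoc_of% k6, reassoc_of% k4, k3]
    exact ⟨X₂, Y₂, Z₂, f₂, g₂, iso a₂ a₁ a, iso b₂ b₁ b, iso c₂ c₁ c, hc₂, key h5 h3 h1,
      key h6 h4 h2⟩

end

end RelTate
end

/-! ### The inclusions of C in D and of D in Pro(D) are transfers. -/

noncomputable section
namespace RelTate

variable {D : Type u} [Category.{v} D] [Preadditive D] {E : ConflationClass D}
  {P : ObjectProperty D} {κ : Cardinal.{w}}

theorem isExtensionClosed_top : E.IsExtensionClosed ⊤ where
  of_iso _ _ := trivial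
  zero _ := trivial
  extension _ _ _ _ _ := trivial

/-- Extension closed subcategories of exact categories are exact. -/
theorem restrict_isExact (hE : E.IsExact) (hP : E.IsExtensionClosed P) :
    (E.restrict P).IsExact where
  hasZeroObject := by
    obtain ⟨O, hO⟩ := hE.hasZeroObject
    refine ⟨⟨O, hP.zero hO⟩, ?_⟩
    rw [IsZero.iff_id_eq_zero]
    exact P.hom_ext (hO.eq_of_src _ _)
  hasBinaryBiproducts := by
    have := hE.hasBinaryBiproducts
    refine ⟨fun X Y => hasBinaryBiproduct_of_total
      { pt := ⟨X.obj ⊞ Y.obj, hP.extension _ _ (hE.conf_inl X.obj Y.obj) X.property Y.property⟩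
        fst := ObjectProperty.homMk biprod.fst
        snd := ObjectProperty.homMk biprod.snd
        inl := ObjectProperty.homMk biprod.inl
        inr := ObjectProperty.homMk biprod.inr
        inl_fst := P.hom_ext biprod.inl_fst
        inl_snd := P.hom_ext biprod.inl_snd
        inr_fst := P.hom_ext biprod.inr_fst
        inr_snd := P.hom_ext biprod.inr_snd } (P.hom_ext biprod.total)⟩
  conf_of_iso a b c h₁ h₂ h := hE.conf_of_iso (P.ι.mapIso a) (P.ι.mapIso b) (P.ι.mapIso c)
    (congrArg P.ι.map h₁) (congrArg P.ι.map h₂) h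
  inflation_id X := by
    obtain ⟨O, hO⟩ := hE.hasZeroObject
    exact ⟨⟨O, hP.zero hO⟩, 0, hE.conf_id_zero X.obj hO⟩
  deflation_id X := by
    obtain ⟨O, hO⟩ := hE.hasZeroObject
    exact ⟨⟨O, hP.zero hO⟩, 0, hE.conf_zero_id X.obj hO⟩
  inflation_comp := by
    rintro X Y Z f g ⟨A, p, hf⟩ ⟨B, q, hg⟩
    obtain ⟨Q, r, a, b, h1, h2, -⟩ := hE.conf_comp hf hg
    exact ⟨⟨Q, hP.extension _ _ h2 A.property B.property⟩, ObjectProperty.homMk r, h1⟩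
  deflation_comp := by
    rintro X Y Z f g ⟨A, p, hf⟩ ⟨B, q, hg⟩
    obtain ⟨Q, r, a, b, h1, h2, -⟩ := hE.conf_comp' hf hg
    exact ⟨⟨Q, hP.extension _ _ h2 A.property B.property⟩, ObjectProperty.homMk r, h1⟩
  exists_pushout := by
    rintro X Y X' i f ⟨Z, p, hi⟩
    obtain ⟨Y', f', i', p', h, hc, -⟩ := hE.exists_pushout_conf hi f.hom
    exact ⟨⟨Y', hP.extension _ _ hc X'.property Z.property⟩, ObjectProperty.homMk f',
      ObjectProperty.homMk i', IsPushout.of_map P.ι (P.hom_ext h.w) h, Z, ObjectProperty.homMk p',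
      hc⟩
  exists_pullback := by
    rintro Y Z Z' p f ⟨X, i, hp⟩
    obtain ⟨Y', f', p', i', h, hc, -⟩ := hE.exists_pullback_conf hp f.hom
    exact ⟨⟨Y', hP.extension _ _ hc X.property Z'.property⟩, ObjectProperty.homMk f',
      ObjectProperty.homMk p', IsPullback.of_map P.ι (P.hom_ext h.w) h, X, ObjectProperty.homMk i',
      hc⟩

theorem isIndTransfer_ι (hE : E.IsExact) (hP : E.IsExtensionClosed P) :
    IsIndTransfer (E.restrict P) ⊤ E P P.ι where
  isExact_source := restrict_isExact hE hP
  isExact_target := hE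
  extensionClosed_source := isExtensionClosed_top
  extensionClosed_target := hP
  full := inferInstance
  faithful := inferInstance
  conf_iff _ _ _ _ _ := Iff.rfl
  map_prop X _ := X.property
  exists_preimage Y hY := ⟨⟨Y, hY⟩, trivial, ⟨Iso.refl _⟩⟩

theorem proClass_isExact (hE : E.IsExact) (hκ : Cardinal.aleph0 ≤ κ) : (proClass E κ).IsExact :=
  (relIndClass_isExact hE.op isExtensionClosed_top hκ).op

instance (hκ : Cardinal.aleph0 ≤ κ) : (toPro E hκ).Full := by
  unfold toPro; infer_instance

instance (hκ : Cardinal.aleph0 ≤ κ) : (toPro E hκ).Faithful := by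
  unfold toPro; infer_instance

instance (hκ : Cardinal.aleph0 ≤ κ) : (toPro E hκ).PreservesZeroMorphisms where
  map_zero X Y := congrArg Quiver.Hom.op ((toRelInd E.op ⊤ hκ).map_zero (op Y) (op X))

theorem conf_toPro_iff (hE : E.IsExact) (hκ : Cardinal.aleph0 ≤ κ) {X Y Z : D} (f : X ⟶ Y)
    (g : Y ⟶ Z) : E.Conf f g ↔ (proClass E κ).Conf ((toPro E hκ).map f) ((toPro E hκ).map g) :=
  ⟨fun h => toRelInd_exact hE.op hκ g.op f.op (ConflationClass.op_op_conf.2 h), fun h =>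
    conf_of_toRelInd (f := g.op) (g := f.op) hE.op isExtensionClosed_top hκ h⟩

theorem essImage_toPro_iff (hκ : Cardinal.aleph0 ≤ κ) {X : ProCat E κ} :
    (toPro E hκ).essImage X ↔ (toRelInd E.op ⊤ hκ).essImage X.unop :=
  ⟨fun ⟨T, ⟨e⟩⟩ => ⟨op T, ⟨e.symm.unop⟩⟩, fun ⟨T, ⟨e⟩⟩ => ⟨T.unop, ⟨e.symm.op⟩⟩⟩

/-- An extension in Pro(D) of objects of C comes from D, by the dual of `essImage_toRelInd_conf`;
conflations being reflected, it is an extension in D, hence in C. -/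
theorem isExtensionClosed_map_toPro (hE : E.IsExact) (hP : E.IsExtensionClosed P)
    (hκ : Cardinal.aleph0 ≤ κ) : (proClass E κ).IsExtensionClosed (P.map (toPro E hκ)) where
  of_iso e h := (P.map (toPro E hκ)).prop_of_iso e h
  zero {X} hX := by
    obtain ⟨O, hO⟩ := hE.hasZeroObject
    exact (P.map (toPro E hκ)).prop_of_iso (((toPro E hκ).map_isZero hO).iso hX)
      (P.prop_map_obj _ (hP.zero hO))
  extension {X Y Z} f g h hX hZ := by
    rw [ObjectProperty.prop_map_iff] at hX hZ
    obtain ⟨A, hA, ⟨a⟩⟩ := hX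
    obtain ⟨C, hC, ⟨c⟩⟩ := hZ
    obtain ⟨B, ⟨b⟩⟩ : (toPro E hκ).essImage Y := (essImage_toPro_iff hκ).2
      ((essImage_toRelInd_conf hE.op isExtensionClosed_top hκ h).2
        ⟨(essImage_toPro_iff hκ).1 ⟨C, ⟨c⟩⟩, (essImage_toPro_iff hκ).1 ⟨A, ⟨a⟩⟩⟩)
    have h' : E.Conf ((toPro E hκ).preimage (a.hom ≫ f ≫ b.inv))
        ((toPro E hκ).preimage (b.hom ≫ g ≫ c.inv)) := by
      rw [conf_toPro_iff hE hκ]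
      refine (proClass_isExact hE hκ).conf_of_iso a.symm b.symm c.symm ?_ ?_ h <;> simp
    exact (P.map (toPro E hκ)).prop_of_iso b (P.prop_map_obj _ (hP.extension _ _ h' hA hC))

theorem isIndTransfer_toPro (hE : E.IsExact) (hP : E.IsExtensionClosed P)
    (hκ : Cardinal.aleph0 ≤ κ) :
    IsIndTransfer E P (proClass E κ) (P.map (toPro E hκ)) (toPro E hκ) where
  isExact_source := hE
  isExact_target := proClass_isExact hE hκ
  extensionClosed_source := hP
  extensionClosed_target := isExtensionClosed_map_toPro hE hP hκ
  full := inferInstance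
  faithful := inferInstance
  conf_iff _ _ _ f g := conf_toPro_iff hE hκ f g
  map_prop _ hX := P.prop_map_obj _ hX
  exists_preimage _ hY := by
    rw [ObjectProperty.prop_map_iff] at hY
    exact hY

end RelTate
end

theorem mainTheorem8 {D : Type u} [Category.{v} D] [Preadditive D]
    (E : RelTate.ConflationClass D) (hE : E.IsExact)
    (P : ObjectProperty D) (hP : E.IsExtensionClosed P)
    (κ : Cardinal.{w}) (hκ : Cardinal.aleph0 ≤ κ) :
    -- `D ⊂ Ind(D, C)` and `Pro(D) ⊂ Tate^el(D, C)` are left s-filtering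
    RelTate.IsLeftSFiltering E (RelTate.relIndClass E P κ) (RelTate.toRelInd E P hκ) ∧
    RelTate.IsLeftSFiltering (RelTate.proClass E κ) (RelTate.elTateClass E P hκ)
      (RelTate.proToElTate E P hκ) ∧
    -- the quotients `Ind(C)/C`, `Ind(D, C)/D` and `Tate^el(D, C)/Pro(D)` are exact categories
    RelTate.QuotIsExact (RelTate.relIndClass (E.restrict P) ⊤ κ)
      (RelTate.toRelInd (E.restrict P) ⊤ hκ).essImage ∧
    RelTate.QuotIsExact (RelTate.relIndClass E P κ) (RelTate.toRelInd E P hκ).essImage ∧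
    RelTate.QuotIsExact (RelTate.elTateClass E P hκ) (RelTate.proToElTate E P hκ).essImage ∧
    -- the natural functors `J₁ : Ind(C) ⥤ Ind(D, C)` and `J₂ : Ind(D, C) ⥤ Tate^el(D, C)` exist,
    (∃ J₁ : RelTate.RelInd (E.restrict P) ⊤ κ ⥤ RelTate.RelInd E P κ,
      RelTate.IsIndExtension (E.restrict P) ⊤ E P hκ P.ι J₁) ∧
    (∃ J₂ : RelTate.RelInd E P κ ⥤ RelTate.ElTate E P hκ,
      RelTate.IsIndExtension E P (RelTate.proClass E κ) (P.map (RelTate.toPro E hκ)) hκ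
        (RelTate.toPro E hκ) J₂) ∧
    -- they are exact and induce exact equivalences of the quotients
    (∀ J₁ : RelTate.RelInd (E.restrict P) ⊤ κ ⥤ RelTate.RelInd E P κ,
      RelTate.IsIndExtension (E.restrict P) ⊤ E P hκ P.ι J₁ →
      RelTate.IsExactFunctor (RelTate.relIndClass (E.restrict P) ⊤ κ)
        (RelTate.relIndClass E P κ) J₁ ∧
      RelTate.InducesExactEquivalence (RelTate.relIndClass (E.restrict P) ⊤ κ)
        (RelTate.toRelInd (E.restrict P) ⊤ hκ).essImage
        (RelTate.relIndClass E P κ) (RelTate.toRelInd E P hκ).essImage J₁) ∧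
    (∀ J₂ : RelTate.RelInd E P κ ⥤ RelTate.ElTate E P hκ,
      RelTate.IsIndExtension E P (RelTate.proClass E κ) (P.map (RelTate.toPro E hκ)) hκ
        (RelTate.toPro E hκ) J₂ →
      RelTate.IsExactFunctor (RelTate.relIndClass E P κ) (RelTate.elTateClass E P hκ) J₂ ∧
      RelTate.InducesExactEquivalence (RelTate.relIndClass E P κ)
        (RelTate.toRelInd E P hκ).essImage
        (RelTate.elTateClass E P hκ) (RelTate.proToElTate E P hκ).essImage J₂) := by
  have hC := RelTate.isIndTransfer_ι hE hP
  have hT := RelTate.isIndTransfer_toPro hE hP hκ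
  exact ⟨RelTate.toRelInd_isLeftSFiltering hE hP hκ,
    -- Tate^el(D, C) is by definition Ind(Pro(D), C), so the general results apply with Pro(D) in
    -- place of D.
    RelTate.toRelInd_isLeftSFiltering hT.isExact_target hT.extensionClosed_target hκ,
    (RelTate.isFilteringSerre_toRelInd hC.isExact_source hC.extensionClosed_source hκ).quotIsExact
      (RelTate.relIndClass_isExact hC.isExact_source hC.extensionClosed_source hκ),
    (RelTate.isFilteringSerre_toRelInd hE hP hκ).quotIsExact
      (RelTate.relIndClass_isExact hE hP hκ),
    (RelTate.isFilteringSerre_toRelInd hT.isExact_target hT.extensionClosed_target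
      hκ).quotIsExact (RelTate.relIndClass_isExact hT.isExact_target hT.extensionClosed_target hκ),
    ⟨_, hC.isIndExtension_indFunctor hκ⟩, ⟨_, hT.isIndExtension_indFunctor hκ⟩,
    fun _ hJ => ⟨hC.exact hκ hJ, hC.inducesExactEquivalence hκ hJ⟩,
    fun _ hJ => ⟨hT.exact hκ hJ, hT.inducesExactEquivalence hκ hJ⟩⟩
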